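/- Let $P \subset \mathbb{R}^d$ be a $d$-dimensional parallelohedron, that is, a $d$-dimensional convex polytope whose translates tile $\mathbb{R}^d$ normally (face-to-face: any two cells of the tiling are either disjoint or meet in a common face), and let $\mathcal{T}_P$ be such a tiling. A scaling of $\mathcal{T}_P$ is a function $s$ that assigns a positive real number to every hyperface (that is, $(d-1)$-dimensional face) of the tiling. For a $(d-2)$-dimensional face $G$ of the tiling let $F_1, \dots, F_k$ be all hyperfaces of the tiling that contain $G$; choose one of the two directions of traversal around $G$ (in the two-dimensional plane orthogonal to the affine hull of $G$), and let $\mathbf{n}_i$ be the unit normal to $F_i$ that points in this direction. The torsion of $s$ around $G$ is $$\Delta_s(G) = \sum_{i=1}^k s(F_i)\,\mathbf{n}_i ,$$ which is defined up to sign. The scaling $s$ is called canonical if $\Delta_s(G) = 0$ for every $(d-2)$-face $G$ of the tiling, and translation invariant if $s(F + v) = s(F)$ for every hyperface $F$ and every vector $v$ such that the translation by $v$ maps $\mathcal{T}_P$ onto itself. If $\mathcal{T}_P$ has a canonical scaling, then $\mathcal{T}_P$ also has a canonical scaling that is translation invariant. -/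

import Mathlib

open scoped Pointwise

namespace Parallelohedra

/-- `F` is a nonempty face (of any dimension, the improper face `C` included) of the convex
polytope `C`: the set of maximizers on `C` of some linear functional. -/
def IsFace {d : ℕ} (C F : Set (EuclideanSpace ℝ (Fin d))) : Prop :=
  F.Nonempty ∧ IsExposed ℝ C F

/-- `P` is a `d`-dimensional convex polytope and `𝒯` is the set of cells of a normal
(face-to-face) tiling of `ℝ^d` by translates of `P`; thus `P` is a parallelohedron. -/
structure IsParallelohedronTiling {d : ℕ} (P : Set (EuclideanSpace ℝ (Fin d)))
    (𝒯 : Set (Set (EuclideanSpace ℝ (Fin d)))) : Prop where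
  polytope : ∃ V : Set (EuclideanSpace ℝ (Fin d)), V.Finite ∧ P = convexHull ℝ V
  full_dimensional : (interior P).Nonempty
  translates : ∀ C ∈ 𝒯, ∃ v : EuclideanSpace ℝ (Fin d), C = v +ᵥ P
  covers : ⋃₀ 𝒯 = Set.univ
  disjoint_interiors : ∀ C ∈ 𝒯, ∀ C' ∈ 𝒯, C ≠ C' → Disjoint (interior C) (interior C')
  face_to_face : ∀ C ∈ 𝒯, ∀ C' ∈ 𝒯, (C ∩ C').Nonempty →
    IsFace C (C ∩ C') ∧ IsFace C' (C ∩ C')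

/-- The faces of dimension `d - j` of the tiling `𝒯` of `ℝ^d` (none if `d < j`). -/
def facesOfCodim {d : ℕ} (𝒯 : Set (Set (EuclideanSpace ℝ (Fin d)))) (j : ℕ) :
    Set (Set (EuclideanSpace ℝ (Fin d))) :=
  {F | (∃ C ∈ 𝒯, IsFace C F) ∧ Module.finrank ℝ (vectorSpan ℝ F) + j = d}

/-- The hyperfaces, i.e. the `(d-1)`-dimensional faces, of the tiling. -/
abbrev hyperfaces {d : ℕ} (𝒯 : Set (Set (EuclideanSpace ℝ (Fin d)))) :
    Set (Set (EuclideanSpace ℝ (Fin d))) :=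
  facesOfCodim 𝒯 1

/-- `e 0, e 1` is an orthonormal basis of the two-dimensional plane complementary to the affine
hull of the `(d-2)`-face `G`. The rotation from `e 0` to `e 1` is one of the two directions of
traversal around `G`; the basis `e 1, e 0` gives the opposite one. -/
def IsTraversalFrame {d : ℕ} (G : Set (EuclideanSpace ℝ (Fin d)))
    (e : Fin 2 → EuclideanSpace ℝ (Fin d)) : Prop :=
  Orthonormal ℝ e ∧ Submodule.span ℝ (Set.range e) = (vectorSpan ℝ G)ᗮ

/-- `n` is the unit normal to the hyperface `F ⊇ G` that points in the direction of traversal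
around `G` given by `e`: in the plane of `e`, into which `F` is projected as a segment issuing
from the projection of `G`, each vector from the latter along the former makes with `n` a
positively oriented pair. -/
structure IsTraversalNormal {d : ℕ} (e : Fin 2 → EuclideanSpace ℝ (Fin d))
    (G F : Set (EuclideanSpace ℝ (Fin d))) (n : EuclideanSpace ℝ (Fin d)) : Prop where
  unit : ‖n‖ = 1
  normal : n ∈ (vectorSpan ℝ F)ᗮ
  oriented : ∀ y ∈ G, ∀ x ∈ F \ G,
    0 < inner ℝ (e 0) (x - y) * inner ℝ (e 1) n - inner ℝ (e 1) (x - y) * inner ℝ (e 0) n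

/-- `τ` is the torsion of the scaling `s` around the `(d-2)`-face `G`, for one of the two
directions of traversal (`F` lists all hyperfaces of the tiling that contain `G`; the sum does
not depend on the order). The torsion is defined up to sign. -/
def IsTorsion {d : ℕ} (𝒯 : Set (Set (EuclideanSpace ℝ (Fin d)))) (s : hyperfaces 𝒯 → ℝ)
    (G : Set (EuclideanSpace ℝ (Fin d))) (τ : EuclideanSpace ℝ (Fin d)) : Prop :=
  ∃ e : Fin 2 → EuclideanSpace ℝ (Fin d), IsTraversalFrame G e ∧
    ∃ (k : ℕ) (F : Fin k ≃ {F : hyperfaces 𝒯 // G ⊆ (F : Set (EuclideanSpace ℝ (Fin d)))})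
      (n : Fin k → EuclideanSpace ℝ (Fin d)),
      (∀ i, IsTraversalNormal e G ((F i).1 : Set (EuclideanSpace ℝ (Fin d))) (n i)) ∧
      τ = ∑ i, s (F i).1 • n i

/-- A canonical scaling of the tiling: a positive function on the hyperfaces with zero torsion
around every `(d-2)`-face. -/
def IsCanonicalScaling {d : ℕ} (𝒯 : Set (Set (EuclideanSpace ℝ (Fin d))))
    (s : hyperfaces 𝒯 → ℝ) : Prop :=
  (∀ F, 0 < s F) ∧ ∀ G ∈ facesOfCodim 𝒯 2, IsTorsion 𝒯 s G 0

/-- The vectors of the translations that map the tiling onto itself. -/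
def translationVectors {d : ℕ} (𝒯 : Set (Set (EuclideanSpace ℝ (Fin d)))) :
    Set (EuclideanSpace ℝ (Fin d)) :=
  {v | (fun C : Set (EuclideanSpace ℝ (Fin d)) => v +ᵥ C) '' 𝒯 = 𝒯}

/-- The scaling takes the same value on `F` and on `v + F` for every hyperface `F` and every
translation by `v` that preserves the tiling. -/
def IsTranslationInvariant {d : ℕ} (𝒯 : Set (Set (EuclideanSpace ℝ (Fin d))))
    (s : hyperfaces 𝒯 → ℝ) : Prop :=
  ∀ v ∈ translationVectors 𝒯, ∀ F F' : hyperfaces 𝒯,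
    (F' : Set (EuclideanSpace ℝ (Fin d))) = v +ᵥ (F : Set (EuclideanSpace ℝ (Fin d))) →
      s F' = s F

end Parallelohedra

/-! Because all cells are translates of one polytope, at most four hyperfaces meet at a (d-2)-face.
If there are three, the linear relation between their unit normals is unique up to a factor; if
there are four, the normals form two opposite pairs, and every relation has equal coefficients
within a pair (`torsion_dichotomy`). So vanishing torsion only prescribes ratios. Call two
hyperfaces linked if the ratio of their values is the same for all canonical scalings (`IsLinked`).
A positive function that reproduces the ratios of one canonical scaling on all linked pairs is then
canonical itself (`isCanonicalScaling_of_isLinked`).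

The heart of the matter is that a linked pair F, v + F has ratio 1 (`IsLinked.eq_of_vadd`). Let r =
s(v + F) / s(F), which does not depend on s. Translating s by -v gives s(F) / s(-v + F) = r. A point
reflection of the tiling that maps F to itself exchanges v + F and -v + F, which gives s(-v + F) /
s(F) = r. Hence r = 1/r, and r = 1 by positivity. Now choose one representative in every class of
the relation "linked with a translate of" and let s'(F) be the value of s on a translate of F linked
with the representative. The choice of the translate is immaterial, so s' is translation invariant
and keeps the ratios on linked pairs.

The reflection exists because P is centrally symmetric (Minkowski): the midpoint of the centres of
two adjacent cells is a symmetry centre of the tiling and of their common hyperface. For the central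
symmetry, a cell is a fundamental domain of the lattice generated by the facet vectors, and the
interior of P - P contains no nonzero lattice vector. Minkowski's convex body theorem then bounds
the volume of (P - P)/2 by that of P. This is equality in the Brunn–Minkowski inequality for P and
-P, and it forces P to be symmetric about its centroid (`exists_center_of_measure_le`). -/

section BrunnMinkowski

/-! ### The Brunn–Minkowski inequality with equal weights -/

open MeasureTheory Set

/-- The translates of `A` by `inf B` and of `B` by `sup A` both lie in `A + B` and share only the
point `sup A + inf B`. -/
theorem Real.volume_add_volume_le_volume_add {A B : Set ℝ} (hA : IsCompact A) (hB : IsCompact B)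
    (hA' : A.Nonempty) (hB' : B.Nonempty) : volume A + volume B ≤ volume (A + B) := by
  have ha := hA.sSup_mem hA'
  have hb := hB.sInf_mem hB'
  set a := sSup A
  set b := sInf B
  have h1 : volume A = volume ((fun x => x + b) '' A) := by simp
  have h2 : volume B = volume ((fun x => a + x) '' B) := by simp
  have hm : MeasurableSet ((fun x => a + x) '' B) :=
    (hB.image (by fun_prop)).measurableSet
  have hd : AEDisjoint volume ((fun x => x + b) '' A) ((fun x => a + x) '' B) := by
    refine measure_mono_null (t := {a + b}) ?_ (by simp)
    rintro _ ⟨⟨x, hx, rfl⟩, y, hy, hxy⟩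
    have h3 : x ≤ a := le_csSup hA.bddAbove hx
    have h4 : b ≤ y := csInf_le hB.bddBelow hy
    simp only [mem_singleton_iff]
    simp only at hxy
    linarith
  rw [h1, h2, ← measure_union₀ hm.nullMeasurableSet hd]
  refine measure_mono (union_subset ?_ ?_)
  · rintro _ ⟨x, hx, rfl⟩
    exact add_mem_add hx hb
  · rintro _ ⟨x, hx, rfl⟩
    exact add_mem_add ha hx

theorem Real.volume_add_volume_le_two_mul {A B C : Set ℝ} (hA : MeasurableSet A)
    (hB : MeasurableSet B) (hA' : A.Nonempty) (hB' : B.Nonempty)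
    (h : ∀ x ∈ A, ∀ y ∈ B, (x + y) / 2 ∈ C) : volume A + volume B ≤ 2 * volume C := by
  obtain ⟨a, ha⟩ := hA'
  obtain ⟨b, hb⟩ := hB'
  rw [hA.measure_eq_iSup_isCompact, hB.measure_eq_iSup_isCompact]
  simp only [iSup_and']
  refine ENNReal.biSup_add_biSup_le' (p := fun K => K ⊆ A ∧ IsCompact K)
    (q := fun K => K ⊆ B ∧ IsCompact K) ⟨∅, by simp⟩ ⟨∅, by simp⟩ fun K hK L hL => ?_
  obtain ⟨hK, hKc⟩ := hK
  obtain ⟨hL, hLc⟩ := hL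
  -- The approximating compact sets may be empty, so a point of `A` and one of `B` are adjoined.
  have h1 := Real.volume_add_volume_le_volume_add (hKc.union isCompact_singleton)
    (hLc.union isCompact_singleton) (A := K ∪ {a}) (B := L ∪ {b}) ⟨a, by simp⟩ ⟨b, by simp⟩
  have h2 : K ∪ {a} + (L ∪ {b}) ⊆ (2 : ℝ) • C := by
    rintro _ ⟨x, hx, y, hy, rfl⟩
    have hx' : x ∈ A := by
      rcases hx with hx | rfl
      exacts [hK hx, ha]
    have hy' : y ∈ B := by
      rcases hy with hy | rfl
      exacts [hL hy, hb]
    exact ⟨_, h x hx' y hy', by simp; ring⟩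
  calc volume K + volume L ≤ volume (K ∪ {a}) + volume (L ∪ {b}) := by
        gcongr <;> simp
    _ ≤ volume ((2 : ℝ) • C) := h1.trans (measure_mono h2)
    _ = 2 * volume C := by
        rw [Measure.addHaar_smul]; simp

theorem ENNReal.four_mul_le_add_sq (a b : ENNReal) : 4 * (a * b) ≤ (a + b) ^ 2 := by
  rcases eq_or_ne a ⊤ with rfl | ha
  · simp
  rcases eq_or_ne b ⊤ with rfl | hb
  · simp
  lift a to NNReal using ha
  lift b to NNReal using hb
  norm_cast
  have := four_mul_le_sq_add (a : ℝ) b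
  rw [← NNReal.coe_le_coe]
  push_cast
  linarith

/-- The one-dimensional Prékopa–Leindler inequality with equal weights. -/
theorem Real.lintegral_mul_lintegral_le_sq {f g h : ℝ → ℝ} (hf : Measurable f) (hg : Measurable g)
    (hh : Measurable h) (hf0 : ∀ x, 0 ≤ f x) (hg0 : ∀ x, 0 ≤ g x) (hh0 : ∀ x, 0 ≤ h x)
    (hfb : BddAbove (range f)) (hgb : BddAbove (range g))
    (H : ∀ x y, f x * g y ≤ h ((x + y) / 2) ^ 2) :
    (∫⁻ x, ENNReal.ofReal (f x)) * (∫⁻ x, ENNReal.ofReal (g x)) ≤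
      (∫⁻ x, ENNReal.ofReal (h x)) ^ 2 := by
  -- After division of `f` and `g` by their suprema and of `h` by the geometric mean of these,
  -- midpoints of the superlevel sets of `f` and `g` lie in that of `h` at the same level.
  -- Integrating the inequality between their lengths over the levels gives an additive inequality,
  -- which the arithmetic-geometric mean inequality makes multiplicative.
  set M := sSup (range f) with hM
  set N := sSup (range g) with hN
  have hfM : ∀ x, f x ≤ M := fun x => le_csSup hfb ⟨x, rfl⟩
  have hgN : ∀ x, g x ≤ N := fun x => le_csSup hgb ⟨x, rfl⟩
  rcases eq_or_lt_of_le ((hf0 0).trans (hfM 0)) with hM0 | hM0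
  · have : ∀ x, f x = 0 := fun x => le_antisymm (hM0 ▸ hfM x) (hf0 x)
    simp [this]
  rcases eq_or_lt_of_le ((hg0 0).trans (hgN 0)) with hN0 | hN0
  · have : ∀ x, g x = 0 := fun x => le_antisymm (hN0 ▸ hgN x) (hg0 x)
    simp [this]
  set S := √(M * N) with hS
  have hS0 : 0 < S := Real.sqrt_pos.2 (mul_pos hM0 hN0)
  have hS2 : S ^ 2 = M * N := Real.sq_sqrt (mul_pos hM0 hN0).le
  have layer : ∀ {k : ℝ → ℝ} {K : ℝ}, Measurable k → (∀ x, 0 ≤ k x) → 0 < K →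
      ENNReal.ofReal K⁻¹ * ∫⁻ x, ENNReal.ofReal (k x) =
        ∫⁻ t in Ioi (0 : ℝ), volume {x | t < k x / K} := by
    intro k K hk hk0 hK
    rw [← lintegral_const_mul _ (by fun_prop), ← lintegral_eq_lintegral_meas_lt]
    · refine lintegral_congr fun x => ?_
      rw [← ENNReal.ofReal_mul (by positivity)]
      congr 1
      field_simp
    · exact Filter.Eventually.of_forall fun x => div_nonneg (hk0 x) hK.le
    · fun_prop
  have trunc : ∀ {k : ℝ → ℝ} {K : ℝ}, (∀ x, k x ≤ K) → 0 < K →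
      ∫⁻ t in Ioi (0 : ℝ), volume {x | t < k x / K} =
        ∫⁻ t in Ioo (0 : ℝ) 1, volume {x | t < k x / K} := by
    intro k K hk hK
    have : Ioi (0 : ℝ) = Ioo 0 1 ∪ Ici 1 := (Ioo_union_Ici_eq_Ioi zero_lt_one).symm
    rw [this, lintegral_union measurableSet_Ici]
    · rw [setLIntegral_congr_fun (g := fun _ => 0) (s := Ici (1 : ℝ)) measurableSet_Ici]
      · simp
      · intro t ht
        have : {x | t < k x / K} = ∅ := by
          ext x
          simp only [mem_ofPred_eq, mem_empty_iff_false, iff_false, not_lt]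
          exact ((div_le_one hK).2 (hk x)).trans ht
        simp [this]
    · exact Set.disjoint_left.2 fun x hx hx' => hx.2.not_ge hx'
  have key : ENNReal.ofReal M⁻¹ * (∫⁻ x, ENNReal.ofReal (f x)) +
      ENNReal.ofReal N⁻¹ * (∫⁻ x, ENNReal.ofReal (g x)) ≤
      2 * (ENNReal.ofReal S⁻¹ * ∫⁻ x, ENNReal.ofReal (h x)) := by
    rw [layer hf hf0 hM0, layer hg hg0 hN0, layer hh hh0 hS0, trunc hfM hM0, trunc hgN hN0]
    have hmono : ∀ {k : ℝ → ℝ}, Measurable fun t : ℝ => volume {x | t < k x} := by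
      intro k
      refine Antitone.measurable fun s t hst => measure_mono fun x hx => ?_
      exact lt_of_le_of_lt hst hx
    rw [← lintegral_add_left (hmono (k := fun x => f x / M))]
    calc _ ≤ ∫⁻ t in Ioo (0 : ℝ) 1, 2 * volume {x | t < h x / S} := by
          refine setLIntegral_mono' measurableSet_Ioo fun t ht => ?_
          -- Both level sets must be nonempty for the inequality on lengths; this holds below level
          -- 1, the normalised supremum.
          have ne : ∀ {k : ℝ → ℝ} {K : ℝ}, K = sSup (range k) → 0 < K →
              {x | t < k x / K}.Nonempty := by
            intro k K hK hK0
            have : t * K < sSup (range k) := by rw [← hK]; nlinarith [ht.2]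
            obtain ⟨_, ⟨x, rfl⟩, hx⟩ := exists_lt_of_lt_csSup (range_nonempty k) this
            exact ⟨x, (lt_div_iff₀ hK0).2 hx⟩
          refine Real.volume_add_volume_le_two_mul
            (measurableSet_lt measurable_const (hf.div_const M))
            (measurableSet_lt measurable_const (hg.div_const N)) (ne hM hM0) (ne hN hN0) ?_
          intro x hx y hy
          simp only [mem_ofPred_eq] at hx hy ⊢
          rw [lt_div_iff₀ hM0] at hx
          rw [lt_div_iff₀ hN0] at hy
          rw [lt_div_iff₀ hS0]
          refine lt_of_pow_lt_pow_left₀ 2 (hh0 _) (lt_of_lt_of_le ?_ (H x y))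
          have := mul_lt_mul'' hx hy (mul_pos ht.1 hM0).le (mul_pos ht.1 hN0).le
          calc (t * S) ^ 2 = t * M * (t * N) := by rw [mul_pow, hS2]; ring
            _ < _ := this
      _ = 2 * ∫⁻ t in Ioo (0 : ℝ) 1, volume {x | t < h x / S} := by
          rw [lintegral_const_mul]
          exact hmono (k := fun x => h x / S)
      _ ≤ _ := by
          gcongr
          exact Ioo_subset_Ioi_self
  set I := ∫⁻ x, ENNReal.ofReal (f x)
  set J := ∫⁻ x, ENNReal.ofReal (g x)
  set L := ∫⁻ x, ENNReal.ofReal (h x)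
  have h4 : 4 * (ENNReal.ofReal M⁻¹ * I * (ENNReal.ofReal N⁻¹ * J)) ≤
      4 * (ENNReal.ofReal S⁻¹ * L) ^ 2 := by
    refine (ENNReal.four_mul_le_add_sq _ _).trans ((pow_le_pow_left₀ (by simp) key 2).trans ?_)
    rw [mul_pow]
    norm_num
  have h5 : ENNReal.ofReal M⁻¹ * I * (ENNReal.ofReal N⁻¹ * J) ≤ (ENNReal.ofReal S⁻¹ * L) ^ 2 :=
    (ENNReal.mul_le_mul_iff_right (by norm_num) (by norm_num)).1 h4
  have h6 : ENNReal.ofReal S⁻¹ ^ 2 = ENNReal.ofReal M⁻¹ * ENNReal.ofReal N⁻¹ := by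
    rw [← ENNReal.ofReal_pow (by positivity), ← ENNReal.ofReal_mul (by positivity), inv_pow, hS2,
      mul_inv]
  have h7 : ENNReal.ofReal M⁻¹ * I * (ENNReal.ofReal N⁻¹ * J) =
      ENNReal.ofReal S⁻¹ ^ 2 * (I * J) := by rw [h6]; ring
  rw [h7, mul_pow] at h5
  refine (ENNReal.mul_le_mul_iff_right ?_ ?_).1 h5
  · simpa using hS0
  · simp

/-- The slices of a subset of a product over the first factor. -/
def Set.slice {W : Type*} (A : Set (ℝ × W)) (t : ℝ) : Set W := {w | (t, w) ∈ A}

theorem IsCompact.slice {W : Type*} [TopologicalSpace W] {A : Set (ℝ × W)}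
    (hA : IsCompact A) (t : ℝ) : IsCompact (A.slice t) := by
  have h : A.slice t = Prod.snd '' (A ∩ Prod.fst ⁻¹' {t}) := by
    ext w
    constructor
    · intro hw
      exact ⟨(t, w), ⟨hw, rfl⟩, rfl⟩
    · rintro ⟨⟨s, w'⟩, ⟨h1, h2⟩, rfl⟩
      obtain rfl : s = t := h2
      exact h1
  rw [h]
  exact (hA.inter_right (isClosed_singleton.preimage continuous_fst)).image continuous_snd

theorem IsCompact.volume_slice_ne_top {n : ℕ} {A : Set (ℝ × (Fin n → ℝ))} (hA : IsCompact A)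
    (t : ℝ) : volume (A.slice t) ≠ ⊤ := (hA.slice t).measure_lt_top.ne

theorem IsCompact.measurable_volume_slice {n : ℕ} {A : Set (ℝ × (Fin n → ℝ))} (hA : IsCompact A) :
    Measurable fun t => volume (A.slice t) :=
  measurable_measure_prodMk_left hA.measurableSet

theorem IsCompact.volume_eq_lintegral_slice {n : ℕ} {A : Set (ℝ × (Fin n → ℝ))}
    (hA : IsCompact A) : volume A = ∫⁻ t, volume (A.slice t) := by
  rw [Measure.volume_eq_prod, Measure.prod_apply hA.measurableSet]
  rfl

theorem IsCompact.bddAbove_volume_slice {n : ℕ} {A : Set (ℝ × (Fin n → ℝ))}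
    (hA : IsCompact A) : BddAbove (range fun t => (volume (A.slice t)).toReal) := by
  refine ⟨(volume (Prod.snd '' A)).toReal, ?_⟩
  rintro _ ⟨t, rfl⟩
  refine ENNReal.toReal_mono (hA.image continuous_snd).measure_lt_top.ne (measure_mono ?_)
  intro w hw
  exact ⟨_, hw, rfl⟩

theorem smul_slice_add_slice_subset {W : Type*} [AddCommGroup W] [Module ℝ W] (A B : Set (ℝ × W))
    (x y : ℝ) :
    (2⁻¹ : ℝ) • (A.slice x + B.slice y) ⊆ Set.slice ((2⁻¹ : ℝ) • (A + B)) ((x + y) / 2) := by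
  rintro _ ⟨_, ⟨v, hv, w, hw, rfl⟩, rfl⟩
  refine ⟨_, ⟨_, hv, _, hw, rfl⟩, ?_⟩
  ext
  · simp; ring
  · simp

/-- Fubini reduces the claim to the volumes of slices. The inequality in dimension `n` says that
these functions satisfy the hypothesis of the one-dimensional Prékopa–Leindler inequality. -/
theorem volume_mul_volume_le_sq_prod {n : ℕ}
    (ih : ∀ {A B : Set (Fin n → ℝ)}, IsCompact A → IsCompact B →
      volume A * volume B ≤ volume ((2⁻¹ : ℝ) • (A + B)) ^ 2)
    {A B : Set (ℝ × (Fin n → ℝ))} (hA : IsCompact A) (hB : IsCompact B) :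
    volume A * volume B ≤ volume ((2⁻¹ : ℝ) • (A + B)) ^ 2 := by
  have hC : IsCompact ((2⁻¹ : ℝ) • (A + B)) := (hA.add hB).smul _
  have e : ∀ {K : Set (ℝ × (Fin n → ℝ))}, IsCompact K →
      volume K = ∫⁻ t, ENNReal.ofReal (volume (K.slice t)).toReal := fun hK => by
    rw [hK.volume_eq_lintegral_slice]
    exact lintegral_congr fun t => (ENNReal.ofReal_toReal (hK.volume_slice_ne_top t)).symm
  rw [e hA, e hB, e hC]
  refine Real.lintegral_mul_lintegral_le_sq hA.measurable_volume_slice.ennreal_toReal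
    hB.measurable_volume_slice.ennreal_toReal hC.measurable_volume_slice.ennreal_toReal
    (fun _ => ENNReal.toReal_nonneg) (fun _ => ENNReal.toReal_nonneg)
    (fun _ => ENNReal.toReal_nonneg) hA.bddAbove_volume_slice hB.bddAbove_volume_slice ?_
  intro x y
  rw [← ENNReal.toReal_mul, ← ENNReal.toReal_pow]
  refine ENNReal.toReal_mono (ENNReal.pow_ne_top (hC.volume_slice_ne_top _)) ?_
  refine (ih (hA.slice x) (hB.slice y)).trans ?_
  gcongr
  exact smul_slice_add_slice_subset A B x y

/-- The Brunn–Minkowski inequality, in multiplicative form and with equal weights. -/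
theorem volume_mul_volume_le_sq (n : ℕ) : ∀ {A B : Set (Fin n → ℝ)}, IsCompact A → IsCompact B →
    volume A * volume B ≤ volume ((2⁻¹ : ℝ) • (A + B)) ^ 2 := by
  induction n with
  | zero =>
    intro A B _ _
    rcases A.eq_empty_or_nonempty with rfl | ⟨a, ha⟩
    · simp
    rcases B.eq_empty_or_nonempty with rfl | ⟨b, hb⟩
    · simp
    have hu : ∀ {K : Set (Fin 0 → ℝ)} {x}, x ∈ K → volume K = 1 := by
      intro K x hx
      have : K = univ := eq_univ_of_forall fun y => Subsingleton.elim x y ▸ hx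
      rw [this, ← pi_univ univ, volume_pi_pi]
      simp
    rw [hu ha, hu hb, hu (smul_mem_smul_set (add_mem_add ha hb))]
    simp
  | succ n ih =>
    intro A B hA hB
    let e := MeasurableEquiv.piFinSuccAbove (fun _ : Fin (n + 1) => ℝ) 0
    have he : MeasurePreserving e := volume_preserving_piFinSuccAbove (fun _ => ℝ) 0
    have hc : Continuous e := by
      refine Continuous.prodMk (continuous_apply 0) ?_
      exact continuous_pi fun i => continuous_apply _
    have hv : ∀ K : Set (Fin (n + 1) → ℝ), volume K = volume (e '' K) := by
      intro K
      rw [← he.measure_preimage_equiv (e '' K), preimage_image_eq _ e.injective]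
    have hadd : ∀ x y, e (x + y) = e x + e y := fun x y => rfl
    have hsmul : ∀ (c : ℝ) x, e (c • x) = c • e x := fun c x => rfl
    have himg : e '' ((2⁻¹ : ℝ) • (A + B)) = (2⁻¹ : ℝ) • (e '' A + e '' B) := by
      ext z
      constructor
      · rintro ⟨_, ⟨_, ⟨a, ha, b, hb, rfl⟩, rfl⟩, rfl⟩
        exact ⟨_, ⟨_, ⟨a, ha, rfl⟩, _, ⟨b, hb, rfl⟩, rfl⟩, rfl⟩
      · rintro ⟨_, ⟨_, ⟨a, ha, rfl⟩, _, ⟨b, hb, rfl⟩, rfl⟩, rfl⟩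
        exact ⟨_, ⟨_, ⟨a, ha, b, hb, rfl⟩, rfl⟩, rfl⟩
    rw [hv A, hv B, hv, himg]
    exact volume_mul_volume_le_sq_prod ih (hA.image hc) (hB.image hc)

end BrunnMinkowski

/-! ### The equality case on the line, by transport of mass -/

section EqualityCase

open MeasureTheory Set

/-- If a positive density on an interval has the mass of a function dominating all the geometric
means `√(F x * F y)` at the points `(x - y) / 2`, then it is symmetric. -/
theorem symmetric_of_mul_le_sq {a b : ℝ} {F H : ℝ → ℝ} (hc : ContinuousOn F (Ioo a b))
    (hpos : ∀ x ∈ Ioo a b, 0 < F x) (hint : IntegrableOn F (Ioo a b)) (hH0 : ∀ x, 0 ≤ H x)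
    (hH : ∀ x ∈ Ioo a b, ∀ y ∈ Ioo a b, F x * F y ≤ H ((x - y) / 2) ^ 2)
    (hle : ∫⁻ x, ENNReal.ofReal (H x) ≤ ∫⁻ x in Ioo a b, ENNReal.ofReal (F x)) :
    ∀ x ∈ Ioo a b, F (a + b - x) = F x := by
  intro x₀ hx₀
  have hab : a < b := hx₀.1.trans hx₀.2
  have hII : ∀ {x y}, x ∈ Icc a b → y ∈ Icc a b → IntervalIntegrable F volume x y := by
    intro x y hx hy
    have : IntervalIntegrable F volume a b := by
      rw [intervalIntegrable_iff_integrableOn_Ioo_of_le hab.le]; exact hint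
    refine this.mono_set ?_
    rw [uIcc_of_le hab.le]
    exact uIcc_subset_Icc hx hy
  -- `Φ` is the cumulative mass, `V` the total mass; the inverse `τ` of `Φ` is the quantile
  -- function.
  set Φ : ℝ → ℝ := fun x => ∫ t in a..x, F t with hΦ
  set V := Φ b with hV
  have ha : a ∈ Icc a b := left_mem_Icc.2 hab.le
  have hb : b ∈ Icc a b := right_mem_Icc.2 hab.le
  have hΦa : Φ a = 0 := by simp [hΦ]
  have hmono : StrictMonoOn Φ (Icc a b) := by
    intro x hx y hy hxy
    have h1 : Φ y - Φ x = ∫ t in x..y, F t :=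
      intervalIntegral.integral_interval_sub_left (hII ha hy) (hII ha hx)
    have h2 : 0 < ∫ t in x..y, F t :=
      intervalIntegral.intervalIntegral_pos_of_pos_on (hII hx hy)
        (fun t ht => hpos t ⟨hx.1.trans_lt ht.1, ht.2.trans_le hy.2⟩) hxy
    linarith
  have hΦc : ContinuousOn Φ (Icc a b) := by
    have := intervalIntegral.continuousOn_primitive_interval (f := F) (a := a) (b := b)
      (μ := volume) (by rw [uIcc_of_le hab.le, integrableOn_Icc_iff_integrableOn_Ioo]; exact hint)
    rwa [uIcc_of_le hab.le] at this
  have hderiv : ∀ x ∈ Ioo a b, HasDerivAt Φ (F x) x := by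
    intro x hx
    refine intervalIntegral.integral_hasDerivAt_right (hII ha (Ioo_subset_Icc_self hx)) ?_
      (hc.continuousAt (Ioo_mem_nhds hx.1 hx.2))
    exact hc.stronglyMeasurableAtFilter isOpen_Ioo x hx
  have hmaps : ∀ x ∈ Ioo a b, Φ x ∈ Ioo 0 V := fun x hx =>
    ⟨hΦa ▸ hmono ha (Ioo_subset_Icc_self hx) hx.1, hmono (Ioo_subset_Icc_self hx) hb hx.2⟩
  have hsurj : ∀ m ∈ Ioo 0 V, ∃ x ∈ Ioo a b, Φ x = m := by
    intro m hm
    have := intermediate_value_Ioo hab.le hΦc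
    rw [hΦa] at this
    exact this hm
  choose! τ hτ hΦτ using hsurj
  have hτΦ : ∀ x ∈ Ioo a b, τ (Φ x) = x := fun x hx =>
    hmono.injOn (Ioo_subset_Icc_self (hτ _ (hmaps x hx))) (Ioo_subset_Icc_self hx)
      (hΦτ _ (hmaps x hx))
  have hτmono : StrictMonoOn τ (Ioo 0 V) := by
    intro m hm m' hm' hmm
    by_contra! hcon
    have := hmono.monotoneOn (Ioo_subset_Icc_self (hτ _ hm')) (Ioo_subset_Icc_self (hτ _ hm)) hcon
    rw [hΦτ _ hm, hΦτ _ hm'] at this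
    exact this.not_gt hmm
  have hτimg : τ '' Ioo 0 V = Ioo a b := by
    ext x
    constructor
    · rintro ⟨m, hm, rfl⟩
      exact hτ m hm
    · intro hx
      exact ⟨Φ x, hmaps x hx, hτΦ x hx⟩
  have hτderiv : ∀ m ∈ Ioo 0 V, HasDerivAt τ (F (τ m))⁻¹ m := by
    intro m hm
    refine HasDerivAt.of_local_left_inverse (f := Φ) ?_ (hderiv _ (hτ m hm))
      (hpos _ (hτ m hm)).ne' ?_
    · refine hτmono.continuousAt_of_image_mem_nhds (Ioo_mem_nhds hm.1 hm.2) ?_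
      rw [hτimg]
      exact Ioo_mem_nhds (hτ m hm).1 (hτ m hm).2
    · filter_upwards [Ioo_mem_nhds hm.1 hm.2] with y hy using hΦτ y hy
  have hrefl : ∀ x ∈ Ioo a b, V - Φ x ∈ Ioo 0 V := fun x hx =>
    ⟨by linarith [(hmaps x hx).2], by linarith [(hmaps x hx).1]⟩
  -- `ψ` is the decreasing transport map: it sends the point with mass `m` to its left to the point
  -- with mass `m` to its right. The substitution `θ x = (x - ψ x) / 2` then compares the integral
  -- of `H` with that of `F`.
  set ψ : ℝ → ℝ := fun x => τ (V - Φ x) with hψ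
  have hψm : ∀ x ∈ Ioo a b, ψ x ∈ Ioo a b := fun x hx => hτ _ (hrefl x hx)
  have hψψ : ∀ x ∈ Ioo a b, ψ (ψ x) = x := by
    intro x hx
    simp only [hψ]
    rw [hΦτ _ (hrefl x hx), sub_sub_cancel, hτΦ x hx]
  have hψderiv : ∀ x ∈ Ioo a b, HasDerivAt ψ (-(F x / F (ψ x))) x := by
    intro x hx
    have := (hτderiv _ (hrefl x hx)).comp x ((hderiv x hx).const_sub V)
    refine this.congr_deriv ?_
    change (F (ψ x))⁻¹ * -F x = -(F x / F (ψ x))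
    ring
  have hψc : ContinuousOn ψ (Ioo a b) := fun x hx =>
    (hψderiv x hx).continuousAt.continuousWithinAt
  have hψanti : StrictAntiOn ψ (Ioo a b) := by
    intro x hx y hy hxy
    refine hτmono (hrefl y hy) (hrefl x hx) ?_
    have := hmono (Ioo_subset_Icc_self hx) (Ioo_subset_Icc_self hy) hxy
    linarith
  set θ : ℝ → ℝ := fun x => (x - ψ x) / 2 with hθ
  set θ' : ℝ → ℝ := fun x => (1 + F x / F (ψ x)) / 2 with hθ'
  have hθderiv : ∀ x ∈ Ioo a b, HasDerivWithinAt θ (θ' x) (Ioo a b) x := by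
    intro x hx
    have := (((hasDerivAt_id x).sub (hψderiv x hx)).div_const 2).hasDerivWithinAt (s := Ioo a b)
    refine this.congr_deriv ?_
    change (1 - -(F x / F (ψ x))) / 2 = (1 + F x / F (ψ x)) / 2
    ring
  have hθinj : InjOn θ (Ioo a b) := by
    refine StrictMonoOn.injOn fun x hx y hy hxy => ?_
    have := hψanti hx hy hxy
    simp only [hθ]
    linarith
  have hFψ : ContinuousOn (fun x => F (ψ x)) (Ioo a b) := hc.comp hψc hψm
  -- `G` is the pointwise gain of the substitution over `F`. It is a nonnegative multiple of a
  -- square, so the bound on the mass of `H` forces it to vanish; then `F ∘ ψ = F`.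
  set G : ℝ → ℝ := fun x => θ' x * √(F x * F (ψ x)) - F x with hG
  have hGc : ContinuousOn G (Ioo a b) := by
    refine ContinuousOn.sub (ContinuousOn.mul ?_ (hc.mul hFψ).sqrt) hc
    exact (continuousOn_const.add (hc.div hFψ fun x hx => (hpos _ (hψm x hx)).ne')).div_const 2
  have hGeq : ∀ x ∈ Ioo a b, G x = √(F x) / (2 * √(F (ψ x))) * (√(F x) - √(F (ψ x))) ^ 2 := by
    intro x hx
    have hp := hpos x hx
    have hq := hpos _ (hψm x hx)
    simp only [hG, hθ']
    rw [Real.sqrt_mul hp.le]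
    obtain ⟨p, hp0, hpe⟩ : ∃ p, 0 < p ∧ F x = p ^ 2 :=
      ⟨√(F x), Real.sqrt_pos.2 hp, (Real.sq_sqrt hp.le).symm⟩
    obtain ⟨q, hq0, hqe⟩ : ∃ q, 0 < q ∧ F (ψ x) = q ^ 2 :=
      ⟨√(F (ψ x)), Real.sqrt_pos.2 hq, (Real.sq_sqrt hq.le).symm⟩
    rw [hpe, hqe, Real.sqrt_sq hp0.le, Real.sqrt_sq hq0.le]
    field_simp
    ring
  have hG0 : ∀ x ∈ Ioo a b, 0 ≤ G x := fun x hx => by rw [hGeq x hx]; positivity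
  have hFfin : ∫⁻ x in Ioo a b, ENNReal.ofReal (F x) ≠ ⊤ := by
    refine ne_of_lt (lt_of_le_of_lt (lintegral_mono fun x => ?_) hint.2)
    exact Real.ofReal_le_enorm _
  have hGint : ∫⁻ x in Ioo a b, ENNReal.ofReal (G x) = 0 := by
    have h1 : (∫⁻ x in Ioo a b, ENNReal.ofReal (F x)) + ∫⁻ x in Ioo a b, ENNReal.ofReal (G x) ≤
        (∫⁻ x in Ioo a b, ENNReal.ofReal (F x)) + 0 := by
      rw [add_zero, ← lintegral_add_left' (hc.aemeasurable measurableSet_Ioo).ennreal_ofReal]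
      refine le_trans ?_ hle
      calc _ = ∫⁻ x in Ioo a b, ENNReal.ofReal (θ' x * √(F x * F (ψ x))) := by
            refine setLIntegral_congr_fun measurableSet_Ioo fun x hx => ?_
            rw [← ENNReal.ofReal_add (hpos x hx).le (hG0 x hx)]
            congr 1
            change F x + (θ' x * √(F x * F (ψ x)) - F x) = _
            ring
        _ ≤ ∫⁻ x in Ioo a b, ENNReal.ofReal |θ' x| * ENNReal.ofReal (H (θ x)) := by
            refine setLIntegral_mono' measurableSet_Ioo fun x hx => ?_
            rw [← ENNReal.ofReal_mul (abs_nonneg _)]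
            refine ENNReal.ofReal_le_ofReal ?_
            have := Real.sqrt_le_sqrt (hH x hx (ψ x) (hψm x hx))
            rw [Real.sqrt_sq (hH0 _)] at this
            gcongr
            exact le_abs_self _
        _ = ∫⁻ y in θ '' Ioo a b, ENNReal.ofReal (H y) :=
            (lintegral_image_eq_lintegral_abs_deriv_mul measurableSet_Ioo hθderiv hθinj
              fun y => ENNReal.ofReal (H y)).symm
        _ ≤ _ := setLIntegral_le_lintegral _ _
    exact le_antisymm ((ENNReal.add_le_add_iff_left hFfin).1 h1) zero_le
  have hGz : EqOn G 0 (Ioo a b) := by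
    refine Measure.eqOn_open_of_ae_eq (μ := volume) ?_ isOpen_Ioo hGc continuousOn_const
    rw [lintegral_eq_zero_iff' (hGc.aemeasurable measurableSet_Ioo).ennreal_ofReal] at hGint
    filter_upwards [hGint, ae_restrict_mem measurableSet_Ioo] with x hx hx'
    have : G x ≤ 0 := by simpa using hx
    exact le_antisymm this (hG0 x hx')
  have hFeq : ∀ x ∈ Ioo a b, F (ψ x) = F x := by
    intro x hx
    have h1 := hGz hx
    rw [hGeq x hx] at h1
    have hp := Real.sqrt_pos.2 (hpos x hx)
    have hq := Real.sqrt_pos.2 (hpos _ (hψm x hx))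
    have h2 : √(F x) - √(F (ψ x)) = 0 := by
      have h3 := (mul_eq_zero.1 h1).resolve_left (by positivity)
      exact pow_eq_zero_iff (two_ne_zero) |>.1 h3
    rw [← Real.sq_sqrt (hpos x hx).le, ← Real.sq_sqrt (hpos _ (hψm x hx)).le, sub_eq_zero.1 h2]
  -- Now `ψ' = -F / (F ∘ ψ) = -1`, so `ψ` is a point reflection. As it preserves the interval, its
  -- centre is the midpoint.
  obtain ⟨c, hcst⟩ : ∃ c, ∀ x ∈ Ioo a b, x + ψ x = c := by
    refine ⟨x₀ + ψ x₀, fun x hx => ?_⟩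
    refine (convex_Ioo a b).is_const_of_fderivWithin_eq_zero (𝕜 := ℝ) (f := fun x => x + ψ x)
      ?_ ?_ hx hx₀
    · intro y hy
      exact ((hasDerivAt_id y).add (hψderiv y hy)).differentiableAt.differentiableWithinAt
    · intro y hy
      have h1 := ((hasDerivAt_id y).add (hψderiv y hy)).hasFDerivAt.hasFDerivWithinAt (s := Ioo a b)
      have h2 := h1.fderivWithin (isOpen_Ioo.uniqueDiffWithinAt hy)
      refine Eq.trans h2 ?_
      rw [hFeq y hy, div_self (hpos y hy).ne']
      ext
      simp
  have hcle : ∀ x ∈ Ioo a b, c - x ∈ Ioo a b := fun x hx => by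
    rw [← hcst x hx, add_sub_cancel_left]; exact hψm x hx
  have hc1 : c ≤ a + b := by
    by_contra! hcon
    have h2 := (hcle (a + (min (c - a - b) (b - a)) / 2) ⟨by
      have : 0 < min (c - a - b) (b - a) := lt_min (by linarith) (by linarith)
      linarith, by have := min_le_right (c - a - b) (b - a); linarith⟩).2
    have := min_le_left (c - a - b) (b - a)
    have : 0 < min (c - a - b) (b - a) := lt_min (by linarith) (by linarith)
    linarith
  have hc2 : a + b ≤ c := by
    by_contra! hcon
    have h2 := (hcle (b - (min (a + b - c) (b - a)) / 2) ⟨by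
      have := min_le_right (a + b - c) (b - a); linarith, by
      have : 0 < min (a + b - c) (b - a) := lt_min (by linarith) (by linarith)
      linarith⟩).1
    have := min_le_left (a + b - c) (b - a)
    have : 0 < min (a + b - c) (b - a) := lt_min (by linarith) (by linarith)
    linarith
  rw [le_antisymm hc2 hc1, ← hcst x₀ hx₀, add_sub_cancel_left, hFeq x₀ hx₀]

end EqualityCase

/-! ### Central symmetry of bodies whose difference body is smallest -/

section CentralSymmetry

open MeasureTheory Set Filter Topology

variable {n : ℕ}

/-- The homothety with centre `(t, w)` and ratio `c` maps `K` into itself and multiplies the volumes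
of slices by `c ^ n`. -/
theorem Convex.pow_mul_volume_slice_le {K : Set (ℝ × (Fin n → ℝ))} (hK : Convex ℝ K)
    (hc : IsCompact K) {x t c : ℝ} {w : Fin n → ℝ} (hw : (t, w) ∈ K) (h0 : 0 ≤ c) (h1 : c ≤ 1) :
    c ^ n * (volume (K.slice x)).toReal ≤ (volume (K.slice (c * x + (1 - c) * t))).toReal := by
  have h : (1 - c) • w +ᵥ c • K.slice x ⊆ K.slice (c * x + (1 - c) * t) := by
    rintro _ ⟨_, ⟨z, hz, rfl⟩, rfl⟩
    have := hK hz hw h0 (sub_nonneg.2 h1) (add_sub_cancel _ _)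
    refine (congrArg (· ∈ K) ?_).mp this
    ext
    · simp
    · simp [add_comm]
  have h2 := measure_mono (μ := volume) h
  rw [measure_vadd, Measure.addHaar_smul_of_nonneg _ h0] at h2
  have h3 := ENNReal.toReal_mono (hc.volume_slice_ne_top _) h2
  rwa [ENNReal.toReal_mul, ENNReal.toReal_ofReal (by positivity), Module.finrank_fin_fun] at h3

theorem neg_slice (K : Set (ℝ × (Fin n → ℝ))) (t : ℝ) : (-K).slice (-t) = -K.slice t := by
  ext w
  change -(-t, w) ∈ K ↔ (t, -w) ∈ K
  simp

/-- If the difference body of a convex body `K` has the smallest possible volume, then the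
centroid of `K` is halfway between the two supporting hyperplanes `x.1 = const`. -/
theorem setIntegral_fst_eq_of_volume_le {K : Set (ℝ × (Fin n → ℝ))} (hK : Convex ℝ K)
    (hc : IsCompact K) (hi : (interior K).Nonempty)
    (hle : volume ((2⁻¹ : ℝ) • (K + -K)) ≤ volume K) :
    ∫ p in K, p.1 = (sInf (Prod.fst '' K) + sSup (Prod.fst '' K)) / 2 * (volume K).toReal := by
  have hne : (Prod.fst '' K).Nonempty := (hi.mono interior_subset).image _
  have hfc : IsCompact (Prod.fst '' K) := hc.image continuous_fst
  set a := sInf (Prod.fst '' K) with ha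
  set b := sSup (Prod.fst '' K) with hb
  obtain ⟨⟨_, wa⟩, hwa, rfl : _ = a⟩ := hfc.sInf_mem hne
  obtain ⟨⟨_, wb⟩, hwb, rfl : _ = b⟩ := hfc.sSup_mem hne
  set F : ℝ → ℝ := fun t => (volume (K.slice t)).toReal with hF
  have hF0 : ∀ t, 0 ≤ F t := fun t => ENNReal.toReal_nonneg
  have hFm : Measurable F := hc.measurable_volume_slice.ennreal_toReal
  have hofF : ∀ t, ENNReal.ofReal (F t) = volume (K.slice t) := fun t =>
    ENNReal.ofReal_toReal (hc.volume_slice_ne_top t)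
  have hout : ∀ t, t ∉ Icc a b → K.slice t = ∅ := by
    intro t ht
    rw [eq_empty_iff_forall_notMem]
    intro w hw
    exact ht ⟨ha ▸ csInf_le hfc.bddBelow ⟨_, hw, rfl⟩, hb ▸ le_csSup hfc.bddAbove ⟨_, hw, rfl⟩⟩
  have hvol : volume K = ∫⁻ t in Ioo a b, ENNReal.ofReal (F t) := by
    rw [hc.volume_eq_lintegral_slice, setLIntegral_congr Ioo_ae_eq_Icc,
      ← lintegral_indicator measurableSet_Icc]
    refine lintegral_congr fun t => ?_
    by_cases ht : t ∈ Icc a b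
    · rw [indicator_of_mem ht, hofF]
    · rw [indicator_of_notMem ht, hout t ht, measure_empty]
  have hKpos : 0 < volume K := Measure.measure_pos_of_nonempty_interior _ hi
  have hKfin : volume K ≠ ⊤ := hc.measure_lt_top.ne
  -- Shrink towards the extreme point `wb` if `y` lies to the right of `x`, towards `wa` otherwise.
  -- The factor is positive and equals 1 at `y = x`, so this estimate and its mirror image yield
  -- both positivity and continuity of `F`.
  have hrel : ∀ x ∈ Ioo a b, ∀ y ∈ Ioo a b,
      min (((b - y) / (b - x)) ^ n) (((y - a) / (x - a)) ^ n) * F x ≤ F y := by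
    intro x hx y hy
    have hbx : 0 < b - x := sub_pos.2 hx.2
    have hxa : 0 < x - a := sub_pos.2 hx.1
    rcases le_total x y with hxy | hxy
    · refine (mul_le_mul_of_nonneg_right (min_le_left _ _) (hF0 x)).trans ?_
      have := hK.pow_mul_volume_slice_le hc (x := x) hwb
        (div_nonneg (sub_nonneg.2 hy.2.le) hbx.le) ((div_le_one hbx).2 (by linarith))
      have e : (b - y) / (b - x) * x + (1 - (b - y) / (b - x)) * b = y := by field_simp; ring
      rwa [e] at this
    · refine (mul_le_mul_of_nonneg_right (min_le_right _ _) (hF0 x)).trans ?_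
      have := hK.pow_mul_volume_slice_le hc (x := x) hwa
        (div_nonneg (sub_nonneg.2 hy.1.le) hxa.le) ((div_le_one hxa).2 (by linarith))
      have e : (y - a) / (x - a) * x + (1 - (y - a) / (x - a)) * a = y := by field_simp; ring
      rwa [e] at this
  have hrpos : ∀ x ∈ Ioo a b, ∀ y ∈ Ioo a b,
      0 < min (((b - y) / (b - x)) ^ n) (((y - a) / (x - a)) ^ n) := by
    intro x hx y hy
    have h1 : 0 < b - x := sub_pos.2 hx.2
    have h2 : 0 < x - a := sub_pos.2 hx.1
    have h3 : 0 < b - y := sub_pos.2 hy.2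
    have h4 : 0 < y - a := sub_pos.2 hy.1
    exact lt_min (by positivity) (by positivity)
  obtain ⟨x₁, hx₁, hFx₁⟩ : ∃ x ∈ Ioo a b, F x ≠ 0 := by
    by_contra! hcon
    rw [hvol, setLIntegral_congr_fun measurableSet_Ioo (g := fun _ => 0)] at hKpos
    · simp at hKpos
    · intro t ht
      simp [hcon t ht]
  have hFpos : ∀ x ∈ Ioo a b, 0 < F x := fun x hx =>
    lt_of_lt_of_le (mul_pos (hrpos x₁ hx₁ x hx) ((hF0 x₁).lt_of_ne' hFx₁)) (hrel x₁ hx₁ x hx)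
  have hFc : ContinuousOn F (Ioo a b) := by
    intro x hx
    refine ContinuousAt.continuousWithinAt ?_
    have hbx : b - x ≠ 0 := (sub_pos.2 hx.2).ne'
    have hxa : x - a ≠ 0 := (sub_pos.2 hx.1).ne'
    have hl : Tendsto (fun y => min (((b - y) / (b - x)) ^ n) (((y - a) / (x - a)) ^ n) * F x)
        (𝓝 x) (𝓝 (F x)) := by
      have : ContinuousAt (fun y => min (((b - y) / (b - x)) ^ n) (((y - a) / (x - a)) ^ n) * F x)
          x := by fun_prop
      have h := this.tendsto
      simp only [div_self hbx, div_self hxa, one_pow, min_self, one_mul] at h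
      exact h
    have hu : Tendsto (fun y => F x / min (((b - x) / (b - y)) ^ n) (((x - a) / (y - a)) ^ n))
        (𝓝 x) (𝓝 (F x)) := by
      have : ContinuousAt
          (fun y => F x / min (((b - x) / (b - y)) ^ n) (((x - a) / (y - a)) ^ n)) x := by
        refine ContinuousAt.div continuousAt_const ?_ (hrpos x hx x hx).ne'
        fun_prop (disch := assumption)
      have h := this.tendsto
      simp only [div_self hbx, div_self hxa, one_pow, min_self, div_one] at h
      exact h
    refine tendsto_of_tendsto_of_tendsto_of_le_of_le' hl hu ?_ ?_
    · filter_upwards [Ioo_mem_nhds hx.1 hx.2] with y hy using hrel x hx y hy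
    · filter_upwards [Ioo_mem_nhds hx.1 hx.2] with y hy
      rw [le_div_iff₀ (hrpos y hy x hx), mul_comm]
      exact hrel y hy x hx
  have hFint : IntegrableOn F (Ioo a b) := by
    refine ⟨hFm.aestronglyMeasurable, ?_⟩
    rw [hasFiniteIntegral_iff_ofReal (Eventually.of_forall hF0), ← hvol]
    exact hKfin.lt_top
  have hD : IsCompact ((2⁻¹ : ℝ) • (K + -K)) := (hc.add hc.neg).smul _
  have hsymm := symmetric_of_mul_le_sq hFc hFpos hFint
    (H := fun t => (volume (((2⁻¹ : ℝ) • (K + -K)).slice t)).toReal)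
    (fun _ => ENNReal.toReal_nonneg) (by
      intro x _ y _
      rw [← ENNReal.toReal_mul, ← ENNReal.toReal_pow]
      refine ENNReal.toReal_mono (ENNReal.pow_ne_top (hD.volume_slice_ne_top _)) ?_
      have h1 := volume_mul_volume_le_sq n (hc.slice x) (hc.neg.slice (-y))
      rw [neg_slice, Measure.measure_neg] at h1
      refine h1.trans ?_
      gcongr
      rw [← neg_slice, sub_eq_add_neg]
      exact smul_slice_add_slice_subset K (-K) x (-y)) (by
      rw [← hvol]
      refine le_trans (le_of_eq ?_) hle
      rw [hD.volume_eq_lintegral_slice]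
      exact lintegral_congr fun t => ENNReal.ofReal_toReal (hD.volume_slice_ne_top t))
  have hmean : ∫ p in K, p.1 = ∫ t in Ioo a b, t * F t := by
    rw [← integral_indicator hc.measurableSet, Measure.volume_eq_prod, integral_prod]
    · rw [← setIntegral_congr_set (Ioo_ae_eq_Icc (μ := volume)).symm,
        ← integral_indicator measurableSet_Icc]
      refine integral_congr_ae (Eventually.of_forall fun t => ?_)
      have h1 : (fun w => K.indicator (fun p : ℝ × (Fin n → ℝ) => p.1) (t, w)) =
          (K.slice t).indicator fun _ => t := by
        ext w
        rfl
      simp only [h1]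
      rw [integral_indicator (hc.slice t).measurableSet, setIntegral_const]
      by_cases ht : t ∈ Icc a b
      · rw [indicator_of_mem ht, smul_eq_mul, mul_comm]
        rfl
      · rw [indicator_of_notMem ht, hout t ht]
        simp
    · rw [integrable_indicator_iff hc.measurableSet, ← Measure.volume_eq_prod]
      exact continuous_fst.continuousOn.integrableOn_compact hc
  have hV : (volume K).toReal = ∫ t in Ioo a b, F t := by
    rw [hvol, integral_eq_lintegral_of_nonneg_ae (Eventually.of_forall hF0)
      hFm.aestronglyMeasurable]
  have hti : IntegrableOn (fun t => t * F t) (Ioo a b) := by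
    refine Integrable.bdd_mul (c := max |a| |b|) hFint (by fun_prop) ?_
    filter_upwards [ae_restrict_mem measurableSet_Ioo] with t ht
    exact abs_le_max_abs_abs ht.1.le ht.2.le
  have hswap : ∫ t in Ioo a b, t * F t = ∫ t in Ioo a b, (a + b - t) * F t := by
    have hab : a ≤ b := hx₁.1.le.trans hx₁.2.le
    rw [← integral_Ioc_eq_integral_Ioo, ← integral_Ioc_eq_integral_Ioo,
      ← intervalIntegral.integral_of_le hab, ← intervalIntegral.integral_of_le hab]
    have h1 := intervalIntegral.integral_comp_sub_left (fun t => t * F t) (a + b) (a := a) (b := b)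
    rw [add_sub_cancel_right, add_sub_cancel_left] at h1
    rw [← h1, intervalIntegral.integral_of_le hab, intervalIntegral.integral_of_le hab,
      integral_Ioc_eq_integral_Ioo, integral_Ioc_eq_integral_Ioo]
    refine setIntegral_congr_fun measurableSet_Ioo fun t ht => ?_
    rw [hsymm t ht]
  have hsum : (∫ t in Ioo a b, t * F t) + ∫ t in Ioo a b, (a + b - t) * F t =
      (a + b) * ∫ t in Ioo a b, F t := by
    rw [← integral_const_mul, ← integral_add hti]
    · congr 1
      ext t
      ring
    · have := (hFint.const_mul (a + b)).sub hti
      refine this.congr (Eventually.of_forall fun t => ?_)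
      simp only [Pi.sub_apply]
      ring
  rw [hmean, hV]
  linarith

/-- In linear coordinates with `u` as the first one, this is the case of the first coordinate: the
measure becomes a multiple of Lebesgue measure, and both sides scale alike. -/
theorem setIntegral_apply_eq_of_measure_le {E : Type*} [NormedAddCommGroup E] [NormedSpace ℝ E]
    [FiniteDimensional ℝ E] [MeasurableSpace E] [BorelSpace E] {μ : Measure E}
    [μ.IsAddHaarMeasure] {K : Set E} (hK : Convex ℝ K) (hc : IsCompact K)
    (hi : (interior K).Nonempty) (hle : μ ((2⁻¹ : ℝ) • (K + -K)) ≤ μ K) {u : StrongDual ℝ E}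
    (hu : u ≠ 0) :
    ∫ x in K, u x ∂μ = (sInf (u '' K) + sSup (u '' K)) / 2 * μ.real K := by
  obtain ⟨v, hv⟩ : ∃ v, u v = 1 := by
    obtain ⟨w, hw⟩ := DFunLike.ne_iff.1 hu
    refine ⟨(u w)⁻¹ • w, ?_⟩
    rw [map_smul, smul_eq_mul, inv_mul_cancel₀ (by simpa using hw)]
  let e₁ := ContinuousLinearEquiv.equivOfRightInverse u
    (ContinuousLinearMap.toSpanSingleton ℝ v) (fun t => by simp [hv])
  let e₂ : u.ker ≃L[ℝ] (Fin (Module.finrank ℝ u.ker) → ℝ) :=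
    ContinuousLinearEquiv.ofFinrankEq (by simp)
  let Φ : E ≃L[ℝ] ℝ × (Fin (Module.finrank ℝ u.ker) → ℝ) :=
    e₁.trans ((ContinuousLinearEquiv.refl ℝ ℝ).prodCongr e₂)
  have hfst : ∀ x, (Φ x).1 = u x := fun x => rfl
  have : (μ.map Φ).IsAddHaarMeasure := Φ.isAddHaarMeasure_map μ
  have : (volume : Measure (ℝ × (Fin (Module.finrank ℝ u.ker) → ℝ))).IsAddHaarMeasure :=
    inferInstanceAs ((volume : Measure ℝ).prod volume).IsAddHaarMeasure
  obtain ⟨c, hc0, hctop, hcμ⟩ : ∃ c : ENNReal, c ≠ 0 ∧ c ≠ ⊤ ∧ μ.map Φ = c • volume := by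
    refine ⟨(Measure.addHaarScalarFactor (μ.map Φ) volume : ENNReal), ?_, by simp, ?_⟩
    · simpa using (Measure.addHaarScalarFactor_pos_of_isAddHaarMeasure _ _).ne'
    · exact Measure.isAddLeftInvariant_eq_smul _ _
  have hme : MeasurableEmbedding Φ := Φ.toHomeomorph.measurableEmbedding
  have hμ : ∀ A : Set E, μ A = c * volume (Φ '' A) := by
    intro A
    rw [← preimage_image_eq A Φ.injective, ← hme.map_apply, hcμ, preimage_image_eq A Φ.injective]
    rfl
  have himg : Φ '' ((2⁻¹ : ℝ) • (K + -K)) = (2⁻¹ : ℝ) • (Φ '' K + -(Φ '' K)) := by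
    ext z
    constructor
    · rintro ⟨_, ⟨_, ⟨x, hx, y, hy, rfl⟩, rfl⟩, rfl⟩
      exact ⟨_, ⟨_, ⟨x, hx, rfl⟩, Φ y, ⟨-y, hy, map_neg Φ y⟩, rfl⟩, by simp⟩
    · rintro ⟨_, ⟨_, ⟨x, hx, rfl⟩, w, ⟨y, hy, hyw⟩, rfl⟩, rfl⟩
      obtain rfl : w = Φ (-y) := by rw [map_neg, hyw, neg_neg]
      exact ⟨(2⁻¹ : ℝ) • (x + -y), ⟨_, ⟨x, hx, -y, by simpa using hy, rfl⟩, rfl⟩, by simp⟩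
  have hle' : volume ((2⁻¹ : ℝ) • (Φ '' K + -(Φ '' K))) ≤ volume (Φ '' K) := by
    rw [hμ, hμ K, himg] at hle
    exact (ENNReal.mul_le_mul_iff_right hc0 hctop).1 hle
  have hi' : (interior (Φ '' K)).Nonempty := by
    have := Φ.toHomeomorph.image_interior K
    exact (hi.image Φ).mono this.subset
  have key : ∫ p in Φ '' K, p.1 = (sInf (Prod.fst '' (Φ '' K)) + sSup (Prod.fst '' (Φ '' K))) / 2 *
      (volume (Φ '' K)).toReal :=
    setIntegral_fst_eq_of_volume_le (hK.linear_image Φ.toLinearMap) (hc.image Φ.continuous) hi' hle'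
  have h1 : ∫ x in K, u x ∂μ = c.toReal * ∫ p in Φ '' K, p.1 := by
    rw [← smul_eq_mul, ← integral_smul_measure, ← Measure.restrict_smul, ← hcμ,
      hme.setIntegral_map, preimage_image_eq K Φ.injective]
    rfl
  have h2 : Prod.fst '' (Φ '' K) = u '' K := by rw [image_image]; rfl
  rw [h1, key, h2, measureReal_def, hμ K, ENNReal.toReal_mul]
  ring

/-- A convex body whose difference body has the smallest possible volume is centrally
symmetric. -/
theorem exists_center_of_measure_le {E : Type*} [NormedAddCommGroup E] [NormedSpace ℝ E]
    [FiniteDimensional ℝ E] [MeasurableSpace E] [BorelSpace E] (μ : Measure E)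
    [μ.IsAddHaarMeasure] {K : Set E} (hK : Convex ℝ K) (hc : IsCompact K)
    (hi : (interior K).Nonempty) (hle : μ ((2⁻¹ : ℝ) • (K + -K)) ≤ μ K) :
    ∃ c, ∀ x ∈ K, c - x ∈ K := by
  have hpos : 0 < μ.real K :=
    ENNReal.toReal_pos (Measure.measure_pos_of_nonempty_interior μ hi).ne' hc.measure_lt_top.ne
  -- The centre of symmetry is the centroid. If the reflected point were outside `K`, a separating
  -- functional `u` would have a larger value there than `sup u`; but the centroid is halfway
  -- between the supporting hyperplanes of `u`, so the value is `inf u + sup u - u x ≤ sup u`.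
  refine ⟨(2 * (μ.real K)⁻¹) • ∫ x in K, x ∂μ, fun x hx => ?_⟩
  by_contra hcon
  obtain ⟨u, s, h1, h2⟩ := geometric_hahn_banach_closed_point hK hc.isClosed hcon
  have hu : u ≠ 0 := by
    rintro rfl
    exact lt_asymm (h1 x hx) h2
  have h3 : u (∫ x in K, x ∂μ) = (sInf (u '' K) + sSup (u '' K)) / 2 * μ.real K := by
    rw [← setIntegral_apply_eq_of_measure_le hK hc hi hle hu]
    exact (u.integral_comp_comm (continuous_id.continuousOn.integrableOn_compact hc)).symm
  rw [map_sub, map_smul, h3, smul_eq_mul] at h2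
  have h4 : 2 * (μ.real K)⁻¹ * ((sInf (u '' K) + sSup (u '' K)) / 2 * μ.real K) =
      sInf (u '' K) + sSup (u '' K) := by
    field_simp
  have h5 : sInf (u '' K) ≤ u x := csInf_le (hc.image u.continuous).bddBelow ⟨x, hx, rfl⟩
  have h6 : sSup (u '' K) ≤ s := csSup_le ⟨_, x, hx, rfl⟩ (by
    rintro _ ⟨y, hy, rfl⟩
    exact (h1 y hy).le)
  linarith

end CentralSymmetry

/-! ### Faces of convex polytopes as sets of maximizers -/

section Faces

open Set Filter Topology

variable {V : Type*} [NormedAddCommGroup V] [InnerProductSpace ℝ V]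

/-- The face of `C` in the direction `m`: the set of points of `C` at which `⟪m, ·⟫` is maximal. -/
def dirFace (C : Set V) (m : V) : Set V := {x ∈ C | ∀ y ∈ C, inner ℝ m y ≤ inner ℝ m x}

theorem dirFace_subset (C : Set V) (m : V) : dirFace C m ⊆ C := fun _ hx => hx.1

theorem inner_eq_of_mem_dirFace {C : Set V} {m x y : V} (hx : x ∈ dirFace C m)
    (hy : y ∈ dirFace C m) : inner ℝ m x = inner ℝ m y :=
  le_antisymm (hy.2 x hx.1) (hx.2 y hy.1)

theorem mem_dirFace_iff {C : Set V} {m x y : V} (hx : x ∈ dirFace C m) :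
    y ∈ dirFace C m ↔ y ∈ C ∧ inner ℝ m y = inner ℝ m x :=
  ⟨fun hy => ⟨hy.1, inner_eq_of_mem_dirFace hy hx⟩, fun hy => ⟨hy.1, fun z hz => hy.2 ▸ hx.2 z hz⟩⟩

theorem mem_dirFace_of_le {C : Set V} {m x y : V} (hx : x ∈ dirFace C m) (hy : y ∈ C)
    (h : inner ℝ m x ≤ inner ℝ m y) : y ∈ dirFace C m :=
  ⟨hy, fun z hz => (hx.2 z hz).trans h⟩

theorem inner_lt_of_notMem_dirFace {C : Set V} {m x y : V} (hx : x ∈ dirFace C m) (hy : y ∈ C)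
    (h : y ∉ dirFace C m) : inner ℝ m y < inner ℝ m x :=
  lt_of_not_ge fun h' => h (mem_dirFace_of_le hx hy h')

theorem Convex.dirFace {C : Set V} (hC : Convex ℝ C) (m : V) : Convex ℝ (dirFace C m) := by
  intro x hx y hy a b ha hb hab
  refine ⟨hC hx.1 hy.1 ha hb hab, fun z hz => ?_⟩
  rw [inner_add_right, inner_smul_right, inner_smul_right, inner_eq_of_mem_dirFace hy hx,
    ← add_mul, hab, one_mul]
  exact hx.2 z hz

theorem dirFace_vadd (C : Set V) (m t : V) : dirFace (t +ᵥ C) m = t +ᵥ dirFace C m := by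
  ext x
  simp only [mem_vadd_set_iff_neg_vadd_mem, dirFace, mem_ofPred_eq, vadd_eq_add]
  refine and_congr_right fun _ => ⟨fun h y hy => ?_, fun h y hy => ?_⟩
  · have := h (t + y) (by simpa using hy)
    simp only [inner_add_right, inner_neg_right] at this ⊢
    linarith
  · have := h _ hy
    simp only [inner_add_right, inner_neg_right] at this ⊢
    linarith

theorem dirFace_smul (C : Set V) (m : V) {a : ℝ} (ha : 0 < a) :
    dirFace C (a • m) = dirFace C m := by
  simp only [dirFace, real_inner_smul_left, mul_le_mul_iff_right₀ ha]

theorem sub_mem_orthogonal_vectorSpan {F : Set V} {m : V}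
    (h : ∀ x ∈ F, ∀ y ∈ F, inner ℝ m x = inner ℝ m y) : m ∈ (vectorSpan ℝ F)ᗮ := by
  rw [Submodule.mem_orthogonal']
  intro u hu
  refine Submodule.span_induction ?_ (by simp) (fun a b _ _ ha hb => ?_) (fun c a _ ha => ?_) hu
  · rintro _ ⟨x, hx, y, hy, rfl⟩
    change inner ℝ m (x - y) = 0
    rw [inner_sub_right, h x hx y hy, sub_self]
  · rw [inner_add_right, ha, hb, add_zero]
  · rw [inner_smul_right, ha, mul_zero]

theorem mem_orthogonal_vectorSpan_dirFace (C : Set V) (m : V) :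
    m ∈ (vectorSpan ℝ (dirFace C m))ᗮ :=
  sub_mem_orthogonal_vectorSpan fun _ hx _ hy => inner_eq_of_mem_dirFace hx hy

theorem inner_sub_eq_zero_of_mem_orthogonal {F : Set V} {m x y : V}
    (hm : m ∈ (vectorSpan ℝ F)ᗮ) (hx : x ∈ F) (hy : y ∈ F) : inner ℝ m (x - y) = 0 :=
  (Submodule.mem_orthogonal' _ _).1 hm _ (vsub_mem_vectorSpan ℝ hx hy)

theorem notMem_interior_of_mem_dirFace {C : Set V} {m x : V} (hm : m ≠ 0)
    (hx : x ∈ dirFace C m) : x ∉ interior C := by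
  intro hxi
  have hc : Tendsto (fun t : ℝ => x + t • m) (𝓝[>] 0) (𝓝 x) := by
    have : Continuous fun t : ℝ => x + t • m := by fun_prop
    have h := this.tendsto 0
    simp only [zero_smul, add_zero] at h
    exact h.mono_left nhdsWithin_le_nhds
  obtain ⟨t, ht1, ht2⟩ := ((hc.eventually (mem_interior_iff_mem_nhds.1 hxi)).and
    self_mem_nhdsWithin).exists
  have h1 := hx.2 _ ht1
  rw [inner_add_right, inner_smul_right] at h1
  have h2 : 0 < inner ℝ m m := real_inner_self_pos.2 hm
  have : 0 < t * inner ℝ m m := mul_pos ht2 h2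
  linarith

/-- `x` lies in the relative interior of `F`. -/
def IsRelInterior (F : Set V) (x : V) : Prop :=
  x ∈ F ∧ ∃ r > 0, ∀ g ∈ vectorSpan ℝ F, ‖g‖ < r → x + g ∈ F

theorem Convex.exists_isRelInterior [FiniteDimensional ℝ V] {F : Set V} (hF : Convex ℝ F)
    (hne : F.Nonempty) : ∃ x, IsRelInterior F x := by
  obtain ⟨_, y, hy, rfl⟩ := hne.intrinsicInterior hF
  rw [mem_interior_iff_mem_nhds, Metric.mem_nhds_iff] at hy
  obtain ⟨r, hr, hball⟩ := hy
  refine ⟨y, hball (Metric.mem_ball_self hr), r, hr, fun g hg hgr => ?_⟩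
  have hmem : (y : V) + g ∈ affineSpan ℝ F := by
    rw [add_comm]
    exact AffineSubspace.vadd_mem_of_mem_direction
      (by rwa [direction_affineSpan]) y.2
  have : (⟨(y : V) + g, hmem⟩ : affineSpan ℝ F) ∈ Metric.ball y r := by
    rw [Metric.mem_ball, Subtype.dist_eq, dist_eq_norm]
    simpa using hgr
  exact hball this

/-- A smaller value at `y` would give a larger one just beyond `x` on the ray from `y` through `x`,
which stays in `F` for a while. -/
theorem IsRelInterior.inner_eq {F : Set V} {x y m : V} (hx : IsRelInterior F x)
    (h : ∀ z ∈ F, inner ℝ m z ≤ inner ℝ m x) (hy : y ∈ F) : inner ℝ m y = inner ℝ m x := by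
  obtain ⟨hxF, r, hr, hball⟩ := hx
  refine le_antisymm (h y hy) ?_
  obtain ⟨t, ht0, htr⟩ : ∃ t : ℝ, 0 < t ∧ ‖t • (x - y)‖ < r := by
    refine ⟨r / (2 * (‖x - y‖ + 1)), by positivity, ?_⟩
    rw [norm_smul, Real.norm_of_nonneg (by positivity), div_mul_eq_mul_div,
      div_lt_iff₀ (by positivity)]
    nlinarith [norm_nonneg (x - y)]
  have h1 := h _ (hball (t • (x - y)) (Submodule.smul_mem _ _ (vsub_mem_vectorSpan ℝ hxF hy)) htr)
  rw [inner_add_right, inner_smul_right, inner_sub_right] at h1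
  nlinarith

theorem IsRelInterior.subset_dirFace {C F : Set V} {x m : V} (hx : IsRelInterior F x) (hF : F ⊆ C)
    (hxm : x ∈ dirFace C m) : F ⊆ dirFace C m := fun _ hy =>
  mem_dirFace_of_le hxm (hF hy) (hx.inner_eq (fun z hz => hxm.2 z (hF hz)) hy).ge

theorem inner_le_of_mem_convexHull {W : Set V} {m : V} {c : ℝ} (h : ∀ w ∈ W, inner ℝ m w ≤ c) :
    ∀ x ∈ convexHull ℝ W, inner ℝ m x ≤ c :=
  fun _ hx => convexHull_min (t := {x | inner ℝ m x ≤ c}) h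
    (convex_halfSpace_le (innerₛₗ ℝ m).isLinear c) hx

/-- A face of a face of a polytope is a face of the polytope. -/
theorem dirFace_dirFace {W : Set V} (hW : W.Finite) {m l : V}
    (hne : (dirFace (dirFace (convexHull ℝ W) m) l).Nonempty) :
    ∃ m', dirFace (dirFace (convexHull ℝ W) m) l = dirFace (convexHull ℝ W) m' := by
  obtain ⟨x₀, hx₀⟩ := hne
  have hx₁ := hx₀.1
  -- At generators outside the face of `m` a large multiple of `m` outweighs `l`. As there are
  -- finitely many generators, a single `N` works for all.
  obtain ⟨N, hN⟩ : ∃ N : ℝ, ∀ w ∈ W,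
      inner ℝ (N • m + l) w ≤ inner ℝ (N • m + l) x₀ := by
    refine Filter.Eventually.exists (f := atTop) ((hW.eventually_all).2 fun w hw => ?_)
    have hwC := subset_convexHull ℝ W hw
    by_cases h : w ∈ dirFace (convexHull ℝ W) m
    · refine Eventually.of_forall fun N => ?_
      rw [inner_add_left, inner_add_left, real_inner_smul_left, real_inner_smul_left,
        inner_eq_of_mem_dirFace h hx₁]
      linarith [hx₀.2 w h]
    · have hlt := inner_lt_of_notMem_dirFace hx₁ hwC h
      filter_upwards [eventually_ge_atTop
        ((inner ℝ l w - inner ℝ l x₀) / (inner ℝ m x₀ - inner ℝ m w))] with N hN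
      rw [div_le_iff₀ (by linarith)] at hN
      rw [inner_add_left, inner_add_left, real_inner_smul_left, real_inner_smul_left]
      linarith
  have hC := inner_le_of_mem_convexHull hN
  have e : ∀ x, inner ℝ ((N + 1) • m + l) x = inner ℝ (N • m + l) x + inner ℝ m x := by
    intro x
    simp only [inner_add_left, real_inner_smul_left]
    ring
  -- The additional copy of `m` separates the two conditions: a maximizer of the sum `(N • m + l) +
  -- m` maximizes both summands, hence `m`, and then `l` on the face of `m`.
  have hmem : x₀ ∈ dirFace (convexHull ℝ W) ((N + 1) • m + l) :=
    ⟨hx₁.1, fun y hy => by rw [e, e]; linarith [hC y hy, hx₁.2 y hy]⟩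
  refine ⟨(N + 1) • m + l, ?_⟩
  ext x
  rw [mem_dirFace_iff hx₀, mem_dirFace_iff hx₁, mem_dirFace_iff hmem]
  constructor
  · rintro ⟨⟨h1, h2⟩, h3⟩
    refine ⟨h1, ?_⟩
    simp only [inner_add_left, real_inner_smul_left, h2, h3]
  · rintro ⟨h1, h2⟩
    rw [e, e] at h2
    have h3 : inner ℝ m x = inner ℝ m x₀ := by linarith [hC x h1, hx₁.2 x h1]
    refine ⟨⟨h1, h3⟩, ?_⟩
    simp only [inner_add_left, real_inner_smul_left, h3] at h2
    linarith

theorem vectorSpan_eq_top_of_interior_nonempty {C : Set V} (h : (interior C).Nonempty) :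
    vectorSpan ℝ C = ⊤ := by
  rw [← direction_affineSpan, affineSpan_eq_top_of_nonempty_interior
    (h.mono (interior_mono (subset_convexHull ℝ C))), AffineSubspace.direction_top]

theorem ne_zero_of_finrank_dirFace {C : Set V} (h : (interior C).Nonempty) {m : V}
    (hd : Module.finrank ℝ (vectorSpan ℝ (dirFace C m)) < Module.finrank ℝ V) : m ≠ 0 := by
  rintro rfl
  have : dirFace C (0 : V) = C := by simp [dirFace]
  rw [this, vectorSpan_eq_top_of_interior_nonempty h, finrank_top] at hd
  exact lt_irrefl _ hd

theorem orthogonal_eq_span_singleton [FiniteDimensional ℝ V] {S : Submodule ℝ V} {m : V}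
    (hd : Module.finrank ℝ S + 1 = Module.finrank ℝ V) (hm : m ∈ Sᗮ) (h0 : m ≠ 0) :
    Sᗮ = ℝ ∙ m := by
  symm
  refine Submodule.eq_of_le_of_finrank_eq ((Submodule.span_singleton_le_iff_mem _ _).2 hm) ?_
  rw [finrank_span_singleton h0]
  have := S.finrank_add_finrank_orthogonal
  omega

/-- A facet and a facet of it lie in a second facet of the polytope. -/
theorem exists_other_facet [FiniteDimensional ℝ V] {W : Set V} (hW : W.Finite)
    (hi : (interior (convexHull ℝ W)).Nonempty) {m l : V}
    (hm : Module.finrank ℝ (vectorSpan ℝ (dirFace (convexHull ℝ W) m)) + 1 = Module.finrank ℝ V)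
    (hl : Module.finrank ℝ (vectorSpan ℝ (dirFace (dirFace (convexHull ℝ W) m) l)) + 2 =
      Module.finrank ℝ V)
    (hne : (dirFace (dirFace (convexHull ℝ W) m) l).Nonempty) :
    ∃ m', Module.finrank ℝ (vectorSpan ℝ (dirFace (convexHull ℝ W) m')) + 1 = Module.finrank ℝ V ∧
      dirFace (convexHull ℝ W) m ∩ dirFace (convexHull ℝ W) m' =
        dirFace (dirFace (convexHull ℝ W) m) l := by
  set C := convexHull ℝ W with hC
  obtain ⟨x₀, hx₀⟩ := hne
  have hx₁ := hx₀.1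
  have hm0 : m ≠ 0 := ne_zero_of_finrank_dirFace hi (by omega)
  have hout : {w ∈ W | w ∉ dirFace C m}.Nonempty := by
    by_contra! hcon
    have h1 : W ⊆ dirFace C m := fun w hw => by
      by_contra h
      exact (hcon.subset ⟨hw, h⟩ : w ∈ (∅ : Set V))
    have h2 : C ⊆ dirFace C m := convexHull_min h1 ((convex_convexHull ℝ W).dirFace m)
    obtain ⟨y, hy⟩ := hi
    exact notMem_interior_of_mem_dirFace hm0 (h2 (interior_subset hy)) hy
  -- The supporting hyperplane is rotated about the given ridge until it touches a generator off the
  -- facet. The least quotient `θ` is the slope at which this happens, and `w₀` is a generator that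
  -- is touched.
  obtain ⟨w₀, ⟨hw₀, hw₀'⟩, hmin⟩ := Set.exists_min_image _
    (fun w => (inner ℝ l x₀ - inner ℝ l w) / (inner ℝ m x₀ - inner ℝ m w))
    (hW.subset (sep_subset _ _)) hout
  set θ := (inner ℝ l x₀ - inner ℝ l w₀) / (inner ℝ m x₀ - inner ℝ m w₀) with hθ
  have hw₀C : w₀ ∈ C := subset_convexHull ℝ W hw₀
  have hlt₀ := inner_lt_of_notMem_dirFace hx₁ hw₀C hw₀'
  have e : ∀ x, inner ℝ (l - θ • m) x = inner ℝ l x - θ * inner ℝ m x := by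
    intro x
    rw [inner_sub_left, real_inner_smul_left]
  have hle : ∀ x ∈ C, inner ℝ (l - θ • m) x ≤ inner ℝ (l - θ • m) x₀ := by
    refine inner_le_of_mem_convexHull fun w hw => ?_
    have hwC : w ∈ C := subset_convexHull ℝ W hw
    rw [e, e]
    by_cases h : w ∈ dirFace C m
    · rw [inner_eq_of_mem_dirFace h hx₁]
      linarith [hx₀.2 w h]
    · have hlt := inner_lt_of_notMem_dirFace hx₁ hwC h
      have := hmin w ⟨hw, h⟩
      rw [le_div_iff₀ (by linarith)] at this
      linarith
  have hx₂ : x₀ ∈ dirFace C (l - θ • m) := ⟨hx₁.1, hle⟩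
  have hw₂ : w₀ ∈ dirFace C (l - θ • m) := by
    refine mem_dirFace_of_le hx₂ hw₀C ?_
    have : θ * (inner ℝ m x₀ - inner ℝ m w₀) = inner ℝ l x₀ - inner ℝ l w₀ :=
      div_mul_cancel₀ _ (by linarith)
    rw [e, e]
    linarith
  have hinter : dirFace C m ∩ dirFace C (l - θ • m) = dirFace (dirFace C m) l := by
    ext x
    rw [mem_inter_iff, mem_dirFace_iff hx₂, mem_dirFace_iff hx₀]
    constructor
    · rintro ⟨h1, h2, h3⟩
      refine ⟨h1, ?_⟩
      rw [e, e, inner_eq_of_mem_dirFace h1 hx₁] at h3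
      linarith
    · rintro ⟨h1, h2⟩
      refine ⟨h1, h1.1, ?_⟩
      rw [e, e, h2, inner_eq_of_mem_dirFace h1 hx₁]
  refine ⟨l - θ • m, ?_, hinter⟩
  have hm'0 : l - θ • m ≠ 0 := by
    intro h0
    have : dirFace (dirFace C m) l = dirFace C m := by
      rw [← hinter, h0]
      simp [dirFace]
    rw [this] at hl
    omega
  -- The touched generator `w₀` makes the new face strictly larger than the ridge, while a nonzero
  -- normal keeps it below full dimension; so it is a facet.
  have hsub : vectorSpan ℝ (dirFace (dirFace C m) l) < vectorSpan ℝ (dirFace C (l - θ • m)) := by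
    refine lt_of_le_of_ne (vectorSpan_mono ℝ (hinter ▸ inter_subset_right)) fun h => ?_
    have h1 : w₀ - x₀ ∈ vectorSpan ℝ (dirFace (dirFace C m) l) := by
      rw [h]
      exact vsub_mem_vectorSpan ℝ hw₂ hx₂
    have h2 : m ∈ (vectorSpan ℝ (dirFace (dirFace C m) l))ᗮ :=
      sub_mem_orthogonal_vectorSpan fun x hx y hy => inner_eq_of_mem_dirFace hx.1 hy.1
    have h3 := (Submodule.mem_orthogonal' _ _).1 h2 _ h1
    rw [inner_sub_right] at h3
    linarith
  have h1 := Submodule.finrank_lt_finrank_of_lt hsub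
  have h2 : 0 < Module.finrank ℝ (vectorSpan ℝ (dirFace C (l - θ • m)))ᗮ := by
    have : Nontrivial (vectorSpan ℝ (dirFace C (l - θ • m)))ᗮ :=
      ⟨⟨⟨_, mem_orthogonal_vectorSpan_dirFace C _⟩, 0, fun h => hm'0 (congrArg Subtype.val h)⟩⟩
    exact Module.finrank_pos
  have h3 := (vectorSpan ℝ (dirFace C (l - θ • m))).finrank_add_finrank_orthogonal
  omega

/-- Near a relative interior point of the intersection `G` of two facets, a convex body contains
the wedge that the facets cut out. -/
theorem exists_mem_interior_of_wedge {D G : Set V} (hD : Convex ℝ D) {m m' x₀ x₁ x₂ w : V}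
    (hG : G ⊆ D) (hx₀ : IsRelInterior G x₀)
    (hGV : ∀ g, inner ℝ m g = 0 → inner ℝ m' g = 0 → g ∈ vectorSpan ℝ G)
    (h₁D : x₁ ∈ D) (h₂D : x₂ ∈ D)
    (h₁ : inner ℝ m (x₁ - x₀) = 0) (h₁' : inner ℝ m' (x₁ - x₀) < 0)
    (h₂ : inner ℝ m (x₂ - x₀) < 0) (h₂' : inner ℝ m' (x₂ - x₀) = 0)
    (hw : inner ℝ m w < 0) (hw' : inner ℝ m' w < 0) :
    ∀ᶠ ε in 𝓝[>] (0 : ℝ), x₀ + ε • w ∈ interior D := by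
  obtain ⟨hx₀G, r, hr, hball⟩ := hx₀
  -- A small vector `z` is split as `α (x₁ - x₀) + β (x₂ - x₀) + g` with `g` parallel to `G`. Then
  -- `x₀ + z` is the convex combination of `x₀ + 2 g`, `x₁`, `x₂` and `x₀` with weights `1/2`, `α`,
  -- `β` and `1/2 - α - β`.
  set α : V → ℝ := fun w => inner ℝ m' w / inner ℝ m' (x₁ - x₀) with hα
  set β : V → ℝ := fun w => inner ℝ m w / inner ℝ m (x₂ - x₀) with hβ
  set g : V → V := fun w => w - α w • (x₁ - x₀) - β w • (x₂ - x₀) with hg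
  have hαc : Continuous α := by fun_prop
  have hβc : Continuous β := by fun_prop
  have hgc : Continuous g := by fun_prop
  set O : Set V := {w | inner ℝ m w < 0 ∧ inner ℝ m' w < 0 ∧ α w + β w < 1 / 2 ∧
    ‖(2 : ℝ) • g w‖ < r} with hO
  have hOo : IsOpen O := by
    have o1 : ∀ m : V, IsOpen {w | inner ℝ m w < 0} := fun m =>
      isOpen_lt (by fun_prop) continuous_const
    have o2 : IsOpen {w | α w + β w < 1 / 2} := isOpen_lt (by fun_prop) continuous_const
    have o3 : IsOpen {w | ‖(2 : ℝ) • g w‖ < r} := isOpen_lt (by fun_prop) continuous_const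
    exact (o1 m).inter ((o1 m').inter (o2.inter o3))
  have hOD : ∀ z ∈ O, x₀ + z ∈ D := by
    rintro z ⟨hz1, hz2, hz3, hz4⟩
    have hα0 : 0 < α z := div_pos_of_neg_of_neg hz2 h₁'
    have hβ0 : 0 < β z := div_pos_of_neg_of_neg hz1 h₂
    have hgV : g z ∈ vectorSpan ℝ G := by
      refine hGV _ ?_ ?_
      · simp only [hg, inner_sub_right, inner_smul_right, hβ] at h₁ h₂ ⊢
        rw [h₁, div_mul_cancel₀ _ h₂.ne]
        ring
      · simp only [hg, inner_sub_right, inner_smul_right, hα] at h₁' h₂' ⊢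
        rw [h₂', div_mul_cancel₀ _ h₁'.ne]
        ring
    have hy := hG (hball _ (Submodule.smul_mem _ 2 hgV) hz4)
    have hconv := hD.sum_mem (t := Finset.univ) (w := ![1 / 2, α z, β z, 1 / 2 - α z - β z])
      (z := ![x₀ + (2 : ℝ) • g z, x₁, x₂, x₀])
      (by
        intro i _
        fin_cases i
        · simp
        · exact hα0.le
        · exact hβ0.le
        · change 0 ≤ 1 / 2 - α z - β z
          linarith)
      (by simp [Fin.sum_univ_four]; norm_num)
      (by
        intro i _
        fin_cases i
        exacts [hy, h₁D, h₂D, hG hx₀G])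
    convert hconv using 1
    simp only [Fin.sum_univ_four, Matrix.cons_val, hg]
    module
  have hev : ∀ᶠ ε in 𝓝[>] (0 : ℝ), ε • w ∈ O := by
    have c1 : ∀ᶠ ε in 𝓝 (0 : ℝ), α (ε • w) + β (ε • w) < 1 / 2 := by
      have : ContinuousAt (fun ε : ℝ => α (ε • w) + β (ε • w)) 0 := by fun_prop
      refine this.eventually_lt continuousAt_const ?_
      simp [hα, hβ]
    have c2 : ∀ᶠ ε in 𝓝 (0 : ℝ), ‖(2 : ℝ) • g (ε • w)‖ < r := by
      have : ContinuousAt (fun ε : ℝ => ‖(2 : ℝ) • g (ε • w)‖) 0 := by fun_prop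
      refine this.eventually_lt continuousAt_const ?_
      simpa [hα, hβ, hg] using hr
    filter_upwards [c1.filter_mono nhdsWithin_le_nhds, c2.filter_mono nhdsWithin_le_nhds,
      self_mem_nhdsWithin] with ε h1 h2 h3
    have h3' : 0 < ε := h3
    refine ⟨?_, ?_, h1, h2⟩
    · rw [inner_smul_right]; exact mul_neg_of_pos_of_neg h3' hw
    · rw [inner_smul_right]; exact mul_neg_of_pos_of_neg h3' hw'
  filter_upwards [hev] with ε hε
  rw [mem_interior]
  refine ⟨(fun z => x₀ + z) '' O, ?_, (Homeomorph.addLeft x₀).isOpenMap _ hOo, ⟨_, hε, rfl⟩⟩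
  rintro _ ⟨z, hz, rfl⟩
  exact hOD z hz

end Faces

/-! ### Local finiteness of the tiling and neighbouring cells -/

namespace Parallelohedra

open Set Filter Topology MeasureTheory

theorem dirFace_neg {V : Type*} [NormedAddCommGroup V] [InnerProductSpace ℝ V] (C : Set V)
    (m : V) : dirFace (-C) m = -dirFace C (-m) := by
  ext x
  simp only [dirFace, Set.mem_neg, mem_ofPred_eq]
  refine and_congr_right fun _ => ⟨fun h y hy => ?_, fun h y hy => ?_⟩
  · have := h (-y) (by simpa using hy)
    simpa using this
  · have := h _ hy
    simpa using this

/-- The translation raises the maximum of `⟪t, ·⟫` over `F` by `‖t‖ ^ 2`. -/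
theorem eq_zero_of_vadd_eq_self {V : Type*} [NormedAddCommGroup V] [InnerProductSpace ℝ V]
    {F : Set V} (hF : IsCompact F) (hne : F.Nonempty) {t : V} (h : t +ᵥ F = F) : t = 0 := by
  obtain ⟨x, hx, hmax⟩ := hF.exists_isMaxOn hne (f := fun x => inner ℝ t x) (by fun_prop)
  have h1 : t + x ∈ F := h ▸ vadd_mem_vadd_set hx
  have h2 : inner ℝ t (t + x) ≤ inner ℝ t x := hmax h1
  rw [inner_add_right] at h2
  exact real_inner_self_nonpos.1 (by linarith)

theorem eq_of_vadd_eq_vadd {V : Type*} [NormedAddCommGroup V] [InnerProductSpace ℝ V]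
    {F : Set V} (hF : IsCompact F) (hne : F.Nonempty) {s t : V} (h : s +ᵥ F = t +ᵥ F) : s = t := by
  have : (s - t) +ᵥ F = F := by
    rw [sub_eq_neg_add, add_vadd, h, neg_vadd_vadd]
  exact sub_eq_zero.1 (eq_zero_of_vadd_eq_self hF hne this)

theorem isCompact_dirFace {V : Type*} [NormedAddCommGroup V] [InnerProductSpace ℝ V]
    {C : Set V} (hC : IsCompact C) (m : V) : IsCompact (dirFace C m) := by
  rcases (dirFace C m).eq_empty_or_nonempty with h | ⟨x, hx⟩
  · rw [h]; exact isCompact_empty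
  · have : dirFace C m = C ∩ {y | inner ℝ m y = inner ℝ m x} := by
      ext y
      exact mem_dirFace_iff hx
    rw [this]
    exact hC.inter_right (isClosed_eq (by fun_prop) continuous_const)

variable {d : ℕ} {P : Set (EuclideanSpace ℝ (Fin d))} {𝒯 : Set (Set (EuclideanSpace ℝ (Fin d)))}

theorem isFace_iff {C F : Set (EuclideanSpace ℝ (Fin d))} :
    IsFace C F ↔ F.Nonempty ∧ ∃ m, F = dirFace C m := by
  refine and_congr_right fun hne => ⟨fun h => ?_, fun ⟨m, h⟩ _ => ?_⟩
  · obtain ⟨l, hl⟩ := h hne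
    refine ⟨(InnerProductSpace.toDual ℝ _).symm l, ?_⟩
    simp only [dirFace, InnerProductSpace.toDual_symm_apply]
    exact hl
  · exact ⟨InnerProductSpace.toDual ℝ _ m, h⟩

namespace IsParallelohedronTiling

theorem exists_finite_convexHull (h : IsParallelohedronTiling P 𝒯)
    {C : Set (EuclideanSpace ℝ (Fin d))} (hC : C ∈ 𝒯) :
    ∃ W : Set (EuclideanSpace ℝ (Fin d)), W.Finite ∧ C = convexHull ℝ W := by
  obtain ⟨v, rfl⟩ := h.translates C hC
  obtain ⟨W, hW, hP⟩ := h.polytope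
  exact ⟨v +ᵥ W, hW.vadd_set, by rw [hP, convexHull_vadd]⟩

theorem convex_base (h : IsParallelohedronTiling P 𝒯) : Convex ℝ P := by
  obtain ⟨W, -, hP⟩ := h.polytope
  exact hP ▸ convex_convexHull ℝ W

theorem isCompact_base (h : IsParallelohedronTiling P 𝒯) : IsCompact P := by
  obtain ⟨W, hW, hP⟩ := h.polytope
  exact hP ▸ hW.isCompact_convexHull ℝ

theorem convex (h : IsParallelohedronTiling P 𝒯)
    {C : Set (EuclideanSpace ℝ (Fin d))} (hC : C ∈ 𝒯) : Convex ℝ C := by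
  obtain ⟨W, -, hP⟩ := h.exists_finite_convexHull hC
  exact hP ▸ convex_convexHull ℝ W

theorem isCompact (h : IsParallelohedronTiling P 𝒯)
    {C : Set (EuclideanSpace ℝ (Fin d))} (hC : C ∈ 𝒯) : IsCompact C := by
  obtain ⟨W, hW, hP⟩ := h.exists_finite_convexHull hC
  exact hP ▸ hW.isCompact_convexHull ℝ

theorem interior_nonempty (h : IsParallelohedronTiling P 𝒯)
    {C : Set (EuclideanSpace ℝ (Fin d))} (hC : C ∈ 𝒯) :
    (interior C).Nonempty := by
  obtain ⟨v, rfl⟩ := h.translates C hC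
  rw [interior_vadd]
  exact h.full_dimensional.vadd_set

theorem base_nonempty (h : IsParallelohedronTiling P 𝒯)
    : P.Nonempty := h.full_dimensional.mono interior_subset

theorem countable (h : IsParallelohedronTiling P 𝒯) : 𝒯.Countable :=
  Set.PairwiseDisjoint.countable_of_isOpen (s := interior) h.disjoint_interiors
    (fun _ _ => isOpen_interior) (fun _ hC => h.interior_nonempty hC)

theorem disjoint_interior_cell (h : IsParallelohedronTiling P 𝒯)
    {C C' : Set (EuclideanSpace ℝ (Fin d))} (hC : C ∈ 𝒯)
    (hC' : C' ∈ 𝒯) (hne : C ≠ C') : Disjoint (interior C) C' := by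
  have h1 := h.disjoint_interiors C hC C' hC' hne
  have h2 : C' = closure (interior C') := by
    rw [(h.convex hC').closure_interior_eq_closure_of_nonempty_interior (h.interior_nonempty hC'),
      (h.isCompact hC').isClosed.closure_eq]
  rw [h2]
  exact h1.closure_right isOpen_interior

/-- All these cells lie in one larger ball, and their disjoint interiors have the same positive
volume. -/
theorem finite_meeting_ball (h : IsParallelohedronTiling P 𝒯) (R : ℝ) :
    {C ∈ 𝒯 | (C ∩ Metric.closedBall 0 R).Nonempty}.Finite := by
  set S := {C ∈ 𝒯 | (C ∩ Metric.closedBall 0 R).Nonempty} with hS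
  have hfin := Measure.finite_const_le_meas_of_disjoint_iUnion
    (volume : Measure (EuclideanSpace ℝ (Fin d)))
    (ε := volume (interior P)) (As := fun C : S => interior (C : Set (EuclideanSpace ℝ (Fin d))))
    (isOpen_interior.measure_pos _ h.full_dimensional)
    (fun C => isOpen_interior.measurableSet)
    (fun C C' hne => h.disjoint_interiors _ C.2.1 _ C'.2.1 fun e => hne (Subtype.ext e))
    (by
      refine ne_of_lt (lt_of_le_of_lt (measure_mono (t := Metric.closedBall 0 (R + Metric.diam P))
        ?_) measure_closedBall_lt_top)
      rw [iUnion_subset_iff]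
      rintro ⟨C, hC, x, hxC, hxR⟩ y hy
      replace hy : y ∈ C := interior_subset hy
      have hd : Metric.diam C = Metric.diam P := by
        obtain ⟨v, rfl⟩ := h.translates C hC
        exact diam_vadd v P
      have := Metric.dist_le_diam_of_mem (h.isCompact hC).isBounded hy hxC
      rw [Metric.mem_closedBall] at hxR ⊢
      linarith [dist_triangle y x 0])
  have : {C : S | volume (interior P) ≤
      volume (interior (C : Set (EuclideanSpace ℝ (Fin d))))} = univ := by
    refine eq_univ_of_forall fun C => ?_
    obtain ⟨v, hv⟩ := h.translates _ C.2.1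
    change volume (interior P) ≤ volume (interior (C : Set (EuclideanSpace ℝ (Fin d))))
    rw [hv, interior_vadd, measure_vadd]
  rw [this, Set.finite_univ_iff] at hfin
  exact Set.toFinite S

theorem isClosed_sUnion (h : IsParallelohedronTiling P 𝒯)
    {S : Set (Set (EuclideanSpace ℝ (Fin d)))} (hS : S ⊆ 𝒯) :
    IsClosed (⋃₀ S) := by
  rw [sUnion_eq_iUnion]
  refine LocallyFinite.isClosed_iUnion (fun x => ?_) fun C => (h.isCompact (hS C.2)).isClosed
  refine ⟨Metric.closedBall 0 (‖x‖ + 1), ?_, ?_⟩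
  · refine mem_of_superset (Metric.closedBall_mem_nhds x one_pos)
      (Metric.closedBall_subset_closedBall' ?_)
    rw [dist_zero_right, add_comm]
  · refine Set.Finite.of_finite_image (f := Subtype.val) ?_ Subtype.val_injective.injOn
    refine (h.finite_meeting_ball (‖x‖ + 1)).subset ?_
    rintro _ ⟨C, hC, rfl⟩
    exact ⟨hS C.2, hC⟩

theorem ne_zero_of_inter_eq (h : IsParallelohedronTiling P 𝒯)
    {C C' : Set (EuclideanSpace ℝ (Fin d))} (hC : C ∈ 𝒯) (hC' : C' ∈ 𝒯)
    (hne : C ≠ C') {l : EuclideanSpace ℝ (Fin d)} (hl : C ∩ C' = dirFace C l) : l ≠ 0 := by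
  rintro rfl
  have h1 : dirFace C (0 : EuclideanSpace ℝ (Fin d)) = C := by simp [dirFace]
  rw [h1, inter_eq_left] at hl
  obtain ⟨x, hx⟩ := h.interior_nonempty hC
  exact disjoint_left.1 (h.disjoint_interior_cell hC hC' hne) hx (hl (interior_subset hx))

/-- If two distinct cells share a hyperface, then it is their common face in opposite directions. -/
theorem inter_eq_dirFace_neg (h : IsParallelohedronTiling P 𝒯)
    {C C' : Set (EuclideanSpace ℝ (Fin d))} (hC : C ∈ 𝒯) (hC' : C' ∈ 𝒯)
    (hne : C ≠ C') (hn : (C ∩ C').Nonempty)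
    (hd : Module.finrank ℝ (vectorSpan ℝ (C ∩ C')) + 1 = d)
    {m : EuclideanSpace ℝ (Fin d)} (hm : C ∩ C' = dirFace C m) :
    C ∩ C' = dirFace C' (-m) := by
  obtain ⟨-, l, hl⟩ := isFace_iff.1 (h.face_to_face C hC C' hC' hn).2
  have hl0 : l ≠ 0 := h.ne_zero_of_inter_eq hC' hC hne.symm (by rw [inter_comm, hl])
  have hm0 : m ≠ 0 := h.ne_zero_of_inter_eq hC hC' hne hm
  have h1 : l ∈ (vectorSpan ℝ (C ∩ C'))ᗮ := hl ▸ mem_orthogonal_vectorSpan_dirFace C' l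
  have h2 : m ∈ (vectorSpan ℝ (C ∩ C'))ᗮ := hm ▸ mem_orthogonal_vectorSpan_dirFace C m
  rw [orthogonal_eq_span_singleton (by simpa using hd) h2 hm0, Submodule.mem_span_singleton] at h1
  obtain ⟨b, rfl⟩ := h1
  rcases lt_trichotomy b 0 with hb | rfl | hb
  · rw [hl, ← neg_smul_neg, dirFace_smul _ _ (neg_pos.2 hb)]
  · simp at hl0
  -- Two cells with the same face in the same direction are translates of each other by zero, hence
  -- equal.
  · exfalso
    rw [dirFace_smul _ _ hb] at hl
    obtain ⟨x, rfl⟩ := h.translates C hC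
    obtain ⟨y, rfl⟩ := h.translates C' hC'
    rw [hm, dirFace_vadd, dirFace_vadd] at hl
    refine hne (congrArg (· +ᵥ P) (eq_of_vadd_eq_vadd (isCompact_dirFace h.isCompact_base m) ?_ hl))
    rw [hm, dirFace_vadd] at hn
    exact vadd_set_nonempty.1 hn

/-- Each hyperface of a cell is shared with a second cell. -/
theorem exists_neighbour (h : IsParallelohedronTiling P 𝒯)
    {C : Set (EuclideanSpace ℝ (Fin d))} (hC : C ∈ 𝒯)
    {m : EuclideanSpace ℝ (Fin d)} (hn : (dirFace C m).Nonempty)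
    (hd : Module.finrank ℝ (vectorSpan ℝ (dirFace C m)) + 1 = d) :
    ∃ C' ∈ 𝒯, C ≠ C' ∧ C ∩ C' = dirFace C m ∧ dirFace C' (-m) = dirFace C m := by
  have hm0 : m ≠ 0 := ne_zero_of_finrank_dirFace (h.interior_nonempty hC) (by simp; omega)
  obtain ⟨x₀, hx₀⟩ := ((h.convex hC).dirFace m).exists_isRelInterior hn
  have hcl := h.isClosed_sUnion (S := 𝒯 \ {C}) sdiff_subset
  -- The union of the other cells is closed. If it missed `x₀`, points slightly outside `C` near
  -- `x₀` would have to lie in `C`.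
  have hx₀' : x₀ ∈ ⋃₀ (𝒯 \ {C}) := by
    by_contra hcon
    have hev : ∀ᶠ t in 𝓝[>] (0 : ℝ), x₀ + t • m ∉ ⋃₀ (𝒯 \ {C}) := by
      have hc : Continuous fun t : ℝ => x₀ + t • m := by fun_prop
      have h1 := hc.tendsto 0
      simp only [zero_smul, add_zero] at h1
      exact (h1.mono_left nhdsWithin_le_nhds).eventually (hcl.isOpen_compl.mem_nhds hcon)
    obtain ⟨t, ht, ht0⟩ := (hev.and self_mem_nhdsWithin).exists
    obtain ⟨C', hC', hxC'⟩ := (h.covers ▸ mem_univ _ : x₀ + t • m ∈ ⋃₀ 𝒯)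
    have hCC : C' = C := by
      by_contra hne
      exact ht ⟨C', ⟨hC', hne⟩, hxC'⟩
    rw [hCC] at hxC'
    have h2 := hx₀.1.2 _ hxC'
    rw [inner_add_right, inner_smul_right] at h2
    have h3 : 0 < t * inner ℝ m m := mul_pos ht0 (real_inner_self_pos.2 hm0)
    linarith
  obtain ⟨C', ⟨hC', hne⟩, hxC'⟩ := hx₀'
  have hne : C ≠ C' := fun e => hne e.symm
  have hnn : (C ∩ C').Nonempty := ⟨x₀, hx₀.1.1, hxC'⟩
  obtain ⟨-, l, hl⟩ := isFace_iff.1 (h.face_to_face C hC C' hC' hnn).1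
  have hl0 := h.ne_zero_of_inter_eq hC hC' hne hl
  have hxl : x₀ ∈ dirFace C l := hl ▸ ⟨hx₀.1.1, hxC'⟩
  -- The face common to both cells contains a relative interior point of the facet, hence the whole
  -- facet; its direction `l` is then parallel to `m`.
  have hsub := hx₀.subset_dirFace (dirFace_subset C m) hxl
  have h1 : l ∈ (vectorSpan ℝ (dirFace C m))ᗮ :=
    sub_mem_orthogonal_vectorSpan fun x hx y hy => inner_eq_of_mem_dirFace (hsub hx) (hsub hy)
  rw [orthogonal_eq_span_singleton (by simpa using hd) (mem_orthogonal_vectorSpan_dirFace C m) hm0,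
    Submodule.mem_span_singleton] at h1
  obtain ⟨a, rfl⟩ := h1
  have ha : a ≠ 0 := by rintro rfl; simp at hl0
  have heq : C ∩ C' = dirFace C m := by
    refine subset_antisymm ?_ (hl ▸ hsub)
    rw [hl]
    intro y hy
    have := inner_eq_of_mem_dirFace hy hxl
    rw [real_inner_smul_left, real_inner_smul_left] at this
    exact (mem_dirFace_iff hx₀.1).2 ⟨hy.1, mul_left_cancel₀ ha this⟩
  refine ⟨C', hC', hne, heq, ?_⟩
  rw [← heq]
  exact (h.inter_eq_dirFace_neg hC hC' hne hnn (by rwa [heq]) heq).symm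

end IsParallelohedronTiling

end Parallelohedra

/-! ### The lattice of facet vectors and Minkowski's theorem -/

namespace Parallelohedra

open Set Filter Topology MeasureTheory

/-- The translation that carries one of two opposite facets of `P` onto the other one. -/
def IsFacetVector {d : ℕ} (P : Set (EuclideanSpace ℝ (Fin d))) (t : EuclideanSpace ℝ (Fin d)) :
    Prop :=
  ∃ m, (dirFace P m).Nonempty ∧ Module.finrank ℝ (vectorSpan ℝ (dirFace P m)) + 1 = d ∧
    dirFace P m = t +ᵥ dirFace P (-m)

variable {d : ℕ} {P : Set (EuclideanSpace ℝ (Fin d))} {𝒯 : Set (Set (EuclideanSpace ℝ (Fin d)))}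

theorem IsFacetVector.neg {t : EuclideanSpace ℝ (Fin d)} (ht : IsFacetVector P t) :
    IsFacetVector P (-t) := by
  obtain ⟨m, hn, hd, hm⟩ := ht
  have hm' : dirFace P (-m) = -t +ᵥ dirFace P m := by rw [hm, neg_vadd_vadd]
  refine ⟨-m, ?_, ?_, by rw [neg_neg, hm']⟩
  · rw [hm']; exact hn.vadd_set
  · rw [hm', vectorSpan_vadd]; exact hd

namespace IsParallelohedronTiling

theorem vadd_base_injective (h : IsParallelohedronTiling P 𝒯)
    {x y : EuclideanSpace ℝ (Fin d)} (hxy : x +ᵥ P = y +ᵥ P) : x = y :=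
  eq_of_vadd_eq_vadd h.isCompact_base h.base_nonempty hxy

/-- The facet vector of a hyperface of a cell. -/
theorem exists_isFacetVector (h : IsParallelohedronTiling P 𝒯)
    {x : EuclideanSpace ℝ (Fin d)} (hx : x +ᵥ P ∈ 𝒯)
    {m : EuclideanSpace ℝ (Fin d)} (hn : (dirFace P m).Nonempty)
    (hd : Module.finrank ℝ (vectorSpan ℝ (dirFace P m)) + 1 = d) :
    ∃ t, (x + t) +ᵥ P ∈ 𝒯 ∧ dirFace P m = t +ᵥ dirFace P (-m) := by
  obtain ⟨C', hC', -, -, h2⟩ := h.exists_neighbour hx (m := m)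
    (by rw [dirFace_vadd]; exact hn.vadd_set) (by rwa [dirFace_vadd, vectorSpan_vadd])
  obtain ⟨y, rfl⟩ := h.translates C' hC'
  refine ⟨y - x, by rwa [add_sub_cancel], ?_⟩
  rw [dirFace_vadd, dirFace_vadd] at h2
  rw [sub_eq_neg_add, add_vadd, h2, neg_vadd_vadd]

/-- The shift to the neighbour across a facet is determined by `P` alone, so it is the same for
every cell. -/
theorem add_mem_of_isFacetVector (h : IsParallelohedronTiling P 𝒯)
    {x t : EuclideanSpace ℝ (Fin d)} (hx : x +ᵥ P ∈ 𝒯)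
    (ht : IsFacetVector P t) : (x + t) +ᵥ P ∈ 𝒯 := by
  obtain ⟨m, hn, hd, hm⟩ := ht
  obtain ⟨s, hs, hs'⟩ := h.exists_isFacetVector hx hn hd
  have : s = t := by
    refine eq_of_vadd_eq_vadd (isCompact_dirFace h.isCompact_base (-m)) ?_ (hs'.symm.trans hm)
    rw [hm] at hn
    exact vadd_set_nonempty.1 hn
  rwa [← this]

theorem isFacetVector_of_inter (h : IsParallelohedronTiling P 𝒯)
    {x y : EuclideanSpace ℝ (Fin d)} (hx : x +ᵥ P ∈ 𝒯)
    (hy : y +ᵥ P ∈ 𝒯) (hne : x ≠ y) (hn : ((x +ᵥ P) ∩ (y +ᵥ P)).Nonempty)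
    (hd : Module.finrank ℝ (vectorSpan ℝ ((x +ᵥ P) ∩ (y +ᵥ P))) + 1 = d) :
    IsFacetVector P (y - x) := by
  obtain ⟨-, m, hm⟩ := isFace_iff.1 (h.face_to_face _ hx _ hy hn).1
  have hm' := h.inter_eq_dirFace_neg hx hy (fun e => hne (h.vadd_base_injective e)) hn hd hm
  rw [hm] at hm' hn hd
  rw [dirFace_vadd] at hn hd
  rw [vectorSpan_vadd] at hd
  rw [dirFace_vadd, dirFace_vadd] at hm'
  exact ⟨m, vadd_set_nonempty.1 hn, hd, by rw [sub_eq_neg_add, add_vadd, ← hm', neg_vadd_vadd]⟩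

theorem finrank_inter_lt (h : IsParallelohedronTiling P 𝒯)
    {C C' : Set (EuclideanSpace ℝ (Fin d))} (hC : C ∈ 𝒯) (hC' : C' ∈ 𝒯)
    (hne : C ≠ C') (hn : (C ∩ C').Nonempty) :
    Module.finrank ℝ (vectorSpan ℝ (C ∩ C')) < d := by
  obtain ⟨-, m, hm⟩ := isFace_iff.1 (h.face_to_face _ hC _ hC' hn).1
  have hm0 := h.ne_zero_of_inter_eq hC hC' hne hm
  have h1 : m ∈ (vectorSpan ℝ (C ∩ C'))ᗮ := hm ▸ mem_orthogonal_vectorSpan_dirFace C m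
  have h2 : 0 < Module.finrank ℝ (vectorSpan ℝ (C ∩ C'))ᗮ := by
    have : Nontrivial (vectorSpan ℝ (C ∩ C'))ᗮ :=
      ⟨⟨⟨_, h1⟩, 0, fun h => hm0 (congrArg Subtype.val h)⟩⟩
    exact Module.finrank_pos
  have h3 := (vectorSpan ℝ (C ∩ C')).finrank_add_finrank_orthogonal
  rw [finrank_euclideanSpace_fin] at h3
  omega

/-- Any two cells are connected by a chain of cells that share hyperfaces. -/
theorem sub_mem_closure_facetVectors (h : IsParallelohedronTiling P 𝒯)
    {x y : EuclideanSpace ℝ (Fin d)} (hx : x +ᵥ P ∈ 𝒯)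
    (hy : y +ᵥ P ∈ 𝒯) : y - x ∈ AddSubgroup.closure {t | IsFacetVector P t} := by
  set L := AddSubgroup.closure {t | IsFacetVector P t} with hL
  by_contra hyL
  -- `A` consists of the cells whose offset from `x` lies in the lattice, `B` of the others. A cell
  -- of `A` and one of `B` never share a hyperface, so they meet in codimension at least two.
  set A : Set (Set (EuclideanSpace ℝ (Fin d))) := {C ∈ 𝒯 | ∃ z, z - x ∈ L ∧ C = z +ᵥ P} with hA
  set B : Set (Set (EuclideanSpace ℝ (Fin d))) := {C ∈ 𝒯 | ∃ z, z - x ∉ L ∧ C = z +ᵥ P} with hB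
  have hAB : ⋃₀ A ∪ ⋃₀ B = univ := by
    refine eq_univ_of_forall fun p => ?_
    obtain ⟨C, hC, hpC⟩ := (h.covers ▸ mem_univ _ : p ∈ ⋃₀ 𝒯)
    obtain ⟨z, rfl⟩ := h.translates C hC
    by_cases hz : z - x ∈ L
    · exact Or.inl ⟨_, ⟨hC, z, hz, rfl⟩, hpC⟩
    · exact Or.inr ⟨_, ⟨hC, z, hz, rfl⟩, hpC⟩
  have hxA : x +ᵥ P ∈ A := ⟨hx, x, by simp, rfl⟩
  have hyB : y +ᵥ P ∈ B := ⟨hy, y, hyL, rfl⟩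
  have hcodim : ∀ C ∈ A, ∀ C' ∈ B, C ≠ C' ∧ ((C ∩ C').Nonempty →
      Module.finrank ℝ (vectorSpan ℝ (C ∩ C')) + 2 ≤ d) := by
    rintro _ ⟨hz, z, hzL, rfl⟩ _ ⟨hw, w, hwL, rfl⟩
    have hne : z ≠ w := by rintro rfl; exact hwL hzL
    have hne' : z +ᵥ P ≠ w +ᵥ P := fun e => hne (h.vadd_base_injective e)
    refine ⟨hne', fun hn => ?_⟩
    have h1 := h.finrank_inter_lt hz hw hne' hn
    by_contra hcon
    refine hwL ?_
    have h2 : w - z ∈ L :=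
      AddSubgroup.subset_closure (h.isFacetVector_of_inter hz hw hne hn (by omega))
    have := L.add_mem h2 hzL
    rwa [sub_add_sub_cancel] at this
  obtain ⟨p, hp⟩ := h.interior_nonempty hx
  -- Joining `p` to these intersections raises their dimension by one only, so countably many null
  -- sets arise. A segment from `p` to a point `q` off all of them cannot pass from `A` to `B`,
  -- although the unions of both families are closed and cover it.
  have hnull : volume (⋃ C ∈ A, ⋃ C' ∈ B,
      (affineSpan ℝ (insert p (C ∩ C')) : Set (EuclideanSpace ℝ (Fin d)))) = 0 := by
    refine (measure_biUnion_null_iff (h.countable.mono fun _ hC => hC.1)).2 fun C hC => ?_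
    refine (measure_biUnion_null_iff (h.countable.mono fun _ hC => hC.1)).2 fun C' hC' => ?_
    refine Measure.addHaar_affineSubspace _ _ fun htop => ?_
    have h1 : vectorSpan ℝ (insert p (C ∩ C')) = ⊤ := by
      rw [← direction_affineSpan, htop, AffineSubspace.direction_top]
    have h2 := finrank_vectorSpan_insert_le_set ℝ (C ∩ C') p
    rw [h1, finrank_top, finrank_euclideanSpace_fin] at h2
    rcases (C ∩ C').eq_empty_or_nonempty with he | hn
    · rw [he] at h1
      have : (⊤ : Submodule ℝ (EuclideanSpace ℝ (Fin d))) = ⊥ := by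
        rw [← h1]; simp
      have hd0 : d = 0 := by
        have h3 := finrank_bot ℝ (EuclideanSpace ℝ (Fin d))
        rwa [← this, finrank_top, finrank_euclideanSpace_fin] at h3
      subst hd0
      exact hyL (by rw [Subsingleton.elim (y - x) 0]; exact L.zero_mem)
    · have := (hcodim C hC C' hC').2 hn
      omega
  obtain ⟨q, hq, hqn⟩ : ∃ q ∈ interior (y +ᵥ P), q ∉ ⋃ C ∈ A, ⋃ C' ∈ B,
      (affineSpan ℝ (insert p (C ∩ C')) : Set (EuclideanSpace ℝ (Fin d))) := by
    by_contra! hcon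
    exact (isOpen_interior.measure_pos _ (h.interior_nonempty hy)).ne'
      (measure_mono_null hcon hnull)
  have hseg := isPreconnected_closed_iff.1 (convex_segment p q).isPreconnected (⋃₀ A) (⋃₀ B)
    (h.isClosed_sUnion fun _ hC => hC.1) (h.isClosed_sUnion fun _ hC => hC.1)
    (by rw [hAB]; exact subset_univ _)
    ⟨p, left_mem_segment ℝ p q, _, hxA, interior_subset hp⟩
    ⟨q, right_mem_segment ℝ p q, _, hyB, interior_subset hq⟩
  obtain ⟨z, hz, ⟨C, hC, hzC⟩, C', hC', hzC'⟩ := hseg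
  refine hqn (mem_iUnion₂.2 ⟨C, hC, mem_iUnion₂.2 ⟨C', hC', ?_⟩⟩)
  rw [segment_eq_image_lineMap] at hz
  obtain ⟨s, -, rfl⟩ := hz
  -- The transition point differs from `p`, so the line through both reaches `q` within the affine
  -- span.
  have hs : s ≠ 0 := by
    rintro rfl
    rw [AffineMap.lineMap_apply_zero] at hzC'
    exact disjoint_left.1 (h.disjoint_interior_cell hx hC'.1 (hcodim _ hxA _ hC').1) hp hzC'
  have h1 : p ∈ affineSpan ℝ (insert p (C ∩ C')) := mem_affineSpan ℝ (mem_insert _ _)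
  have h2 : AffineMap.lineMap p q s ∈ affineSpan ℝ (insert p (C ∩ C')) :=
    mem_affineSpan ℝ (mem_insert_of_mem _ ⟨hzC, hzC'⟩)
  have h3 := AffineMap.lineMap_mem s⁻¹ h1 h2
  have h4 : AffineMap.lineMap p (AffineMap.lineMap p q s : EuclideanSpace ℝ (Fin d)) s⁻¹ = q := by
    simp only [AffineMap.lineMap_apply, vsub_eq_sub, vadd_eq_add, add_sub_cancel_right, smul_smul,
      inv_mul_cancel₀ hs, one_smul, sub_add_cancel]
  rwa [h4] at h3

theorem add_mem_of_mem_closure (h : IsParallelohedronTiling P 𝒯)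
    {x v : EuclideanSpace ℝ (Fin d)} (hx : x +ᵥ P ∈ 𝒯)
    (hv : v ∈ AddSubgroup.closure {t | IsFacetVector P t}) : (x + v) +ᵥ P ∈ 𝒯 := by
  suffices ∀ x, x +ᵥ P ∈ 𝒯 → (x + v) +ᵥ P ∈ 𝒯 ∧ (x - v) +ᵥ P ∈ 𝒯 from (this x hx).1
  clear hx x
  induction hv using AddSubgroup.closure_induction with
  | mem t ht =>
    intro x hx
    rw [sub_eq_add_neg]
    exact ⟨h.add_mem_of_isFacetVector hx ht, h.add_mem_of_isFacetVector hx ht.neg⟩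
  | zero => simp
  | add v w _ _ hv hw =>
    intro x hx
    rw [← add_assoc, ← sub_sub]
    exact ⟨(hw _ (hv x hx).1).1, (hw _ (hv x hx).2).2⟩
  | neg v _ hv =>
    intro x hx
    rw [← sub_eq_add_neg, sub_neg_eq_add]
    exact (hv x hx).symm

/-- **Minkowski's theorem**: the cells are centrally symmetric. -/
theorem exists_center (h : IsParallelohedronTiling P 𝒯) : ∃ c, ∀ x ∈ P, c - x ∈ P := by
  set L := AddSubgroup.closure {t | IsFacetVector P t} with hL
  obtain ⟨C₀, hC₀, -⟩ := (h.covers ▸ mem_univ _ : (0 : EuclideanSpace ℝ (Fin d)) ∈ ⋃₀ 𝒯)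
  obtain ⟨x₀, rfl⟩ := h.translates C₀ hC₀
  have hcount : Countable L := by
    have := h.countable.to_subtype
    refine Function.Injective.countable (β := 𝒯)
      (f := fun v => ⟨(x₀ + v) +ᵥ P, h.add_mem_of_mem_closure hC₀ v.2⟩) fun v w hvw => ?_
    exact Subtype.ext (add_left_cancel (h.vadd_base_injective (congrArg Subtype.val hvw)))
  -- Lattice translates of a cell are exactly the cells of the tiling; different ones overlap only
  -- in their frontiers, which are null by convexity.
  have hfund : IsAddFundamentalDomain L (x₀ +ᵥ P)
      (volume : Measure (EuclideanSpace ℝ (Fin d))) := by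
    refine ⟨(h.isCompact hC₀).measurableSet.nullMeasurableSet, ae_of_all _ fun p => ?_, ?_⟩
    · obtain ⟨C, hC, hpC⟩ := (h.covers ▸ mem_univ _ : p ∈ ⋃₀ 𝒯)
      obtain ⟨z, rfl⟩ := h.translates C hC
      refine ⟨⟨x₀ - z, h.sub_mem_closure_facetVectors hC hC₀⟩, ?_⟩
      obtain ⟨y, hy, rfl⟩ := hpC
      refine ⟨y, hy, ?_⟩
      change x₀ + y = x₀ - z + (z + y)
      abel
    · intro v w hvw
      have e : ∀ v : L, v +ᵥ (x₀ +ᵥ P) = (x₀ + v) +ᵥ P := fun v => by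
        rw [add_comm, add_vadd]; rfl
      have hv := h.add_mem_of_mem_closure hC₀ v.2
      have hw := h.add_mem_of_mem_closure hC₀ w.2
      change AEDisjoint volume (v +ᵥ (x₀ +ᵥ P)) (w +ᵥ (x₀ +ᵥ P))
      rw [e, e]
      have hne : (x₀ + (v : EuclideanSpace ℝ (Fin d))) +ᵥ P ≠ (x₀ + w) +ᵥ P := fun e =>
        hvw (Subtype.ext (add_left_cancel (h.vadd_base_injective e)))
      refine measure_mono_null ?_ ((h.convex hv).addHaar_frontier volume)
      rintro p ⟨hp1, hp2⟩
      refine ⟨subset_closure hp1, fun hpi => ?_⟩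
      exact disjoint_left.1 (h.disjoint_interior_cell hv hw hne) hpi hp2
  have hPc := h.convex_base
  set s := interior P + -interior P with hs
  have hsconv : Convex ℝ s := hPc.interior.add hPc.interior.neg
  -- A nonzero lattice vector in the difference of the interior with itself would make the interiors
  -- of two cells overlap, so Minkowski's convex body theorem bounds the volume.
  have hmink : volume s ≤ volume (x₀ +ᵥ P) * 2 ^ Module.finrank ℝ (EuclideanSpace ℝ (Fin d)) := by
    by_contra! hcon
    obtain ⟨v, hv0, p, hp, q, hq, hpq⟩ :=
      exists_ne_zero_mem_lattice_of_measure_mul_two_pow_lt_measure hfund (s := s) (by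
        rintro _ ⟨p, hp, q, hq, rfl⟩
        exact ⟨-q, hq, -p, by simpa using hp, by simp [add_comm]⟩) hsconv hcon
    have hv := h.add_mem_of_mem_closure hC₀ v.2
    have hne : x₀ +ᵥ P ≠ (x₀ + v) +ᵥ P := fun e =>
      hv0 (Subtype.ext (by simpa using h.vadd_base_injective e))
    have h1 : x₀ + p ∈ interior (x₀ +ᵥ P) := by
      rw [interior_vadd]
      exact vadd_mem_vadd_set hp
    have h2 : x₀ + p ∈ interior ((x₀ + v) +ᵥ P) := by
      rw [interior_vadd]
      refine ⟨-q, hq, ?_⟩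
      rw [← hpq]
      change x₀ + (p + q) + -q = x₀ + p
      abel
    exact disjoint_left.1 (h.disjoint_interiors _ hC₀ _ hv hne) h1 h2
  refine exists_center_of_measure_le volume hPc h.isCompact_base h.full_dimensional ?_
  have hsub : P + -P ⊆ closure s := by
    have hcl : P = closure (interior P) := by
      rw [hPc.closure_interior_eq_closure_of_nonempty_interior h.full_dimensional,
        h.isCompact_base.isClosed.closure_eq]
    rintro _ ⟨p, hp, q, hq, rfl⟩
    have hq' : q ∈ closure (-interior P) := by
      rw [← neg_closure, ← hcl]; exact hq
    rw [hcl] at hp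
    exact map_mem_closure₂ continuous_add hp hq' fun a ha b hb => add_mem_add ha hb
  have hcl : volume (closure s) ≤ volume s := by
    rw [closure_eq_self_union_frontier]
    exact (measure_union_le _ _).trans (by rw [hsconv.addHaar_frontier volume, add_zero])
  rw [Measure.addHaar_smul_of_nonneg _ (by norm_num)]
  rw [measure_vadd] at hmink
  set k := Module.finrank ℝ (EuclideanSpace ℝ (Fin d))
  calc ENNReal.ofReal (2⁻¹ ^ k) * volume (P + -P)
      ≤ ENNReal.ofReal (2⁻¹ ^ k) * (volume P * 2 ^ k) := by
        gcongr
        exact (measure_mono hsub).trans (hcl.trans hmink)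
    _ = volume P := by
        rw [mul_left_comm, ENNReal.ofReal_pow (by norm_num), ← mul_pow,
          ENNReal.ofReal_inv_of_pos (by norm_num)]
        simp [ENNReal.inv_mul_cancel]

/-- Each hyperface is mapped onto itself by a point reflection that preserves the tiling. -/
theorem exists_reflection (h : IsParallelohedronTiling P 𝒯)
    {F : Set (EuclideanSpace ℝ (Fin d))} (hF : F ∈ hyperfaces 𝒯) :
    ∃ w : EuclideanSpace ℝ (Fin d), (∀ C ∈ 𝒯, w +ᵥ -C ∈ 𝒯) ∧ w +ᵥ -F = F := by
  obtain ⟨⟨C, hC, hCF⟩, hd⟩ := hF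
  obtain ⟨hn, m, rfl⟩ := isFace_iff.1 hCF
  obtain ⟨x, rfl⟩ := h.translates C hC
  rw [dirFace_vadd] at hn hd ⊢
  rw [vectorSpan_vadd] at hd
  obtain ⟨t, ht, hm⟩ := h.exists_isFacetVector hC (vadd_set_nonempty.1 hn) hd
  obtain ⟨c, hc⟩ := h.exists_center
  have hP : c +ᵥ -P = P := by
    refine subset_antisymm ?_ fun y hy => ?_
    · rintro _ ⟨y, hy, rfl⟩
      have := hc _ hy
      rwa [sub_neg_eq_add] at this
    · exact ⟨-(c - y), by simpa using hc y hy, by simp⟩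
  have hneg : -P = -c +ᵥ P := by rw [← hP, neg_vadd_vadd, hP]
  have hneg' : ∀ (y : EuclideanSpace ℝ (Fin d)) (S : Set (EuclideanSpace ℝ (Fin d))),
      -(y +ᵥ S) = -y +ᵥ -S := by
    intro y S
    ext z
    simp only [Set.mem_neg, mem_vadd_set_iff_neg_vadd_mem, vadd_eq_add]
    rw [neg_add, neg_neg]
  -- The map `p ↦ x + (x + t) + c - p` exchanges the adjacent cells `x +ᵥ P` and `(x + t) +ᵥ P`.
  refine ⟨x + (x + t) + c, fun C hC' => ?_, ?_⟩
  · obtain ⟨y, rfl⟩ := h.translates C hC'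
    rw [hneg', hneg, vadd_vadd, vadd_vadd]
    have := h.add_mem_of_mem_closure ht (h.sub_mem_closure_facetVectors hC' hC)
    convert this using 2
    abel
  · have h1 : -dirFace P m = -c +ᵥ dirFace P (-m) := by
      rw [← dirFace_vadd, ← hneg, dirFace_neg, neg_neg]
    rw [hneg', h1, hm, vadd_vadd, vadd_vadd, vadd_vadd]
    congr 1
    abel

end IsParallelohedronTiling

end Parallelohedra

/-! ### Linear relations in a planar fan -/

namespace Parallelohedra

/-- The linear relations between unit vectors `(p i, q i)` of a plane which form the
normal fan of the hyperfaces around a `(d-2)`-face: either the relations are all proportional, or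
the vectors come in opposite pairs with equal coefficients in each relation. -/
theorem relations_of_fan {ι : Type*} [Fintype ι] [DecidableEq ι] (p q : ι → ℝ)
    (hunit : ∀ i, p i ^ 2 + q i ^ 2 = 1) (hinj : ∀ i j, p i = p j → q i = q j → i = j)
    (hfan : ∀ i, ∃ j, 0 < p i * q j - q i * p j ∧ ∀ l, l = i ∨ l = j ∨
      (p i * q l - q i * p l ≤ 0 ∧ p l * q j - q l * p j ≤ 0)) :
    (∀ s t : ι → ℝ, ∑ i, s i * p i = 0 → ∑ i, s i * q i = 0 → ∑ i, t i * p i = 0 →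
      ∑ i, t i * q i = 0 → ∀ i j, s i * t j = s j * t i) ∨
    ∃ τ : Equiv.Perm ι, (∀ i, p (τ i) = -p i ∧ q (τ i) = -q i) ∧
      ∀ s : ι → ℝ, ∑ i, s i * p i = 0 → ∑ i, s i * q i = 0 → ∀ i, s (τ i) = s i := by
  rcases isEmpty_or_nonempty ι with hι | ⟨⟨a⟩⟩
  · exact Or.inl fun s t _ _ _ _ i => isEmptyElim i
  -- A unit vector parallel to vector `j` and not on its side of the line of `i` is its opposite.
  have hpar : ∀ i j l, p l * q j - q l * p j = 0 → p i * q j - q i * p j > 0 →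
      p i * q l - q i * p l ≤ 0 → p l = -p j ∧ q l = -q j := by
    intro i j l h1 h2 h3
    have hj := hunit j
    have hl := hunit l
    set c := p l * p j + q l * q j with hc
    have hp : p l = c * p j := by linear_combination (-p l) * hj + q j * h1
    have hq : q l = c * q j := by linear_combination (-q l) * hj - p j * h1
    have hc0 : c ≤ 0 := by
      have : c * (p i * q j - q i * p j) ≤ 0 := by rw [hp, hq] at h3; linarith
      nlinarith
    have hc2 : c ^ 2 = 1 := by
      rw [hp, hq] at hl
      linear_combination hl - c ^ 2 * hj
    have hc1 : c = -1 := by nlinarith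
    rw [hp, hq, hc1]
    constructor <;> ring
  -- Take three successive vectors `a`, `b`, `c`. Any further vector is confined by both pairs to
  -- the line of `b`, hence equals `-b`, so there is at most one.
  obtain ⟨b, hab, hA⟩ := hfan a
  obtain ⟨c, hbc, hB⟩ := hfan b
  have ne_of : ∀ {i j}, 0 < p i * q j - q i * p j → i ≠ j := by
    rintro i j h rfl
    linarith
  have hab' := ne_of hab
  have hbc' := ne_of hbc
  have hac' : a ≠ c := by rintro rfl; linarith
  have hAc := ((hA c).resolve_left hac'.symm).resolve_left hbc'.symm
  have hrest : ∀ l, l ≠ a → l ≠ b → l ≠ c → p l = -p b ∧ q l = -q b := by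
    intro l h1 h2 h3
    have h4 := ((hA l).resolve_left h1).resolve_left h2
    have h5 := ((hB l).resolve_left h2).resolve_left h3
    exact hpar a b l (by linarith) hab h4.1
  by_cases hd : ∃ d, d ≠ a ∧ d ≠ b ∧ d ≠ c
  · obtain ⟨d, hda, hdb, hdc⟩ := hd
    have hd := hrest d hda hdb hdc
    have hall : ∀ l, l = a ∨ l = b ∨ l = c ∨ l = d := by
      intro l
      by_contra! hcon
      have := hrest l hcon.1 hcon.2.1 hcon.2.2.1
      exact hcon.2.2.2 (hinj _ _ (this.1.trans hd.1.symm) (this.2.trans hd.2.symm))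
    -- With `d = -b` present, the possible successors of `c` are `a` and `d`. The first contradicts
    -- the position of `d`; the second forces `c` to be opposite to `a`.
    have hc : p c = -p a ∧ q c = -q a := by
      obtain ⟨e, hce, hC⟩ := hfan c
      have hce' := ne_of hce
      rcases hall e with rfl | rfl | rfl | rfl
      · have := ((hC d).resolve_left hdc).resolve_left hda
        rw [hd.1, hd.2] at this
        linarith
      · linarith
      · exact absurd rfl hce'
      · have := ((hC a).resolve_left hac').resolve_left hda.symm
        rw [hd.1, hd.2] at this
        refine hpar e a c (by linarith) ?_ ?_ <;> rw [hd.1, hd.2] <;> linarith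
    have huniv : (Finset.univ : Finset ι) = {a, b, c, d} := by
      ext l
      simpa using hall l
    have hsum : ∀ f : ι → ℝ, ∑ i, f i = f a + (f b + (f c + f d)) := by
      intro f
      rw [huniv, Finset.sum_insert (by simp [hab', hac', hda.symm]),
        Finset.sum_insert (by simp [hbc', hdb.symm]), Finset.sum_pair hdc.symm]
    have τa : (Equiv.swap a c * Equiv.swap b d) a = c := by
      rw [Equiv.Perm.mul_apply, Equiv.swap_apply_of_ne_of_ne hab' hda.symm, Equiv.swap_apply_left]
    have τb : (Equiv.swap a c * Equiv.swap b d) b = d := by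
      rw [Equiv.Perm.mul_apply, Equiv.swap_apply_left, Equiv.swap_apply_of_ne_of_ne hda hdc]
    have τc : (Equiv.swap a c * Equiv.swap b d) c = a := by
      rw [Equiv.Perm.mul_apply, Equiv.swap_apply_of_ne_of_ne hbc'.symm hdc.symm,
        Equiv.swap_apply_right]
    have τd : (Equiv.swap a c * Equiv.swap b d) d = b := by
      rw [Equiv.Perm.mul_apply, Equiv.swap_apply_right, Equiv.swap_apply_of_ne_of_ne hab'.symm hbc']
    refine Or.inr ⟨Equiv.swap a c * Equiv.swap b d, fun i => ?_, fun s hp hq i => ?_⟩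
    · rcases hall i with rfl | rfl | rfl | rfl
      · rw [τa]; exact hc
      · rw [τb]; exact hd
      · rw [τc, hc.1, hc.2, neg_neg, neg_neg]; exact ⟨rfl, rfl⟩
      · rw [τd, hd.1, hd.2, neg_neg, neg_neg]; exact ⟨rfl, rfl⟩
    · rw [hsum, hc.1, hd.1] at hp
      rw [hsum, hc.2, hd.2] at hq
      have e1 : (s a - s c) * (p a * q b - q a * p b) = 0 := by
        linear_combination q b * hp - p b * hq
      have e2 : (s b - s d) * (p a * q b - q a * p b) = 0 := by
        linear_combination p a * hq - q a * hp
      have e1' := sub_eq_zero.1 ((mul_eq_zero.1 e1).resolve_right hab.ne')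
      have e2' := sub_eq_zero.1 ((mul_eq_zero.1 e2).resolve_right hab.ne')
      rcases hall i with rfl | rfl | rfl | rfl
      · rw [τa, e1']
      · rw [τb, e2']
      · rw [τc, e1']
      · rw [τd, e2']
  · push Not at hd
    have hall : ∀ l, l = a ∨ l = b ∨ l = c := by
      intro l
      by_contra! hcon
      exact hcon.2.2 (hd l hcon.1 hcon.2.1)
    have huniv : (Finset.univ : Finset ι) = {a, b, c} := by
      ext l
      simpa using hall l
    have hsum : ∀ f : ι → ℝ, ∑ i, f i = f a + (f b + f c) := by
      intro f
      rw [huniv, Finset.sum_insert (by simp [hab', hac']), Finset.sum_pair hbc']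
    -- Since `a` and `b` are independent, the coefficient at `c` determines the other two by
    -- Cramer's rule.
    have hrel : ∀ s : ι → ℝ, ∑ i, s i * p i = 0 → ∑ i, s i * q i = 0 →
        s a = s c * ((p b * q c - q b * p c) / (p a * q b - q a * p b)) ∧
        s b = s c * ((p c * q a - q c * p a) / (p a * q b - q a * p b)) := by
      intro s hp hq
      rw [hsum] at hp hq
      have h0 := hab.ne'
      constructor
      · rw [mul_div_assoc', eq_div_iff h0]
        linear_combination q b * hp - p b * hq
      · rw [mul_div_assoc', eq_div_iff h0]
        linear_combination p a * hq - q a * hp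
    refine Or.inl fun s t hsp hsq htp htq i j => ?_
    obtain ⟨hsa, hsb⟩ := hrel s hsp hsq
    obtain ⟨hta, htb⟩ := hrel t htp htq
    rcases hall i with rfl | rfl | rfl <;> rcases hall j with rfl | rfl | rfl <;>
      simp only [hsa, hsb, hta, htb] <;> ring

end Parallelohedra

/-! ### The plane orthogonal to a (d-2)-face -/

namespace Parallelohedra

open Set Filter Topology

variable {d : ℕ} {P : Set (EuclideanSpace ℝ (Fin d))} {𝒯 : Set (Set (EuclideanSpace ℝ (Fin d)))}
  {e : Fin 2 → EuclideanSpace ℝ (Fin d)} {G : Set (EuclideanSpace ℝ (Fin d))}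

/-- The area form of the plane with the orthonormal basis `e`, extended by projection. -/
noncomputable def areaForm (e : Fin 2 → EuclideanSpace ℝ (Fin d))
    (a b : EuclideanSpace ℝ (Fin d)) : ℝ :=
  inner ℝ (e 0) a * inner ℝ (e 1) b - inner ℝ (e 1) a * inner ℝ (e 0) b

theorem IsTraversalFrame.inner_eq (he : IsTraversalFrame G e) {w : EuclideanSpace ℝ (Fin d)}
    (hw : w ∈ (vectorSpan ℝ G)ᗮ) (z : EuclideanSpace ℝ (Fin d)) :
    inner ℝ w z = inner ℝ (e 0) w * inner ℝ (e 0) z + inner ℝ (e 1) w * inner ℝ (e 1) z := by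
  rw [← he.2, Submodule.mem_span_range_iff_exists_fun] at hw
  obtain ⟨c, rfl⟩ := hw
  rw [he.1.inner_right_fintype, he.1.inner_right_fintype, sum_inner, Fin.sum_univ_two,
    real_inner_smul_left, real_inner_smul_left]

theorem IsTraversalFrame.mem_vectorSpan (he : IsTraversalFrame G e)
    {g : EuclideanSpace ℝ (Fin d)} (h0 : inner ℝ (e 0) g = 0) (h1 : inner ℝ (e 1) g = 0) :
    g ∈ vectorSpan ℝ G := by
  rw [← (vectorSpan ℝ G).orthogonal_orthogonal, Submodule.mem_orthogonal]
  intro u hu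
  rw [he.inner_eq hu, h0, h1, mul_zero, mul_zero, add_zero]

theorem IsTraversalFrame.eq_of_inner_eq (he : IsTraversalFrame G e)
    {w w' : EuclideanSpace ℝ (Fin d)} (hw : w ∈ (vectorSpan ℝ G)ᗮ) (hw' : w' ∈ (vectorSpan ℝ G)ᗮ)
    (h0 : inner ℝ (e 0) w = inner ℝ (e 0) w') (h1 : inner ℝ (e 1) w = inner ℝ (e 1) w') :
    w = w' := by
  refine ext_inner_right ℝ fun z => ?_
  rw [he.inner_eq hw, he.inner_eq hw', h0, h1]

/-- In the plane of `e`, the projection of a vector orthogonal to the unit vector `n` is a multiple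
of the quarter turn of `n`. -/
theorem IsTraversalFrame.inner_eq_areaForm (he : IsTraversalFrame G e)
    {n w z : EuclideanSpace ℝ (Fin d)} (hn : n ∈ (vectorSpan ℝ G)ᗮ) (hn1 : ‖n‖ = 1)
    (hw : w ∈ (vectorSpan ℝ G)ᗮ) (hz : inner ℝ n z = 0) :
    inner ℝ w z = areaForm e z n * areaForm e w n := by
  have h1 : inner ℝ n n = (1 : ℝ) := by rw [real_inner_self_eq_norm_sq, hn1, one_pow]
  rw [he.inner_eq hn] at h1 hz
  rw [he.inner_eq hw]
  simp only [areaForm]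
  set n0 : ℝ := inner ℝ (e 0) n
  set n1 : ℝ := inner ℝ (e 1) n
  set z0 : ℝ := inner ℝ (e 0) z
  set z1 : ℝ := inner ℝ (e 1) z
  set w0 : ℝ := inner ℝ (e 0) w
  set w1 : ℝ := inner ℝ (e 1) w
  linear_combination (-(w0 * z0 + w1 * z1)) * h1 + (w0 * n0 + w1 * n1) * hz

/-- Cramer's rule in the plane of `e`. -/
theorem IsTraversalFrame.mul_areaForm_smul_eq (he : IsTraversalFrame G e)
    {a b c : EuclideanSpace ℝ (Fin d)} (ha : a ∈ (vectorSpan ℝ G)ᗮ) (hb : b ∈ (vectorSpan ℝ G)ᗮ)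
    (hc : c ∈ (vectorSpan ℝ G)ᗮ) :
    areaForm e a b • c = areaForm e c b • a + areaForm e a c • b := by
  refine he.eq_of_inner_eq (Submodule.smul_mem _ _ hc)
    (Submodule.add_mem _ (Submodule.smul_mem _ _ ha) (Submodule.smul_mem _ _ hb)) ?_ ?_ <;>
  · simp only [inner_smul_right, inner_add_right, areaForm]
    ring

theorem mem_orthogonal_of_subset {F : Set (EuclideanSpace ℝ (Fin d))} (hGF : G ⊆ F)
    {n : EuclideanSpace ℝ (Fin d)} (hn : n ∈ (vectorSpan ℝ F)ᗮ) : n ∈ (vectorSpan ℝ G)ᗮ :=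
  Submodule.orthogonal_le (vectorSpan_mono ℝ hGF) hn

theorem exists_mem_sdiff (hG : G ∈ facesOfCodim 𝒯 2) {F : Set (EuclideanSpace ℝ (Fin d))}
    (hF : F ∈ hyperfaces 𝒯) : ∃ x ∈ F, x ∉ G := by
  by_contra! hcon
  have h1 := Submodule.finrank_mono (vectorSpan_mono ℝ (hcon : F ⊆ G))
  have h2 := hG.2
  have h3 : _ + 1 = d := hF.2
  omega

namespace IsParallelohedronTiling

/-- `G` is a face of the common face `C ∩ C'`, and a face of a face of the polytope `C'` is a face
of `C'`. -/
theorem isFace_of_subset (h : IsParallelohedronTiling P 𝒯)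
    {C C' : Set (EuclideanSpace ℝ (Fin d))} (hC : C ∈ 𝒯) (hC' : C' ∈ 𝒯)
    (hG : IsFace C G) (hGC' : G ⊆ C') : IsFace C' G := by
  obtain ⟨hn, l, hl⟩ := isFace_iff.1 hG
  have hGC : G ⊆ C := hl ▸ dirFace_subset C l
  obtain ⟨x, hx⟩ := hn
  obtain ⟨-, m, hm⟩ := isFace_iff.1 (h.face_to_face C hC C' hC' ⟨x, hGC hx, hGC' hx⟩).2
  have hG' : G = dirFace (dirFace C' m) l := by
    rw [← hm]
    ext y
    constructor
    · intro hy
      exact ⟨⟨hGC hy, hGC' hy⟩, fun z hz => (hl ▸ hy : y ∈ dirFace C l).2 z hz.1⟩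
    · intro hy
      rw [hl]
      rw [hl] at hx
      exact mem_dirFace_of_le hx hy.1.1 (hy.2 x ⟨hx.1, hGC' (hl ▸ hx)⟩)
  obtain ⟨W, hW, rfl⟩ := h.exists_finite_convexHull hC'
  obtain ⟨m', hm'⟩ := dirFace_dirFace hW (m := m) (l := l) (hG' ▸ ⟨x, hx⟩)
  exact isFace_iff.2 ⟨⟨x, hx⟩, m', hG'.trans hm'⟩

/-- Each hyperface is a face of a cell on each of its sides. -/
theorem exists_cell_dirFace (h : IsParallelohedronTiling P 𝒯)
    {F : Set (EuclideanSpace ℝ (Fin d))} (hF : F ∈ hyperfaces 𝒯)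
    {n : EuclideanSpace ℝ (Fin d)} (hn : n ∈ (vectorSpan ℝ F)ᗮ) (hn0 : n ≠ 0) :
    ∃ D ∈ 𝒯, F = dirFace D n := by
  obtain ⟨⟨C, hC, hCF⟩, hd⟩ := hF
  obtain ⟨hne, m, hm⟩ := isFace_iff.1 hCF
  have hm1 : m ∈ (vectorSpan ℝ F)ᗮ := hm ▸ mem_orthogonal_vectorSpan_dirFace C m
  rw [orthogonal_eq_span_singleton (by simpa using hd) hn hn0, Submodule.mem_span_singleton] at hm1
  obtain ⟨a, rfl⟩ := hm1
  rcases lt_trichotomy a 0 with ha | rfl | ha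
  · rw [← neg_smul_neg, dirFace_smul _ _ (neg_pos.2 ha)] at hm
    obtain ⟨D, hD, -, -, hD'⟩ := h.exists_neighbour hC (m := -n) (hm ▸ hne) (hm ▸ hd)
    exact ⟨D, hD, by rw [hm, ← hD', neg_neg]⟩
  · exfalso
    refine ne_zero_of_finrank_dirFace (h.interior_nonempty hC) ?_ (zero_smul ℝ n)
    rw [← hm, finrank_euclideanSpace_fin]
    change _ + 1 = d at hd
    omega
  · exact ⟨C, hC, by rw [hm, dirFace_smul _ _ ha]⟩

end IsParallelohedronTiling

/-- The hyperfaces `A` and `B` with the normals `n` and `n'` meet in `G`, and `D` is the cell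
between them: it follows `A` and precedes `B` in the direction of traversal. -/
structure IsConsecutive (𝒯 : Set (Set (EuclideanSpace ℝ (Fin d))))
    (e : Fin 2 → EuclideanSpace ℝ (Fin d)) (G A B D : Set (EuclideanSpace ℝ (Fin d)))
    (n n' : EuclideanSpace ℝ (Fin d)) : Prop where
  mem : D ∈ 𝒯
  left : A = dirFace D (-n)
  right : B = dirFace D n'
  inter : A ∩ B = G
  pos : 0 < areaForm e n n'

namespace IsParallelohedronTiling

/-- The next hyperface is found inside the cell `D` just beyond `F i` in the direction of traversal:
`G` is a facet of the facet `F i` of `D`, so a second facet of `D` meets `F i` in `G`. -/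
theorem exists_isConsecutive (h : IsParallelohedronTiling P 𝒯)
    (hG : G ∈ facesOfCodim 𝒯 2) (he : IsTraversalFrame G e) {ι : Type*}
    {F : ι → Set (EuclideanSpace ℝ (Fin d))} {n : ι → EuclideanSpace ℝ (Fin d)}
    (hF : ∀ i, F i ∈ hyperfaces 𝒯) (hGF : ∀ i, G ⊆ F i)
    (hcov : ∀ A ∈ hyperfaces 𝒯, G ⊆ A → ∃ i, F i = A)
    (hn : ∀ i, IsTraversalNormal e G (F i) (n i)) (i : ι) :
    ∃ j D, IsConsecutive 𝒯 e G (F i) (F j) D (n i) (n j) := by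
  have hn0 : ∀ i, n i ≠ 0 := fun i => norm_ne_zero_iff.1 (by rw [(hn i).unit]; exact one_ne_zero)
  have hnG : ∀ i, n i ∈ (vectorSpan ℝ G)ᗮ := fun i =>
    mem_orthogonal_of_subset (hGF i) (hn i).normal
  obtain ⟨D, hD, hFD⟩ := h.exists_cell_dirFace (hF i) (neg_mem (hn i).normal)
    (neg_ne_zero.2 (hn0 i))
  obtain ⟨⟨C, hC, hCG⟩, hGd⟩ := hG
  have hGne : G.Nonempty := hCG.1
  have hGD : G ⊆ D := (hGF i).trans (hFD ▸ dirFace_subset _ _)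
  obtain ⟨-, l, hl⟩ := isFace_iff.1 (h.isFace_of_subset hC hD hCG hGD)
  have hl' : dirFace (dirFace D (-n i)) l = G := by
    rw [← hFD]
    ext y
    obtain ⟨x, hx⟩ := hGne
    constructor
    · intro hy
      rw [hl] at hx ⊢
      have h1 : F i ⊆ D := hFD ▸ dirFace_subset _ _
      exact mem_dirFace_of_le hx (h1 hy.1) (hy.2 x (hGF i (hl ▸ hx)))
    · intro hy
      refine ⟨hGF i hy, fun z hz => ?_⟩
      rw [hl] at hy
      exact hy.2 z ((hFD ▸ dirFace_subset _ _ : F i ⊆ D) hz)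
  obtain ⟨m', hm', hinter⟩ : ∃ m', Module.finrank ℝ (vectorSpan ℝ (dirFace D m')) + 1 = d ∧
      dirFace D (-n i) ∩ dirFace D m' = G := by
    obtain ⟨W, hW, rfl⟩ := h.exists_finite_convexHull hD
    have h1 : Module.finrank ℝ (vectorSpan ℝ (F i)) + 1 = d := (hF i).2
    obtain ⟨m', hm', hm''⟩ := exists_other_facet hW (h.interior_nonempty hD) (m := -n i) (l := l)
      (by rwa [← hFD, finrank_euclideanSpace_fin])
      (by rwa [hl', finrank_euclideanSpace_fin]) (by rwa [hl'])
    rw [finrank_euclideanSpace_fin] at hm'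
    exact ⟨m', hm', hm''.trans hl'⟩
  have hGB : G ⊆ dirFace D m' := hinter ▸ inter_subset_right
  obtain ⟨j, hj⟩ := hcov (dirFace D m') ⟨⟨D, hD, isFace_iff.2 ⟨hGne.mono hGB, m', rfl⟩⟩, hm'⟩ hGB
  have hm0 : m' ∈ (vectorSpan ℝ (F j))ᗮ := hj ▸ mem_orthogonal_vectorSpan_dirFace D m'
  rw [orthogonal_eq_span_singleton (by simpa using (hF j).2) (hn j).normal (hn0 j),
    Submodule.mem_span_singleton] at hm0
  obtain ⟨a, rfl⟩ := hm0
  obtain ⟨y, hy⟩ := hGne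
  obtain ⟨xi, hxi, hxi'⟩ := exists_mem_sdiff ⟨⟨C, hC, hCG⟩, hGd⟩ (hF i)
  obtain ⟨xj, hxj, hxj'⟩ := exists_mem_sdiff ⟨⟨C, hC, hCG⟩, hGd⟩ (hF j)
  have hoi : 0 < areaForm e (xi - y) (n i) := (hn i).oriented y hy xi ⟨hxi, hxi'⟩
  have hoj : 0 < areaForm e (xj - y) (n j) := (hn j).oriented y hy xj ⟨hxj, hxj'⟩
  have hi0 := inner_sub_eq_zero_of_mem_orthogonal (hn i).normal hxi (hGF i hy)
  have hj0 := inner_sub_eq_zero_of_mem_orthogonal (hn j).normal hxj (hGF j hy)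
  -- The vector along the second facet points into `D`, to the side of `n i`; this fixes the turning
  -- sense. Likewise the vector along the first facet shows below that `n j` is an outward normal of
  -- `D`.
  have hpos : 0 < areaForm e (n i) (n j) := by
    have h1 : xj ∉ dirFace D (-n i) := fun hcon => hxj' (by
      rw [← hinter]; exact ⟨hcon, hj ▸ hxj⟩)
    have h2 := inner_lt_of_notMem_dirFace (hFD ▸ hGF i hy)
      ((hj ▸ hxj : xj ∈ dirFace D (a • n j)).1) h1
    have h3 := he.inner_eq_areaForm (hnG j) (hn j).unit (hnG i) hj0
    rw [inner_sub_right] at h3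
    rw [inner_neg_left, inner_neg_left] at h2
    have h4 : 0 < areaForm e (xj - y) (n j) * areaForm e (n i) (n j) := by linarith
    exact pos_of_mul_pos_right h4 hoj.le
  have hapos : 0 < a := by
    have h1 : xi ∉ dirFace D (a • n j) := fun hcon => hxi' (by
      rw [← hinter]; exact ⟨hFD ▸ hxi, hcon⟩)
    have h2 := inner_lt_of_notMem_dirFace (hGB hy) ((hFD ▸ hxi : xi ∈ dirFace D (-n i)).1) h1
    have h3 := he.inner_eq_areaForm (hnG i) (hn i).unit (hnG j) hi0
    rw [inner_sub_right] at h3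
    rw [real_inner_smul_left, real_inner_smul_left] at h2
    have h4 : areaForm e (n j) (n i) = -areaForm e (n i) (n j) := by simp only [areaForm]; ring
    rw [h4] at h3
    have h5 : 0 < areaForm e (xi - y) (n i) * areaForm e (n i) (n j) := mul_pos hoi hpos
    nlinarith
  rw [dirFace_smul _ _ hapos] at hj hinter
  exact ⟨j, D, hD, hFD, hj, by rw [hj, hFD]; exact hinter, hpos⟩

end IsParallelohedronTiling

end Parallelohedra

/-! ### The normals of the hyperfaces around a (d-2)-face -/

namespace Parallelohedra

open Set Filter Topology

variable {d : ℕ} {P : Set (EuclideanSpace ℝ (Fin d))} {𝒯 : Set (Set (EuclideanSpace ℝ (Fin d)))}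
  {e : Fin 2 → EuclideanSpace ℝ (Fin d)} {G : Set (EuclideanSpace ℝ (Fin d))}

theorem areaForm_swap (e : Fin 2 → EuclideanSpace ℝ (Fin d)) (a b : EuclideanSpace ℝ (Fin d)) :
    areaForm e a b = -areaForm e b a := by
  simp only [areaForm]
  ring

theorem dirFace_add_eq_inter {D : Set (EuclideanSpace ℝ (Fin d))}
    {a b : EuclideanSpace ℝ (Fin d)} (hne : (dirFace D a ∩ dirFace D b).Nonempty) :
    dirFace D (a + b) = dirFace D a ∩ dirFace D b := by
  obtain ⟨x, hxa, hxb⟩ := hne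
  have hx : x ∈ dirFace D (a + b) := by
    refine ⟨hxa.1, fun z hz => ?_⟩
    rw [inner_add_left, inner_add_left]
    exact add_le_add (hxa.2 z hz) (hxb.2 z hz)
  ext y
  rw [mem_inter_iff, mem_dirFace_iff hx, mem_dirFace_iff hxa, mem_dirFace_iff hxb]
  constructor
  · rintro ⟨hy, h1⟩
    rw [inner_add_left, inner_add_left] at h1
    have h2 := hxa.2 y hy
    have h3 := hxb.2 y hy
    exact ⟨⟨hy, by linarith⟩, hy, by linarith⟩
  · rintro ⟨⟨hy, h1⟩, -, h2⟩
    exact ⟨hy, by rw [inner_add_left, inner_add_left, h1, h2]⟩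

theorem IsTraversalNormal.mem_orthogonal {A : Set (EuclideanSpace ℝ (Fin d))}
    {n : EuclideanSpace ℝ (Fin d)} (hn : IsTraversalNormal e G A n) (hGA : G ⊆ A) :
    n ∈ (vectorSpan ℝ G)ᗮ :=
  mem_orthogonal_of_subset hGA hn.normal

theorem IsTraversalNormal.ne_zero {A : Set (EuclideanSpace ℝ (Fin d))}
    {n : EuclideanSpace ℝ (Fin d)} (hn : IsTraversalNormal e G A n) : n ≠ 0 :=
  norm_ne_zero_iff.1 (by rw [hn.unit]; exact one_ne_zero)

/-- The scalar product with the vector along a hyperface. -/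
theorem IsTraversalNormal.inner_sub_eq {A : Set (EuclideanSpace ℝ (Fin d))}
    {n w x y : EuclideanSpace ℝ (Fin d)} (he : IsTraversalFrame G e)
    (hn : IsTraversalNormal e G A n) (hGA : G ⊆ A) (hw : w ∈ (vectorSpan ℝ G)ᗮ) (hx : x ∈ A)
    (hy : y ∈ A) : inner ℝ w (x - y) = areaForm e (x - y) n * areaForm e w n :=
  he.inner_eq_areaForm (hn.mem_orthogonal hGA) hn.unit hw
    (inner_sub_eq_zero_of_mem_orthogonal hn.normal hx hy)

namespace IsParallelohedronTiling

/-- This is where the cells being translates of one polytope restricts the fan of normals: a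
direction cannot expose a facet in one cell and a smaller face in another. -/
theorem finrank_dirFace (h : IsParallelohedronTiling P 𝒯)
    {D D' : Set (EuclideanSpace ℝ (Fin d))} (hD : D ∈ 𝒯) (hD' : D' ∈ 𝒯)
    (m : EuclideanSpace ℝ (Fin d)) :
    Module.finrank ℝ (vectorSpan ℝ (dirFace D m)) =
      Module.finrank ℝ (vectorSpan ℝ (dirFace D' m)) := by
  obtain ⟨v, rfl⟩ := h.translates D hD
  obtain ⟨v', rfl⟩ := h.translates D' hD'
  rw [dirFace_vadd, dirFace_vadd, vectorSpan_vadd, vectorSpan_vadd]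

/-- No hyperface has its normal strictly between the outward normals of two consecutive ones. -/
theorem notMem_of_isConsecutive (h : IsParallelohedronTiling P 𝒯) (hG : G ∈ facesOfCodim 𝒯 2)
    {A B D : Set (EuclideanSpace ℝ (Fin d))} {n n' : EuclideanSpace ℝ (Fin d)}
    (hc : IsConsecutive 𝒯 e G A B D n n') {F : Set (EuclideanSpace ℝ (Fin d))}
    (hF : F ∈ hyperfaces 𝒯) {m : EuclideanSpace ℝ (Fin d)} (hm : m ∈ (vectorSpan ℝ F)ᗮ)
    (hm0 : m ≠ 0) {c a b : ℝ} (hc0 : 0 < c) (ha : 0 < a) (hb : 0 < b) :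
    c • m ≠ a • -n + b • n' := by
  intro heq
  obtain ⟨D', hD', hFD'⟩ := h.exists_cell_dirFace hF hm hm0
  have hGne : (dirFace D (a • -n) ∩ dirFace D (b • n')).Nonempty := by
    rw [dirFace_smul _ _ ha, dirFace_smul _ _ hb, ← hc.left, ← hc.right, hc.inter]
    obtain ⟨C, -, hCG⟩ := hG.1
    exact hCG.1
  -- A direction strictly between the outward normals `-n` and `n'` exposes only `G` in `D`, whereas
  -- `m` exposes a hyperface in another cell.
  have h1 := dirFace_add_eq_inter hGne
  rw [← heq, dirFace_smul _ _ hc0, dirFace_smul _ _ ha, dirFace_smul _ _ hb, ← hc.left,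
    ← hc.right, hc.inter] at h1
  have h2 := h.finrank_dirFace hc.mem hD' m
  rw [h1, ← hFD'] at h2
  have h3 := hG.2
  have h4 : _ + 1 = d := hF.2
  omega

/-- The cell between two consecutive hyperfaces fills the wedge between them. -/
theorem eventually_mem_interior (h : IsParallelohedronTiling P 𝒯)
    (hG : G ∈ facesOfCodim 𝒯 2) (he : IsTraversalFrame G e)
    {A B D : Set (EuclideanSpace ℝ (Fin d))} {n n' : EuclideanSpace ℝ (Fin d)}
    (hA : A ∈ hyperfaces 𝒯) (hB : B ∈ hyperfaces 𝒯) (hn : n ∈ (vectorSpan ℝ G)ᗮ)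
    (hn' : n' ∈ (vectorSpan ℝ G)ᗮ)
    (hc : IsConsecutive 𝒯 e G A B D n n') {y w : EuclideanSpace ℝ (Fin d)}
    (hy : IsRelInterior G y) (hw : 0 < inner ℝ n w) (hw' : inner ℝ n' w < 0) :
    ∀ᶠ ε in 𝓝[>] (0 : ℝ), y + ε • w ∈ interior D := by
  have hGA : G ⊆ A := hc.inter ▸ inter_subset_left
  have hGB : G ⊆ B := hc.inter ▸ inter_subset_right
  have hAD : A ⊆ D := hc.left ▸ dirFace_subset _ _
  have hBD : B ⊆ D := hc.right ▸ dirFace_subset _ _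
  obtain ⟨x₁, hx₁, hx₁'⟩ := exists_mem_sdiff hG hA
  obtain ⟨x₂, hx₂, hx₂'⟩ := exists_mem_sdiff hG hB
  have hyA : y ∈ dirFace D (-n) := hc.left ▸ hGA hy.1
  have hyB : y ∈ dirFace D n' := hc.right ▸ hGB hy.1
  have h₁ := inner_eq_of_mem_dirFace (hc.left ▸ hx₁ : x₁ ∈ dirFace D (-n)) hyA
  have h₁' := inner_lt_of_notMem_dirFace hyB (hAD hx₁)
    fun hcon => hx₁' (by rw [← hc.inter]; exact ⟨hx₁, hc.right ▸ hcon⟩)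
  have h₂ := inner_lt_of_notMem_dirFace hyA (hBD hx₂)
    fun hcon => hx₂' (by rw [← hc.inter]; exact ⟨hc.left ▸ hcon, hx₂⟩)
  have h₂' := inner_eq_of_mem_dirFace (hc.right ▸ hx₂ : x₂ ∈ dirFace D n') hyB
  refine exists_mem_interior_of_wedge (h.convex hc.mem) (m := -n) (m' := n') (x₁ := x₁) (x₂ := x₂)
    (hGA.trans hAD) hy ?_ (hAD hx₁) (hBD hx₂) ?_ ?_ ?_ ?_ ?_ hw'
  · intro g hg hg'
    rw [inner_neg_left, neg_eq_zero, he.inner_eq hn] at hg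
    rw [he.inner_eq hn'] at hg'
    have hpos := hc.pos.ne'
    simp only [areaForm] at hpos
    refine he.mem_vectorSpan (mul_left_cancel₀ hpos ?_) (mul_left_cancel₀ hpos ?_)
    · linear_combination inner ℝ (e 1) n' * hg - inner ℝ (e 1) n * hg'
    · linear_combination inner ℝ (e 0) n * hg' - inner ℝ (e 0) n' * hg
  · rw [inner_sub_right, h₁, sub_self]
  · rw [inner_sub_right]; linarith
  · rw [inner_sub_right]; linarith
  · rw [inner_sub_right, h₂', sub_self]
  · rw [inner_neg_left]; linarith

/-- A hyperface around `G` is determined by its traversal normal. -/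
theorem eq_of_isConsecutive (h : IsParallelohedronTiling P 𝒯)
    (hG : G ∈ facesOfCodim 𝒯 2) (he : IsTraversalFrame G e)
    {A A' B B' D D' : Set (EuclideanSpace ℝ (Fin d))} {n m m' : EuclideanSpace ℝ (Fin d)}
    (hA : A ∈ hyperfaces 𝒯) (hA' : A' ∈ hyperfaces 𝒯) (hB : B ∈ hyperfaces 𝒯)
    (hB' : B' ∈ hyperfaces 𝒯) (hn : IsTraversalNormal e G A n)
    (hm : m ∈ (vectorSpan ℝ G)ᗮ) (hm' : m' ∈ (vectorSpan ℝ G)ᗮ)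
    (hc : IsConsecutive 𝒯 e G A B D n m) (hc' : IsConsecutive 𝒯 e G A' B' D' n m') : A = A' := by
  have hGA : G ⊆ A := hc.inter ▸ inter_subset_left
  have hnG := hn.mem_orthogonal hGA
  obtain ⟨C, hC, hCG⟩ := hG.1
  have hGc : Convex ℝ G := by
    obtain ⟨-, l, rfl⟩ := isFace_iff.1 hCG
    exact (h.convex hC).dirFace l
  obtain ⟨y, hy⟩ := hGc.exists_isRelInterior hCG.1
  obtain ⟨x, hx, hx'⟩ := exists_mem_sdiff hG hA
  have hxy : 0 < areaForm e (x - y) n := hn.oriented y hy.1 x ⟨hx, hx'⟩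
  -- The vector along `A`, tilted slightly towards `n`, points into the wedges of both `D` and `D'`.
  -- The interiors of these cells therefore meet, so `D = D'`, and its face in direction `-n` is
  -- both `A` and `A'`.
  have hneg : ∀ m ∈ (vectorSpan ℝ G)ᗮ, 0 < areaForm e n m →
      ∀ᶠ δ in 𝓝[>] (0 : ℝ), inner ℝ m (x - y + δ • n) < 0 := by
    intro m hm hpos
    have hct : ContinuousAt (fun δ : ℝ => inner ℝ m (x - y + δ • n)) 0 := by fun_prop
    refine (hct.eventually_lt continuousAt_const ?_).filter_mono nhdsWithin_le_nhds
    rw [zero_smul, add_zero, hn.inner_sub_eq he hGA hm hx (hGA hy.1), areaForm_swap e m n]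
    nlinarith
  obtain ⟨δ, ⟨h1, h2⟩, h3⟩ := (((hneg m hm hc.pos).and (hneg m' hm' hc'.pos)).and
    self_mem_nhdsWithin).exists
  have h4 : 0 < inner ℝ n (x - y + δ • n) := by
    rw [inner_add_right, inner_sub_eq_zero_of_mem_orthogonal hn.normal hx (hGA hy.1), zero_add,
      inner_smul_right]
    exact mul_pos h3 (real_inner_self_pos.2 hn.ne_zero)
  obtain ⟨ε, h5, h6⟩ := ((h.eventually_mem_interior hG he hA hB hnG hm hc hy h4 h1).and
    (h.eventually_mem_interior hG he hA' hB' hnG hm' hc' hy h4 h2)).exists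
  have hDD : D = D' := by
    by_contra hne
    exact disjoint_left.1 (h.disjoint_interiors D hc.mem D' hc'.mem hne) h5 h6
  rw [hc.left, hc'.left, hDD]

/-- The position of the normal of a further hyperface relative to two consecutive ones. -/
theorem areaForm_nonpos_of_isConsecutive (h : IsParallelohedronTiling P 𝒯)
    (hG : G ∈ facesOfCodim 𝒯 2) (he : IsTraversalFrame G e)
    {A B D F : Set (EuclideanSpace ℝ (Fin d))} {n n' m : EuclideanSpace ℝ (Fin d)}
    (hA : A ∈ hyperfaces 𝒯) (hB : B ∈ hyperfaces 𝒯) (hF : F ∈ hyperfaces 𝒯) (hGF : G ⊆ F)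
    (hn : IsTraversalNormal e G A n) (hn' : IsTraversalNormal e G B n')
    (hm : IsTraversalNormal e G F m) (hc : IsConsecutive 𝒯 e G A B D n n') :
    m = n ∨ m = n' ∨ (areaForm e n m ≤ 0 ∧ areaForm e m n' ≤ 0) := by
  have hGA : G ⊆ A := hc.inter ▸ inter_subset_left
  have hGB : G ⊆ B := hc.inter ▸ inter_subset_right
  have hnG := hn.mem_orthogonal hGA
  have hnG' := hn'.mem_orthogonal hGB
  have hmG := hm.mem_orthogonal hGF
  have hW := hc.pos
  -- The signs of `X` and `Y` locate `m` among the four sectors cut out by the lines of `n` and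
  -- `n'`. Opposite signs put `m` or `-m` between `-n` and `n'`, which is excluded; a vanishing
  -- coordinate with the other positive gives `m = n` or `m = n'`.
  have key := he.mul_areaForm_smul_eq hnG hnG' hmG
  set W := areaForm e n n' with hWdef
  set X := areaForm e m n' with hX
  set Y := areaForm e n m with hY
  have hcol : ∀ {u : EuclideanSpace ℝ (Fin d)} {c : ℝ}, ‖u‖ = 1 → 0 ≤ c → W • m = c • u →
      m = u := by
    intro u c hu hc0 heq
    have := congrArg norm heq
    rw [norm_smul, norm_smul, hm.unit, hu, mul_one, mul_one, Real.norm_of_nonneg hW.le,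
      Real.norm_of_nonneg hc0] at this
    rw [← this] at heq
    exact smul_right_injective _ hW.ne' heq
  rcases lt_trichotomy X 0 with hX0 | hX0 | hX0
  · rcases le_or_gt Y 0 with hY0 | hY0
    · exact Or.inr (Or.inr ⟨hY0, hX0.le⟩)
    · exfalso
      refine h.notMem_of_isConsecutive hG hc hF hm.normal hm.ne_zero hW (neg_pos.2 hX0) hY0 ?_
      rw [key, neg_smul_neg]
  · rcases le_or_gt Y 0 with hY0 | hY0
    · exact Or.inr (Or.inr ⟨hY0, hX0.le⟩)
    · refine Or.inr (Or.inl (hcol hn'.unit hY0.le ?_))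
      rw [key, hX0, zero_smul, zero_add]
  · rcases lt_trichotomy Y 0 with hY0 | hY0 | hY0
    · exfalso
      refine h.notMem_of_isConsecutive hG hc hF (neg_mem hm.normal) (neg_ne_zero.2 hm.ne_zero) hW
        hX0 (neg_pos.2 hY0) ?_
      rw [smul_neg, key]
      module
    · refine Or.inl (hcol hn.unit hX0.le ?_)
      rw [key, hY0, zero_smul, add_zero]
    -- If both are positive, the hyperface `F` issues from `G` into the interior of `D`, which no
    -- hyperface can enter.
    · exfalso
      obtain ⟨C, hC, hCG⟩ := hG.1
      have hGc : Convex ℝ G := by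
        obtain ⟨-, l, rfl⟩ := isFace_iff.1 hCG
        exact (h.convex hC).dirFace l
      obtain ⟨y, hy⟩ := hGc.exists_isRelInterior hCG.1
      obtain ⟨x, hx, hx'⟩ := exists_mem_sdiff hG hF
      have hxy : 0 < areaForm e (x - y) m := hm.oriented y hy.1 x ⟨hx, hx'⟩
      have h1 : 0 < inner ℝ n (x - y) := by
        rw [hm.inner_sub_eq he hGF hnG hx (hGF hy.1)]
        exact mul_pos hxy hY0
      have h2 : inner ℝ n' (x - y) < 0 := by
        rw [hm.inner_sub_eq he hGF hnG' hx (hGF hy.1), areaForm_swap e n' m]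
        nlinarith
      obtain ⟨ε, h3, h4, h5⟩ := ((h.eventually_mem_interior hG he hA hB hnG hnG' hc hy h1 h2).and
        (Ioo_mem_nhdsGT one_pos)).exists
      obtain ⟨D', hD', hFD'⟩ := h.exists_cell_dirFace hF hm.normal hm.ne_zero
      have hFc : Convex ℝ F := hFD' ▸ (h.convex hD').dirFace m
      have h6 : y + ε • (x - y) ∈ F := by
        have := hFc (hGF hy.1) hx (sub_nonneg.2 h5.le) h4.le (sub_add_cancel 1 ε)
        convert this using 1
        module
      rcases eq_or_ne D D' with rfl | hne
      · rw [hFD'] at h6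
        exact notMem_interior_of_mem_dirFace hm.ne_zero h6 h3
      · exact disjoint_left.1 (h.disjoint_interior_cell hc.mem hD' hne) h3
          ((hFD' ▸ dirFace_subset _ _ : F ⊆ D') h6)

/-- Around a `(d-2)`-face of the tiling there are either three hyperfaces, with proportional
relations between their normals, or two pairs of opposite hyperfaces. -/
theorem torsion_dichotomy (h : IsParallelohedronTiling P 𝒯)
    (hG : G ∈ facesOfCodim 𝒯 2) (he : IsTraversalFrame G e)
    {ι : Type*} [Fintype ι] [DecidableEq ι] {F : ι → Set (EuclideanSpace ℝ (Fin d))}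
    {n : ι → EuclideanSpace ℝ (Fin d)} (hinj : Function.Injective F)
    (hF : ∀ i, F i ∈ hyperfaces 𝒯) (hGF : ∀ i, G ⊆ F i)
    (hcov : ∀ A ∈ hyperfaces 𝒯, G ⊆ A → ∃ i, F i = A)
    (hn : ∀ i, IsTraversalNormal e G (F i) (n i)) :
    (∀ s t : ι → ℝ, ∑ i, s i • n i = 0 → ∑ i, t i • n i = 0 → ∀ i j, s i * t j = s j * t i) ∨
    ∃ τ : Equiv.Perm ι, (∀ i, n (τ i) = -n i) ∧
      ∀ s : ι → ℝ, ∑ i, s i • n i = 0 → ∀ i, s (τ i) = s i := by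
  have hnG : ∀ i, n i ∈ (vectorSpan ℝ G)ᗮ := fun i => (hn i).mem_orthogonal (hGF i)
  have hninj : ∀ i j, n i = n j → i = j := by
    intro i j hij
    obtain ⟨i', D, hD⟩ := h.exists_isConsecutive hG he hF hGF hcov hn i
    obtain ⟨j', D', hD'⟩ := h.exists_isConsecutive hG he hF hGF hcov hn j
    rw [← hij] at hD'
    exact hinj (h.eq_of_isConsecutive hG he (hF i) (hF j) (hF i') (hF j') (hn i) (hnG i') (hnG j')
      hD hD')
  have hsum : ∀ (s : ι → ℝ), ∑ i, s i • n i = 0 → ∀ v : EuclideanSpace ℝ (Fin d),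
      ∑ i, s i * inner ℝ v (n i) = 0 := by
    intro s hs v
    have := congrArg (inner ℝ v) hs
    simpa [inner_sum, inner_smul_right] using this
  have key := relations_of_fan (fun i => inner ℝ (e 0) (n i)) (fun i => inner ℝ (e 1) (n i))
    (by
      intro i
      have h1 := he.inner_eq (hnG i) (n i)
      rw [real_inner_self_eq_norm_sq, (hn i).unit] at h1
      linarith)
    (fun i j h0 h1 => hninj i j (he.eq_of_inner_eq (hnG i) (hnG j) h0 h1))
    (by
      intro i
      obtain ⟨j, D, hD⟩ := h.exists_isConsecutive hG he hF hGF hcov hn i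
      refine ⟨j, hD.pos, fun l => ?_⟩
      rcases h.areaForm_nonpos_of_isConsecutive hG he (hF i) (hF j) (hF l) (hGF l) (hn i) (hn j)
        (hn l) hD with h1 | h1 | h1
      · exact Or.inl (hninj _ _ h1)
      · exact Or.inr (Or.inl (hninj _ _ h1))
      · exact Or.inr (Or.inr h1))
  rcases key with key | ⟨τ, hτ, key⟩
  · exact Or.inl fun s t hs ht =>
      key s t (hsum s hs _) (hsum s hs _) (hsum t ht _) (hsum t ht _)
  · refine Or.inr ⟨τ, fun i => ?_, fun s hs => key s (hsum s hs _) (hsum s hs _)⟩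
    refine he.eq_of_inner_eq (hnG _) (neg_mem (hnG i)) ?_ ?_
    · rw [inner_neg_right]; exact (hτ i).1
    · rw [inner_neg_right]; exact (hτ i).2

end IsParallelohedronTiling

end Parallelohedra

/-! ### Independence of the frame, and symmetries of the tiling -/

namespace Parallelohedra

open Set

variable {d : ℕ} {P : Set (EuclideanSpace ℝ (Fin d))} {𝒯 : Set (Set (EuclideanSpace ℝ (Fin d)))}
  {e : Fin 2 → EuclideanSpace ℝ (Fin d)} {G : Set (EuclideanSpace ℝ (Fin d))}

/-- The area forms of two traversal frames are proportional. -/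
theorem IsTraversalFrame.areaForm_eq {e' : Fin 2 → EuclideanSpace ℝ (Fin d)}
    (he : IsTraversalFrame G e) (he' : IsTraversalFrame G e') (a b : EuclideanSpace ℝ (Fin d)) :
    areaForm e a b = areaForm e' (e 0) (e 1) * areaForm e' a b := by
  have hmem : ∀ i, e i ∈ (vectorSpan ℝ G)ᗮ := fun i => he.2 ▸ Submodule.subset_span ⟨i, rfl⟩
  simp only [areaForm]
  rw [he'.inner_eq (hmem 0) a, he'.inner_eq (hmem 0) b, he'.inner_eq (hmem 1) a,
    he'.inner_eq (hmem 1) b]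
  ring

/-- The traversal normals of a hyperface for two traversal frames agree up to a common sign. -/
theorem IsTraversalNormal.eq_smul {e' : Fin 2 → EuclideanSpace ℝ (Fin d)}
    (hG : G ∈ facesOfCodim 𝒯 2) (he : IsTraversalFrame G e) (he' : IsTraversalFrame G e')
    {A : Set (EuclideanSpace ℝ (Fin d))} (hA : A ∈ hyperfaces 𝒯)
    {n n' : EuclideanSpace ℝ (Fin d)} (hn : IsTraversalNormal e G A n)
    (hn' : IsTraversalNormal e' G A n') :
    n' = (if 0 < areaForm e' (e 0) (e 1) then (1 : ℝ) else -1) • n := by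
  obtain ⟨C, -, ⟨y, hy⟩, -⟩ := hG.1
  obtain ⟨x, hx, hx'⟩ := exists_mem_sdiff hG hA
  have h1 : 0 < areaForm e (x - y) n := hn.oriented y hy x ⟨hx, hx'⟩
  have h2 : 0 < areaForm e' (x - y) n' := hn'.oriented y hy x ⟨hx, hx'⟩
  rw [he.areaForm_eq he'] at h1
  have hmem := hn'.normal
  rw [orthogonal_eq_span_singleton (by rw [finrank_euclideanSpace_fin]; exact hA.2) hn.normal
    hn.ne_zero] at hmem
  obtain ⟨c, rfl⟩ := Submodule.mem_span_singleton.1 hmem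
  have h3 : areaForm e' (x - y) (c • n) = c * areaForm e' (x - y) n := by
    simp only [areaForm, inner_smul_right]
    ring
  rw [h3] at h2
  have h4 := hn'.unit
  rw [norm_smul, hn.unit, mul_one, Real.norm_eq_abs] at h4
  congr 1
  split_ifs with hD
  · have h5 := pos_of_mul_pos_right h1 hD.le |> fun h5 => pos_of_mul_pos_left h2 h5.le
    rwa [abs_of_pos h5] at h4
  · have h5 : areaForm e' (x - y) n < 0 := by
      by_contra! hcon
      exact hD (pos_of_mul_pos_left h1 hcon)
    have h6 : c < 0 := by
      by_contra! hcon
      exact h2.not_ge (mul_nonpos_of_nonneg_of_nonpos hcon h5.le)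
    rw [abs_of_neg h6] at h4
    linarith

/-- A vanishing torsion vanishes for each choice of the traversal frame and of the order of the
hyperfaces. -/
theorem IsTorsion.sum_eq_zero {s : hyperfaces 𝒯 → ℝ} (hs : IsTorsion 𝒯 s G 0)
    (hG : G ∈ facesOfCodim 𝒯 2) (he : IsTraversalFrame G e) {ι : Type*} [Fintype ι]
    (F : ι ≃ {F : hyperfaces 𝒯 // G ⊆ (F : Set (EuclideanSpace ℝ (Fin d)))})
    {n : ι → EuclideanSpace ℝ (Fin d)}
    (hn : ∀ i, IsTraversalNormal e G ((F i).1 : Set (EuclideanSpace ℝ (Fin d))) (n i)) :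
    ∑ i, s (F i).1 • n i = 0 := by
  obtain ⟨e', he', k, F', n', hn', h0⟩ := hs
  set σ : ℝ := if 0 < areaForm e (e' 0) (e' 1) then (1 : ℝ) else -1 with hσ
  have hnn : ∀ i, n i = σ • n' (F'.symm (F i)) := by
    intro i
    have h1 := hn' (F'.symm (F i))
    rw [Equiv.apply_symm_apply] at h1
    exact IsTraversalNormal.eq_smul hG he' he (F i).1.2 h1 (hn i)
  calc ∑ i, s (F i).1 • n i
      = σ • ∑ i, s (F' ((F.trans F'.symm) i)).1 • n' ((F.trans F'.symm) i) := by
        rw [Finset.smul_sum]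
        refine Finset.sum_congr rfl fun i _ => ?_
        rw [Equiv.trans_apply, Equiv.apply_symm_apply, hnn i, smul_comm]
    _ = 0 := by
        rw [(F.trans F'.symm).sum_comp fun j => s (F' j).1 • n' j, ← h0, smul_zero]

/-- The isometries that map the tiling onto itself. -/
structure IsSymmetry (𝒯 : Set (Set (EuclideanSpace ℝ (Fin d))))
    (φ : EuclideanSpace ℝ (Fin d) ≃ᵃⁱ[ℝ] EuclideanSpace ℝ (Fin d)) : Prop where
  image_mem : ∀ C ∈ 𝒯, φ '' C ∈ 𝒯
  symm_image_mem : ∀ C ∈ 𝒯, φ.symm '' C ∈ 𝒯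

section Isometry

variable {φ : EuclideanSpace ℝ (Fin d) ≃ᵃⁱ[ℝ] EuclideanSpace ℝ (Fin d)}

theorem inner_map_sub_map (m x y : EuclideanSpace ℝ (Fin d)) :
    inner ℝ (φ.linearIsometryEquiv m) (φ x - φ y) = inner ℝ m (x - y) := by
  rw [← vsub_eq_sub, ← φ.map_vsub, LinearIsometryEquiv.inner_map_map, vsub_eq_sub]

theorem image_dirFace (C : Set (EuclideanSpace ℝ (Fin d))) (m : EuclideanSpace ℝ (Fin d)) :
    φ '' dirFace C m = dirFace (φ '' C) (φ.linearIsometryEquiv m) := by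
  have key : ∀ x y, inner ℝ (φ.linearIsometryEquiv m) (φ y) ≤
      inner ℝ (φ.linearIsometryEquiv m) (φ x) ↔ inner ℝ m y ≤ inner ℝ m x := by
    intro x y
    rw [← sub_nonneg, ← inner_sub_right, inner_map_sub_map, inner_sub_right, sub_nonneg]
  ext z
  constructor
  · rintro ⟨x, ⟨hx, hx'⟩, rfl⟩
    refine ⟨mem_image_of_mem _ hx, ?_⟩
    rintro _ ⟨y, hy, rfl⟩
    exact (key x y).2 (hx' y hy)
  · rintro ⟨⟨x, hx, rfl⟩, hx'⟩
    exact ⟨x, ⟨hx, fun y hy => (key x y).1 (hx' _ (mem_image_of_mem _ hy))⟩, rfl⟩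

theorem vectorSpan_image (A : Set (EuclideanSpace ℝ (Fin d))) :
    vectorSpan ℝ (φ '' A) = (vectorSpan ℝ A).map (φ.linearIsometryEquiv.toLinearEquiv :
      EuclideanSpace ℝ (Fin d) →ₗ[ℝ] EuclideanSpace ℝ (Fin d)) :=
  (φ.toAffineEquiv.toAffineMap.map_vectorSpan).symm

theorem orthogonal_vectorSpan_image (A : Set (EuclideanSpace ℝ (Fin d))) :
    (vectorSpan ℝ (φ '' A))ᗮ = (vectorSpan ℝ A)ᗮ.map (φ.linearIsometryEquiv.toLinearEquiv :
      EuclideanSpace ℝ (Fin d) →ₗ[ℝ] EuclideanSpace ℝ (Fin d)) := by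
  rw [vectorSpan_image]
  exact (Submodule.map_orthogonal_equiv _ φ.linearIsometryEquiv).symm

theorem IsTraversalFrame.image (he : IsTraversalFrame G e) :
    IsTraversalFrame (φ '' G) (φ.linearIsometryEquiv ∘ e) := by
  refine ⟨he.1.comp_linearIsometryEquiv _, ?_⟩
  rw [orthogonal_vectorSpan_image, ← he.2, Submodule.map_span, range_comp]
  rfl

theorem IsTraversalNormal.image {A : Set (EuclideanSpace ℝ (Fin d))}
    {n : EuclideanSpace ℝ (Fin d)} (hn : IsTraversalNormal e G A n) :
    IsTraversalNormal (φ.linearIsometryEquiv ∘ e) (φ '' G) (φ '' A)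
      (φ.linearIsometryEquiv n) where
  unit := by rw [LinearIsometryEquiv.norm_map, hn.unit]
  normal := by
    rw [orthogonal_vectorSpan_image]
    exact Submodule.mem_map_of_mem hn.normal
  oriented := by
    rintro _ ⟨y, hy, rfl⟩ _ ⟨⟨x, hx, rfl⟩, hx'⟩
    simp only [Function.comp_apply, inner_map_sub_map, LinearIsometryEquiv.inner_map_map]
    exact hn.oriented y hy x ⟨hx, fun hxG => hx' (mem_image_of_mem _ hxG)⟩

namespace IsSymmetry

theorem symm (hφ : IsSymmetry 𝒯 φ) : IsSymmetry 𝒯 φ.symm :=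
  ⟨hφ.symm_image_mem, by rw [φ.symm_symm]; exact hφ.image_mem⟩

theorem image_mem_facesOfCodim (hφ : IsSymmetry 𝒯 φ) {j : ℕ}
    {A : Set (EuclideanSpace ℝ (Fin d))} (hA : A ∈ facesOfCodim 𝒯 j) :
    φ '' A ∈ facesOfCodim 𝒯 j := by
  obtain ⟨⟨C, hC, hCA⟩, hd⟩ := hA
  obtain ⟨hne, m, rfl⟩ := isFace_iff.1 hCA
  refine ⟨⟨φ '' C, hφ.image_mem C hC, isFace_iff.2 ⟨hne.image _, _, image_dirFace C m⟩⟩, ?_⟩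
  rw [vectorSpan_image, LinearEquiv.finrank_map_eq]
  exact hd

/-- The permutation of the hyperfaces by a symmetry of the tiling. -/
def hyperfaceEquiv (hφ : IsSymmetry 𝒯 φ) : hyperfaces 𝒯 ≃ hyperfaces 𝒯 where
  toFun F := ⟨φ '' F.1, hφ.image_mem_facesOfCodim F.2⟩
  invFun F := ⟨φ.symm '' F.1, hφ.symm.image_mem_facesOfCodim F.2⟩
  left_inv F := Subtype.ext (by simp [image_image])
  right_inv F := Subtype.ext (by simp [image_image])

/-- The linear part of the inverse symmetry carries frame and normals at `φ '' G` to those at `G`,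
and so the torsion too. An orientation-reversing symmetry does no harm because either direction of
traversal is admitted. -/
theorem isCanonicalScaling_comp (hφ : IsSymmetry 𝒯 φ) {s : hyperfaces 𝒯 → ℝ}
    (hs : IsCanonicalScaling 𝒯 s) : IsCanonicalScaling 𝒯 (s ∘ hφ.hyperfaceEquiv) := by
  refine ⟨fun F => hs.1 _, fun G hG => ?_⟩
  obtain ⟨e, he, k, F, n, hn, h0⟩ := hs.2 _ (hφ.image_mem_facesOfCodim hG)
  have hGG : φ.symm '' (φ '' G) = G := by simp [image_image]
  have hsub : ∀ A : Set (EuclideanSpace ℝ (Fin d)), φ '' G ⊆ A ↔ G ⊆ φ.symm '' A := by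
    intro A
    rw [← image_subset_image_iff φ.symm.injective, hGG]
  let F' : Fin k ≃ {A : hyperfaces 𝒯 // G ⊆ (A : Set (EuclideanSpace ℝ (Fin d)))} :=
    F.trans (hφ.hyperfaceEquiv.symm.subtypeEquiv fun A => hsub A.1)
  refine ⟨φ.symm.linearIsometryEquiv ∘ e, hGG ▸ he.image, k, F',
    fun i => φ.symm.linearIsometryEquiv (n i), fun i => ?_, ?_⟩
  · have := (hn i).image (φ := φ.symm)
    rwa [hGG] at this
  · have h1 : ∀ i, (s ∘ hφ.hyperfaceEquiv) (F' i).1 = s (F i).1 := fun i =>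
      congrArg s (hφ.hyperfaceEquiv.apply_symm_apply (F i).1)
    simp only [h1, ← map_smul, ← map_sum]
    rw [← h0, map_zero]

end IsSymmetry

end Isometry

theorem isSymmetry_constVAdd {v : EuclideanSpace ℝ (Fin d)} (hv : v ∈ translationVectors 𝒯) :
    IsSymmetry 𝒯 (AffineIsometryEquiv.constVAdd ℝ (EuclideanSpace ℝ (Fin d)) v) := by
  refine ⟨fun C hC => ?_, fun C hC => ?_⟩
  · rw [← show _ = 𝒯 from hv]
    exact mem_image_of_mem _ hC
  · rw [← show _ = 𝒯 from hv] at hC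
    obtain ⟨C, hC, rfl⟩ := hC
    have : (AffineIsometryEquiv.constVAdd ℝ (EuclideanSpace ℝ (Fin d)) v).symm '' (v +ᵥ C) = C :=
      (AffineIsometryEquiv.constVAdd ℝ (EuclideanSpace ℝ (Fin d)) v).toEquiv.symm_image_image C
    exact this.symm ▸ hC

theorem isSymmetry_constVSub {w : EuclideanSpace ℝ (Fin d)} (hw : ∀ C ∈ 𝒯, w +ᵥ -C ∈ 𝒯) :
    IsSymmetry 𝒯 (AffineIsometryEquiv.constVSub ℝ w) := by
  have himage : ∀ C : Set (EuclideanSpace ℝ (Fin d)), (fun x => w - x) '' C = w +ᵥ -C := by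
    intro C
    rw [← image_neg_eq_neg, ← image_vadd, image_image]
    simp only [vadd_eq_add, sub_eq_add_neg]
  refine ⟨fun C hC => ?_, fun C hC => ?_⟩
  · have := hw C hC
    rwa [← himage] at this
  · have := hw C hC
    rw [← himage] at this
    convert this using 2
    ext x
    simp [sub_eq_neg_add]

/-- The group of the translations that map the tiling onto itself. -/
def translationSubgroup (𝒯 : Set (Set (EuclideanSpace ℝ (Fin d)))) :
    AddSubgroup (EuclideanSpace ℝ (Fin d)) where
  carrier := translationVectors 𝒯
  zero_mem' := by
    change (fun C => (0 : EuclideanSpace ℝ (Fin d)) +ᵥ C) '' 𝒯 = 𝒯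
    simp
  add_mem' {a b} ha hb := by
    change (fun C => (a + b) +ᵥ C) '' 𝒯 = 𝒯
    conv_rhs => rw [← show _ = 𝒯 from ha, ← show _ = 𝒯 from hb]
    simp only [image_image, vadd_vadd]
  neg_mem' {a} ha := by
    change (fun C => -a +ᵥ C) '' 𝒯 = 𝒯
    conv_lhs => rw [← show _ = 𝒯 from ha]
    simp only [image_image, neg_vadd_vadd, image_id']

/-- The action of the translation group of the tiling on its hyperfaces. -/
noncomputable instance : AddAction (translationSubgroup 𝒯) (hyperfaces 𝒯) where
  vadd v F := (isSymmetry_constVAdd v.2).hyperfaceEquiv F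
  zero_vadd F := Subtype.ext (zero_vadd (EuclideanSpace ℝ (Fin d)) F.1)
  add_vadd v w F := Subtype.ext (add_vadd v.1 w.1 F.1)

theorem coe_translation_vadd (v : translationSubgroup 𝒯) (F : hyperfaces 𝒯) :
    ((v +ᵥ F : hyperfaces 𝒯) : Set (EuclideanSpace ℝ (Fin d))) = v.1 +ᵥ F.1 :=
  rfl

theorem IsCanonicalScaling.comp_vadd {s : hyperfaces 𝒯 → ℝ} (hs : IsCanonicalScaling 𝒯 s)
    (v : translationSubgroup 𝒯) : IsCanonicalScaling 𝒯 fun F => s (v +ᵥ F) :=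
  (isSymmetry_constVAdd v.2).isCanonicalScaling_comp hs

/-! ### Linked hyperfaces and the invariant scaling -/

/-- The values on `F` and `F'` have the same ratio for all canonical scalings. -/
def IsLinked (F F' : hyperfaces 𝒯) : Prop :=
  ∀ s t : hyperfaces 𝒯 → ℝ, IsCanonicalScaling 𝒯 s → IsCanonicalScaling 𝒯 t →
    s F * t F' = s F' * t F

namespace IsLinked

variable {F F' F'' : hyperfaces 𝒯}

theorem refl (F : hyperfaces 𝒯) : IsLinked F F := fun _ _ _ _ => rfl

theorem symm (hF : IsLinked F F') : IsLinked F' F :=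
  fun _ _ hs ht => (hF _ _ hs ht).symm

theorem trans (hF : IsLinked F F') (hF' : IsLinked F' F'') : IsLinked F F'' := by
  intro s t hs ht
  refine mul_left_cancel₀ (hs.1 F').ne' (mul_left_cancel₀ (ht.1 F').ne' ?_)
  linear_combination s F' * t F'' * hF s t hs ht + s F' * t F * hF' s t hs ht

theorem vadd (hF : IsLinked F F') (v : translationSubgroup 𝒯) : IsLinked (v +ᵥ F) (v +ᵥ F') :=
  fun _ _ hs ht => hF _ _ (hs.comp_vadd v) (ht.comp_vadd v)

theorem of_eq (hF : ∀ s : hyperfaces 𝒯 → ℝ, IsCanonicalScaling 𝒯 s → s F = s F') :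
    IsLinked F F' := fun s t hs ht => by rw [hF s hs, hF t ht]

/-- Canonical scalings agree on linked hyperfaces that are translates of each other. -/
theorem eq_of_vadd (h : IsParallelohedronTiling P 𝒯) {v : translationSubgroup 𝒯}
    (hF : IsLinked F (v +ᵥ F)) {s : hyperfaces 𝒯 → ℝ} (hs : IsCanonicalScaling 𝒯 s) :
    s (v +ᵥ F) = s F := by
  obtain ⟨w, hw, hwF⟩ := h.exists_reflection F.2
  have hφ := isSymmetry_constVSub hw
  have himage : ∀ A : hyperfaces 𝒯, (hφ.hyperfaceEquiv A).1 = w +ᵥ -A.1 := by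
    intro A
    change (fun x => w - x) '' A.1 = _
    rw [← image_neg_eq_neg, ← image_vadd, image_image]
    simp only [vadd_eq_add, sub_eq_add_neg]
  have h1 : hφ.hyperfaceEquiv F = F := Subtype.ext ((himage F).trans hwF)
  -- A point reflection conjugates the translation by `v` into that by `-v`, and this one fixes `F`.
  have h2 : hφ.hyperfaceEquiv (v +ᵥ F) = -v +ᵥ F := by
    refine Subtype.ext ?_
    rw [himage, coe_translation_vadd, coe_translation_vadd]
    nth_rw 2 [← hwF]
    rw [vadd_vadd]
    ext z
    simp only [mem_vadd_set_iff_neg_vadd_mem, mem_neg, vadd_eq_add, AddSubgroup.coe_neg]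
    congr! 1
    abel
  -- Linkedness is tested on the reflected scaling, which gives `s (v +ᵥ F) = s (-v +ᵥ F)`, and then
  -- on the scaling translated by `-v`, which gives `s (-v +ᵥ F) * s (v +ᵥ F) = s F ^ 2`.
  have h3 := hF _ _ (hφ.isCanonicalScaling_comp hs) hs
  simp only [Function.comp_apply, h1, h2] at h3
  have h4 : s (v +ᵥ F) = s (-v +ᵥ F) :=
    mul_left_cancel₀ (hs.1 F).ne' (h3.trans (mul_comm _ _))
  have h5 := hF _ _ (hs.comp_vadd (-v)) hs
  simp only [neg_vadd_vadd, ← h4] at h5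
  exact (mul_self_inj (hs.1 _).le (hs.1 _).le).1 h5

theorem eq_of_vadd_vadd (h : IsParallelohedronTiling P 𝒯) {v w : translationSubgroup 𝒯}
    (hF : IsLinked (v +ᵥ F) (w +ᵥ F)) {s : hyperfaces 𝒯 → ℝ} (hs : IsCanonicalScaling 𝒯 s) :
    s (w +ᵥ F) = s (v +ᵥ F) := by
  have h1 : (w - v) +ᵥ (v +ᵥ F) = w +ᵥ F := by rw [vadd_vadd, sub_add_cancel]
  rw [← h1] at hF ⊢
  exact hF.eq_of_vadd h hs

end IsLinked

/-- Two hyperfaces are equivalent if one of them is linked with a translate of the other. -/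
def linkedSetoid (𝒯 : Set (Set (EuclideanSpace ℝ (Fin d)))) : Setoid (hyperfaces 𝒯) where
  r F F' := ∃ v : translationSubgroup 𝒯, IsLinked F (v +ᵥ F')
  iseqv := by
    refine ⟨fun F => ⟨0, by rw [zero_vadd]; exact .refl F⟩, ?_, ?_⟩
    · rintro F F' ⟨v, hv⟩
      refine ⟨-v, ?_⟩
      have := (hv.vadd (-v)).symm
      rwa [neg_vadd_vadd] at this
    · rintro F F' F'' ⟨v, hv⟩ ⟨w, hw⟩
      exact ⟨v + w, by rw [add_vadd]; exact hv.trans (hw.vadd v)⟩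

/-- A canonical scaling yields a translation invariant positive scaling whose ratios on linked
hyperfaces are those of the canonical scalings. -/
theorem IsParallelohedronTiling.exists_invariant_of_isCanonicalScaling
    (h : IsParallelohedronTiling P 𝒯) {s : hyperfaces 𝒯 → ℝ} (hs : IsCanonicalScaling 𝒯 s) :
    ∃ s' : hyperfaces 𝒯 → ℝ, (∀ F, 0 < s' F) ∧ IsTranslationInvariant 𝒯 s' ∧
      ∀ F F', IsLinked F F' → s' F * s F' = s' F' * s F := by
  let R : hyperfaces 𝒯 → hyperfaces 𝒯 := fun F => (Quotient.mk (linkedSetoid 𝒯) F).out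
  have hR : ∀ F, ∃ v : translationSubgroup 𝒯, IsLinked (R F) (v +ᵥ F) := fun F =>
    Quotient.mk_out (s := linkedSetoid 𝒯) F
  have hRR : ∀ {F F'} (v : translationSubgroup 𝒯), IsLinked F (v +ᵥ F') → R F = R F' :=
    fun v hv => congrArg Quotient.out (Quotient.sound (s := linkedSetoid 𝒯) ⟨v, hv⟩)
  choose v hv using hR
  -- The new value is that of `s` on a translate of `F` linked with the representative of its class.
  -- All such translates are linked with each other, hence carry the same value.
  refine ⟨fun F => s (v F +ᵥ F), fun F => hs.1 _, ?_, fun F F' hFF => ?_⟩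
  · intro u hu F F' hFF
    obtain ⟨u, rfl⟩ : ∃ u' : translationSubgroup 𝒯, u'.1 = u := ⟨⟨u, hu⟩, rfl⟩
    obtain rfl : F' = u +ᵥ F := Subtype.ext hFF
    have h1 := hv (u +ᵥ F)
    rw [hRR u (.refl _), vadd_vadd] at h1
    change s (v (u +ᵥ F) +ᵥ (u +ᵥ F)) = _
    rw [vadd_vadd]
    exact ((hv F).symm.trans h1).eq_of_vadd_vadd h hs
  · have h1 := hv F
    rw [hRR 0 (by rwa [zero_vadd])] at h1
    -- Linked hyperfaces have the same representative, so the translation chosen for `F` serves for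
    -- `F'` too; the ratio is then read off from `s` translated by `v F`.
    have h2 : s (v F' +ᵥ F') = s (v F +ᵥ F') :=
      ((hFF.vadd (v F)).symm.trans (h1.symm.trans (hv F'))).eq_of_vadd_vadd h hs
    change s (v F +ᵥ F) * s F' = s (v F' +ᵥ F') * s F
    rw [h2]
    exact hFF _ _ (hs.comp_vadd (v F)) hs

/-- A scaling whose ratios on linked hyperfaces are those of the canonical scalings is canonical. -/
theorem IsParallelohedronTiling.isCanonicalScaling_of_isLinked
    (h : IsParallelohedronTiling P 𝒯) {s s' : hyperfaces 𝒯 → ℝ} (hs : IsCanonicalScaling 𝒯 s)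
    (hs' : ∀ F, 0 < s' F) (hss : ∀ F F', IsLinked F F' → s' F * s F' = s' F' * s F) :
    IsCanonicalScaling 𝒯 s' := by
  refine ⟨hs', fun G hG => ?_⟩
  obtain ⟨e, he, k, F, n, hn, h0⟩ := hs.2 G hG
  refine ⟨e, he, k, F, n, hn, ?_⟩
  have hinj : Function.Injective fun i => ((F i).1 : Set (EuclideanSpace ℝ (Fin d))) :=
    Subtype.val_injective.comp (Subtype.val_injective.comp F.injective)
  rcases h.torsion_dichotomy hG he hinj (fun i => (F i).1.2) (fun i => (F i).2)
    (fun A hA hGA => ⟨F.symm ⟨⟨A, hA⟩, hGA⟩, by simp only [Equiv.apply_symm_apply]⟩) hn with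
    hprop | ⟨τ, hτ, hpair⟩
  · have hlink : ∀ i j, IsLinked (F i).1 (F j).1 := fun i j t u ht hu =>
      hprop (fun i => t (F i).1) (fun i => u (F i).1) ((ht.2 G hG).sum_eq_zero hG he F hn)
        ((hu.2 G hG).sum_eq_zero hG he F hn) i j
    rcases isEmpty_or_nonempty (Fin k) with hk | ⟨⟨i⟩⟩
    · simp
    · have h1 : s (F i).1 • ∑ j, s' (F j).1 • n j = s' (F i).1 • ∑ j, s (F j).1 • n j := by
        simp only [Finset.smul_sum, smul_smul]
        refine Finset.sum_congr rfl fun j _ => ?_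
        rw [hss _ _ (hlink i j), mul_comm]
      rw [← h0, smul_zero] at h1
      exact ((smul_eq_zero.1 h1).resolve_left (hs.1 _).ne').symm
  · have hlink : ∀ t : hyperfaces 𝒯 → ℝ, IsCanonicalScaling 𝒯 t →
        ∀ i, t (F (τ i)).1 = t (F i).1 := fun t ht =>
      hpair (fun i => t (F i).1) ((ht.2 G hG).sum_eq_zero hG he F hn)
    have h1 : ∀ i, s' (F (τ i)).1 = s' (F i).1 := by
      intro i
      have h2 := hss _ _ (.of_eq fun t ht => hlink t ht i)
      rw [hlink s hs i] at h2
      exact mul_right_cancel₀ (hs.1 _).ne' h2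
    -- Opposite hyperfaces have equal values and opposite normals, so the torsion of `s'` equals its
    -- own negative.
    have h2 : ∑ i, s' (F (τ i)).1 • n (τ i) = -∑ i, s' (F i).1 • n i := by
      simp only [h1, hτ, smul_neg, Finset.sum_neg_distrib]
    rw [Equiv.sum_comp τ fun i => s' (F i).1 • n i, ← add_eq_zero_iff_eq_neg, ← two_smul ℝ] at h2
    exact ((smul_eq_zero.1 h2).resolve_left two_ne_zero).symm

end Parallelohedra

theorem mainTheorem6 {d : ℕ} (P : Set (EuclideanSpace ℝ (Fin d)))
    (𝒯 : Set (Set (EuclideanSpace ℝ (Fin d))))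
    (h𝒯 : Parallelohedra.IsParallelohedronTiling P 𝒯)
    (hs : ∃ s : Parallelohedra.hyperfaces 𝒯 → ℝ, Parallelohedra.IsCanonicalScaling 𝒯 s) :
    ∃ s' : Parallelohedra.hyperfaces 𝒯 → ℝ,
      Parallelohedra.IsCanonicalScaling 𝒯 s' ∧ Parallelohedra.IsTranslationInvariant 𝒯 s' := by
  obtain ⟨s, hs⟩ := hs
  obtain ⟨s', hpos, hinv, hss⟩ := h𝒯.exists_invariant_of_isCanonicalScaling hs
  exact ⟨s', h𝒯.isCanonicalScaling_of_isLinked hs hpos hss, hinv⟩
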